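/- Let $\mathbb K$ be an algebraically closed field, $n>2$ an integer and $q\in\mathbb K$ a primitive $n$-th root of unity. Let $H_n(1,q)$ be the Hopf algebra over $\mathbb K$ generated as an algebra by $a,b,c,d$ with relations $$ba=qab,\quad db=qbd,\quad ca=qac,\quad dc=qcd,\quad bc=cb,\quad a^n=d^n=0,\quad b^n=c^n=1,\quad da-qad=1-bc,$$ with comultiplication $\Delta(a)=a\otimes b+1\otimes a$, $\Delta(b)=b\otimes b$, $\Delta(c)=c\otimes c$, $\Delta(d)=d\otimes c+1\otimes d$, counit $\varepsilon(a)=\varepsilon(d)=0$, $\varepsilon(b)=\varepsilon(c)=1$, and antipode $S(a)=-ab^{n-1}$, $S(b)=b^{n-1}$, $S(c)=c^{n-1}$, $S(d)=-dc^{n-1}$. For a Hopf algebra $H$ the Green ring $r(H)$ is the abelian group generated by the isomorphism classes $[M]$ of finite dimensional left $H$-modules modulo the relations $[M\oplus N]=[M]+[N]$, with multiplication $[M][N]=[M\otimes N]$; the projective class ring $r_p(H)$ is the subring of $r(H)$ generated by the classes of the (finite dimensional) projective modules and of the simple modules. For $1\le l\le n$ and $r\in\mathbb Z/n\mathbb Z$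 let $V(l,r)$ be the simple $H_n(1,q)$-module with basis $v_1,\dots,v_l$ and action $av_i=v_{i+1}$ (where $v_{l+1}=0$), $bv_i=q^{r+i-1}v_i$, $cv_i=q^{i-r-l}v_i$, $dv_1=0$ and $dv_i=(1+q+\dots+q^{i-2})(1-q^{i-1-l})\,v_{i-1}$ for $2\le i\le l$. Let $I$ be the ideal of $\mathbb Z[x,y]$ generated by $x^n-1$ and $$\Bigl(\sum_{i=0}^{\lfloor n/2\rfloor}(-1)^i\tfrac{n}{n-i}\tbinom{n-i}{i}x^iy^{n-2i}-2\Bigr)\Bigl(\sum_{i=0}^{\lfloor (n-1)/2\rfloor}(-1)^i\tbinom{n-1-i}{i}x^iy^{n-1-2i}\Bigr).$$ Then there is a ring isomorphism $\mathbb Z[x,y]/I\to r_p(H_n(1,q))$ that sends the class of $x$ to $[V(1,1)]$ and the class of $y$ to $[V(2,0)]$. In particular, the elements $[V(1,1)]^l[V(2,0)]^m$ with $0\le l\le n-1$ and $0\le m\le 2n-2$ form a $\mathbb Z$-basis of $r_p(H_n(1,q))$. -/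

import Mathlib

open scoped TensorProduct

universe u v

noncomputable section

namespace Green

/-! ### Finite dimensional modules over a bialgebra -/

/-- A finite dimensional left module over the `K`-algebra `H`: a finite dimensional `K`-space
with an algebra map `ρ` to its endomorphism algebra. -/
structure FDMod (K : Type u) (H : Type v) [Field K] [Ring H] [Algebra K H] where
  carrier : Type u
  [addCommGroup : AddCommGroup carrier]
  [module : Module K carrier]
  [finite : Module.Finite K carrier]
  ρ : H →ₐ[K] Module.End K carrier

attribute [instance] FDMod.addCommGroup FDMod.module FDMod.finite

namespace FDMod

variable {K : Type u} {H : Type v} [Field K] [Ring H]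

/-- The `H`-module structure on the carrier. -/
instance instModule [Algebra K H] (M : FDMod K H) : Module H M.carrier :=
  Module.compHom M.carrier M.ρ.toRingHom

/-- Isomorphism of `H`-modules. -/
def Iso [Algebra K H] (M N : FDMod K H) : Prop :=
  ∃ e : M.carrier ≃ₗ[K] N.carrier, ∀ (h : H) (m : M.carrier), e (M.ρ h m) = N.ρ h (e m)

theorem Iso.refl [Algebra K H] (M : FDMod K H) : Iso M M :=
  ⟨LinearEquiv.refl K _, fun _ _ => rfl⟩

theorem Iso.symm [Algebra K H] {M N : FDMod K H} : Iso M N → Iso N M := by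
  rintro ⟨e, he⟩
  refine ⟨e.symm, fun h m => ?_⟩
  rw [LinearEquiv.symm_apply_eq, he, LinearEquiv.apply_symm_apply]

theorem Iso.trans [Algebra K H] {M N P : FDMod K H} : Iso M N → Iso N P → Iso M P := by
  rintro ⟨e, he⟩ ⟨f, hf⟩
  exact ⟨e.trans f, fun h m => by simp [he, hf]⟩

instance setoid (K : Type u) (H : Type v) [Field K] [Ring H] [Algebra K H] :
    Setoid (FDMod K H) where
  r := Iso
  iseqv := ⟨Iso.refl, Iso.symm, Iso.trans⟩

/-- The zero module. -/
def zero (K : Type u) (H : Type v) [Field K] [Ring H] [Algebra K H] : FDMod K H where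
  carrier := PUnit.{u + 1}
  ρ :=
    { toFun := fun _ => 0
      map_one' := Subsingleton.elim _ _
      map_mul' := fun _ _ => Subsingleton.elim _ _
      map_zero' := rfl
      map_add' := fun _ _ => Subsingleton.elim _ _
      commutes' := fun _ => Subsingleton.elim _ _ }

/-- The direct sum `M ⊕ N`. -/
def sum [Algebra K H] (M N : FDMod K H) : FDMod K H where
  carrier := M.carrier × N.carrier
  ρ := (LinearMap.prodMapAlgHom K M.carrier N.carrier).comp (M.ρ.prod N.ρ)

theorem sum_ρ [Algebra K H] (M N : FDMod K H) (h : H) (m : M.carrier) (n : N.carrier) :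
    (sum M N).ρ h (m, n) = (M.ρ h m, N.ρ h n) := rfl

/-- The trivial module: `K` with `h · k = ε(h) k`. -/
def unit (K : Type u) (H : Type v) [Field K] [Ring H] [Bialgebra K H] : FDMod K H where
  carrier := K
  ρ := (Algebra.ofId K (Module.End K K)).comp (Bialgebra.counitAlgHom K H)

section tensor

variable {A B C V W U : Type*} [Ring A] [Ring B] [Ring C]
  [AddCommGroup V] [Module K V] [AddCommGroup W] [Module K W] [AddCommGroup U] [Module K U]

/-- If `A` acts on `V` and `B` acts on `W`, then `A ⊗ B` acts on `V ⊗ W`. -/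
def act₂ [Algebra K A] [Algebra K B] (ρ : A →ₐ[K] Module.End K V) (σ : B →ₐ[K] Module.End K W) :
    A ⊗[K] B →ₐ[K] Module.End K (V ⊗[K] W) :=
  (Module.endTensorEndAlgHom (R := K) (S := K) (A := K)).comp (Algebra.TensorProduct.map ρ σ)

@[simp] theorem act₂_tmul [Algebra K A] [Algebra K B] (ρ : A →ₐ[K] Module.End K V)
    (σ : B →ₐ[K] Module.End K W) (x : A) (y : B) (m : V) (n : W) :
    act₂ ρ σ (x ⊗ₜ y) (m ⊗ₜ n) = ρ x m ⊗ₜ σ y n := by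
  simp [act₂, Module.endTensorEndAlgHom_apply]

/-- Two elements of the endomorphism algebras that intertwine on pure tensors intertwine. -/
theorem act₂_intertwine [Algebra K A] [Algebra K B] (ρ : A →ₐ[K] Module.End K V)
    (σ : B →ₐ[K] Module.End K W) (e : V ⊗[K] W →ₗ[K] U) (τ : A ⊗[K] B →ₗ[K] Module.End K U)
    (h : ∀ x y m n, e (ρ x m ⊗ₜ σ y n) = τ (x ⊗ₜ y) (e (m ⊗ₜ n)))
    (t : A ⊗[K] B) (z : V ⊗[K] W) : e (act₂ ρ σ t z) = τ t (e z) := by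
  induction t using TensorProduct.induction_on with
  | zero => simp
  | add x y hx hy => simp only [map_add, LinearMap.add_apply, hx, hy]
  | tmul x y =>
    induction z using TensorProduct.induction_on with
    | zero => simp
    | add x y hx hy => simp only [map_add, hx, hy]
    | tmul m n => rw [act₂_tmul, h]

theorem act₂_assoc [Algebra K A] [Algebra K B] [Algebra K C] (ρ : A →ₐ[K] Module.End K V)
    (σ : B →ₐ[K] Module.End K W) (τ : C →ₐ[K] Module.End K U)
    (t : (A ⊗[K] B) ⊗[K] C) (z : (V ⊗[K] W) ⊗[K] U) :
    TensorProduct.assoc K V W U (act₂ (act₂ ρ σ) τ t z) =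
      act₂ ρ (act₂ σ τ) (TensorProduct.assoc K A B C t) (TensorProduct.assoc K V W U z) := by
  refine act₂_intertwine (act₂ ρ σ) τ (TensorProduct.assoc K V W U).toLinearMap
    ((act₂ ρ (act₂ σ τ)).toLinearMap ∘ₗ (TensorProduct.assoc K A B C).toLinearMap) ?_ t z
  intro s x r p
  induction s using TensorProduct.induction_on with
  | zero => simp
  | add x y hx hy =>
    simp only [map_add, TensorProduct.add_tmul, LinearMap.add_apply, hx, hy]
  | tmul y w =>
    induction r using TensorProduct.induction_on with
    | zero => simp
    | add x y hx hy => simp only [map_add, TensorProduct.add_tmul, hx, hy]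
    | tmul m n => simp

theorem act₂_comp_left [Algebra K A] [Algebra K B] [Algebra K C] (ρ : A →ₐ[K] Module.End K V)
    (σ : B →ₐ[K] Module.End K W) (f : C →ₐ[K] A) (t : C ⊗[K] B) :
    act₂ (ρ.comp f) σ t = act₂ ρ σ (f.toLinearMap.rTensor B t) := by
  induction t using TensorProduct.induction_on with
  | zero => simp
  | add x y hx hy => simp only [map_add, hx, hy]
  | tmul x y => rfl

theorem act₂_comp_right [Algebra K A] [Algebra K B] [Algebra K C] (ρ : A →ₐ[K] Module.End K V)
    (σ : B →ₐ[K] Module.End K W) (f : C →ₐ[K] B) (t : A ⊗[K] C) :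
    act₂ ρ (σ.comp f) t = act₂ ρ σ (f.toLinearMap.lTensor A t) := by
  induction t using TensorProduct.induction_on with
  | zero => simp
  | add x y hx hy => simp only [map_add, hx, hy]
  | tmul x y => rfl

variable [Bialgebra K H]

/-- The tensor product `M ⊗ N` over `K`, on which `H` acts through the comultiplication. -/
def tensor (M N : FDMod K H) : FDMod K H where
  carrier := M.carrier ⊗[K] N.carrier
  ρ := (act₂ M.ρ N.ρ).comp (Bialgebra.comulAlgHom K H)

theorem Iso.sum {M M' N N' : FDMod K H} : Iso M M' → Iso N N' → Iso (sum M N) (sum M' N') := by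
  rintro ⟨e, he⟩ ⟨f, hf⟩
  refine ⟨e.prodCongr f, ?_⟩
  rintro h ⟨m, n⟩
  exact Prod.ext (he h m) (hf h n)

theorem Iso.tensor {M M' N N' : FDMod K H} :
    Iso M M' → Iso N N' → Iso (tensor M N) (tensor M' N') := by
  rintro ⟨e, he⟩ ⟨f, hf⟩
  exact ⟨TensorProduct.congr e f, fun h z =>
    act₂_intertwine M.ρ N.ρ (TensorProduct.congr e f).toLinearMap (act₂ M'.ρ N'.ρ).toLinearMap
      (fun x y m n => by simp [he, hf]) (Coalgebra.comul h) z⟩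

theorem sum_comm_iso (M N : FDMod K H) : Iso (sum M N) (sum N M) :=
  ⟨LinearEquiv.prodComm K _ _, fun _ _ => rfl⟩

theorem sum_assoc_iso (M N P : FDMod K H) : Iso (sum (sum M N) P) (sum M (sum N P)) :=
  ⟨LinearEquiv.prodAssoc K _ _ _, fun _ _ => rfl⟩

theorem zero_sum_iso (M : FDMod K H) : Iso (sum (zero K H) M) M :=
  ⟨(LinearEquiv.uniqueProd : (PUnit.{u + 1} × M.carrier) ≃ₗ[K] M.carrier), fun _ _ => rfl⟩

theorem unit_tensor_iso (M : FDMod K H) : Iso (tensor (unit K H) M) M := by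
  refine ⟨TensorProduct.lid K M.carrier, fun h z => ?_⟩
  have := act₂_intertwine ((Algebra.ofId K (Module.End K K)).comp (Bialgebra.counitAlgHom K H))
    M.ρ (TensorProduct.lid K M.carrier).toLinearMap
    (M.ρ.toLinearMap ∘ₗ (TensorProduct.lid K H).toLinearMap ∘ₗ Coalgebra.counit.rTensor H)
    (fun x y m n => by
      simp only [Algebra.ofId_apply, AlgHom.comp_apply, Bialgebra.counitAlgHom_apply,
        Module.algebraMap_end_apply, LinearEquiv.coe_coe, LinearMap.comp_apply,
        TensorProduct.lid_tmul, LinearMap.rTensor_tmul, AlgHom.toLinearMap_apply, map_smul, LinearMap.smul_apply,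
        smul_eq_mul, mul_smul]
      exact smul_comm _ _ _) (Coalgebra.comul h) z
  refine this.trans ?_
  simp only [LinearMap.comp_apply, Coalgebra.rTensor_counit_comul]
  simp
  rfl

theorem tensor_unit_iso (M : FDMod K H) : Iso (tensor M (unit K H)) M := by
  refine ⟨TensorProduct.rid K M.carrier, fun h z => ?_⟩
  have := act₂_intertwine M.ρ
    ((Algebra.ofId K (Module.End K K)).comp (Bialgebra.counitAlgHom K H))
    (TensorProduct.rid K M.carrier).toLinearMap
    (M.ρ.toLinearMap ∘ₗ (TensorProduct.rid K H).toLinearMap ∘ₗ Coalgebra.counit.lTensor H)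
    (fun x y m n => by
      simp only [Algebra.ofId_apply, AlgHom.comp_apply, Bialgebra.counitAlgHom_apply,
        Module.algebraMap_end_apply, LinearEquiv.coe_coe, LinearMap.comp_apply,
        TensorProduct.rid_tmul, LinearMap.lTensor_tmul, AlgHom.toLinearMap_apply, map_smul, LinearMap.smul_apply,
        smul_eq_mul, mul_smul]
      exact smul_comm _ _ _) (Coalgebra.comul h) z
  refine this.trans ?_
  simp only [LinearMap.comp_apply, Coalgebra.lTensor_counit_comul]
  simp
  rfl

theorem tensor_assoc_iso (M N P : FDMod K H) :
    Iso (tensor (tensor M N) P) (tensor M (tensor N P)) := by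
  refine ⟨TensorProduct.assoc K M.carrier N.carrier P.carrier, fun h z => ?_⟩
  have h₁ := act₂_comp_left (act₂ M.ρ N.ρ) P.ρ (Bialgebra.comulAlgHom K H) (Coalgebra.comul h)
  have h₂ := act₂_comp_right M.ρ (act₂ N.ρ P.ρ) (Bialgebra.comulAlgHom K H) (Coalgebra.comul h)
  have h₃ := act₂_assoc M.ρ N.ρ P.ρ (Coalgebra.comul.rTensor H (Coalgebra.comul h)) z
  rw [Coalgebra.coassoc_apply] at h₃
  exact ((congrArg (fun f => TensorProduct.assoc K M.carrier N.carrier P.carrier (f z)) h₁).trans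
    h₃).trans (congrArg (fun f => f (TensorProduct.assoc K M.carrier N.carrier P.carrier z)) h₂).symm

theorem sum_tensor_iso (M N P : FDMod K H) :
    Iso (tensor (sum M N) P) (sum (tensor M P) (tensor N P)) :=
  ⟨TensorProduct.prodLeft K K M.carrier N.carrier P.carrier, fun h z =>
    act₂_intertwine ((LinearMap.prodMapAlgHom K M.carrier N.carrier).comp (M.ρ.prod N.ρ)) P.ρ
      (TensorProduct.prodLeft K K M.carrier N.carrier P.carrier).toLinearMap
      ((LinearMap.prodMapAlgHom K _ _).comp ((act₂ M.ρ P.ρ).prod (act₂ N.ρ P.ρ))).toLinearMap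
      (fun x y m n => by obtain ⟨m, m'⟩ := m; simp) (Coalgebra.comul h) z⟩

theorem tensor_sum_iso (M N P : FDMod K H) :
    Iso (tensor M (sum N P)) (sum (tensor M N) (tensor M P)) :=
  ⟨TensorProduct.prodRight K K M.carrier N.carrier P.carrier, fun h z =>
    act₂_intertwine M.ρ ((LinearMap.prodMapAlgHom K N.carrier P.carrier).comp (N.ρ.prod P.ρ))
      (TensorProduct.prodRight K K M.carrier N.carrier P.carrier).toLinearMap
      ((LinearMap.prodMapAlgHom K _ _).comp ((act₂ M.ρ N.ρ).prod (act₂ M.ρ P.ρ))).toLinearMap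
      (fun x y m n => by simp) (Coalgebra.comul h) z⟩

theorem zero_tensor_iso (M : FDMod K H) : Iso (tensor (zero K H) M) (zero K H) := by
  have : Subsingleton (tensor (zero K H) M).carrier :=
    inferInstanceAs (Subsingleton (PUnit.{u + 1} ⊗[K] M.carrier))
  have : Subsingleton (zero K H).carrier := inferInstanceAs (Subsingleton PUnit.{u + 1})
  exact ⟨0, fun _ _ => Subsingleton.elim _ _⟩

theorem tensor_zero_iso (M : FDMod K H) : Iso (tensor M (zero K H)) (zero K H) := by
  have : Subsingleton (tensor M (zero K H)).carrier :=
    inferInstanceAs (Subsingleton (M.carrier ⊗[K] PUnit.{u + 1}))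
  have : Subsingleton (zero K H).carrier := inferInstanceAs (Subsingleton PUnit.{u + 1})
  exact ⟨0, fun _ _ => Subsingleton.elim _ _⟩

end tensor

end FDMod

/-! ### The Green ring -/

/-- The isomorphism classes of finite dimensional `H`-modules. -/
def IsoClass (K : Type u) (H : Type v) [Field K] [Ring H] [Bialgebra K H] : Type (max (u + 1) v) :=
  Quotient (FDMod.setoid K H)

section
variable (K : Type u) (H : Type v) [Field K] [Ring H] [Bialgebra K H]

instance : Add (IsoClass K H) :=
  ⟨Quotient.map₂ FDMod.sum fun _ _ h _ _ h' => FDMod.Iso.sum h h'⟩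

instance : Mul (IsoClass K H) :=
  ⟨Quotient.map₂ FDMod.tensor fun _ _ h _ _ h' => FDMod.Iso.tensor h h'⟩

instance : Zero (IsoClass K H) := ⟨Quotient.mk (FDMod.setoid K H) (FDMod.zero K H)⟩

instance : One (IsoClass K H) := ⟨Quotient.mk (FDMod.setoid K H) (FDMod.unit K H)⟩

/-- Isomorphism classes form a semiring under `⊕` and `⊗`. -/
instance : Semiring (IsoClass K H) where
  nsmul := nsmulRec
  npow := npowRec
  add_assoc := by
    rintro ⟨M⟩ ⟨N⟩ ⟨P⟩
    exact Quotient.sound (FDMod.sum_assoc_iso M N P)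
  zero_add := by
    rintro ⟨M⟩
    exact Quotient.sound (FDMod.zero_sum_iso M)
  add_zero := by
    rintro ⟨M⟩
    exact Quotient.sound ((FDMod.sum_comm_iso _ _).trans (FDMod.zero_sum_iso M))
  add_comm := by
    rintro ⟨M⟩ ⟨N⟩
    exact Quotient.sound (FDMod.sum_comm_iso M N)
  mul_assoc := by
    rintro ⟨M⟩ ⟨N⟩ ⟨P⟩
    exact Quotient.sound (FDMod.tensor_assoc_iso M N P)
  one_mul := by
    rintro ⟨M⟩
    exact Quotient.sound (FDMod.unit_tensor_iso M)
  mul_one := by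
    rintro ⟨M⟩
    exact Quotient.sound (FDMod.tensor_unit_iso M)
  zero_mul := by
    rintro ⟨M⟩
    exact Quotient.sound (FDMod.zero_tensor_iso M)
  mul_zero := by
    rintro ⟨M⟩
    exact Quotient.sound (FDMod.tensor_zero_iso M)
  left_distrib := by
    rintro ⟨M⟩ ⟨N⟩ ⟨P⟩
    exact Quotient.sound (FDMod.tensor_sum_iso M N P)
  right_distrib := by
    rintro ⟨M⟩ ⟨N⟩ ⟨P⟩
    exact Quotient.sound (FDMod.sum_tensor_iso M N P)

end

/-- The Grothendieck group of the additive monoid of a semiring `S`. -/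
def Completion (S : Type*) [Semiring S] : Type _ := Algebra.GrothendieckAddGroup S

namespace Completion

variable {S : Type*} [Semiring S]

instance : AddCommGroup (Completion S) :=
  inferInstanceAs (AddCommGroup (Algebra.GrothendieckAddGroup S))

/-- The canonical map of `S` to its Grothendieck group. -/
def of : S →+ Completion S := Algebra.GrothendieckAddGroup.of

/-- The universal property of the Grothendieck group. -/
def lift {G : Type*} [AddCommGroup G] (f : S →+ G) : Completion S →+ G :=
  Algebra.GrothendieckAddGroup.lift f

@[simp] theorem lift_of {G : Type*} [AddCommGroup G] (f : S →+ G) (s : S) :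
    lift f (of s) = f s :=
  DFunLike.congr_fun (Algebra.GrothendieckAddGroup.lift.symm_apply_apply f) s

theorem hom_ext {G : Type*} [AddCommGroup G] {f g : Completion S →+ G}
    (h : ∀ s, f (of s) = g (of s)) : f = g :=
  Algebra.GrothendieckAddGroup.lift.symm.injective (AddMonoidHom.ext h)

theorem ind {p : Completion S → Prop} (x : Completion S) (hof : ∀ s, p (of s))
    (hneg : ∀ x, p x → p (-x)) (hadd : ∀ x y, p x → p y → p (x + y)) : p x := by
  have hx : x ∈ (AddSubgroup.closure (Set.range (of (S := S)))) := by
    have : (QuotientAddGroup.mk' (AddSubgroup.closure (Set.range (of (S := S))))) = 0 :=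
      hom_ext fun s => by
        rw [QuotientAddGroup.mk'_apply, AddMonoidHom.zero_apply, QuotientAddGroup.eq_zero_iff]
        exact AddSubgroup.subset_closure (Set.mem_range_self s)
    exact (QuotientAddGroup.eq_zero_iff _).1 (DFunLike.congr_fun this x)
  induction hx using AddSubgroup.closure_induction with
  | mem x hx => obtain ⟨s, rfl⟩ := hx; exact hof s
  | zero => simpa using hof 0
  | add x y _ _ hx hy => exact hadd x y hx hy
  | neg x _ hx => exact hneg x hx

/-- The biadditive extension of the multiplication of `S`. -/
def mulHom : Completion S →+ Completion S →+ Completion S :=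
  lift
    { toFun := fun s => lift (of.comp (AddMonoidHom.mulLeft s))
      map_zero' := hom_ext fun t => by simp
      map_add' := fun s s' => hom_ext fun t => by simp [add_mul] }

instance : Mul (Completion S) := ⟨fun x y => mulHom x y⟩

theorem mul_def (x y : Completion S) : x * y = mulHom x y := rfl

theorem of_mul (s t : S) : of (s * t) = of s * of t := by
  simp [mul_def, mulHom]

/-- The ring structure on the Grothendieck group with `of s * of t = of (s * t)`. -/
instance : Ring (Completion S) where
  __ := (inferInstance : AddCommGroup (Completion S))
  __ := (inferInstance : Mul (Completion S))
  one := of 1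
  left_distrib x y z := by simp [mul_def]
  right_distrib x y z := by simp [mul_def]
  zero_mul x := by simp [mul_def]
  mul_zero x := by simp [mul_def]
  one_mul x := by
    change of 1 * x = x
    induction x using ind with
    | hof s => rw [← of_mul, one_mul]
    | hneg x hx => rw [mul_def] at hx ⊢; rw [map_neg, hx]
    | hadd x y hx hy => rw [mul_def] at hx hy ⊢; rw [map_add, hx, hy]
  mul_one x := by
    change x * of 1 = x
    induction x using ind with
    | hof s => rw [← of_mul, mul_one]
    | hneg x hx => rw [mul_def] at hx ⊢; rw [map_neg, AddMonoidHom.neg_apply, hx]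
    | hadd x y hx hy => rw [mul_def] at hx hy ⊢; rw [map_add, AddMonoidHom.add_apply, hx, hy]
  mul_assoc x y z := by
    induction x using ind with
    | hneg x hx => simp only [mul_def, map_neg, AddMonoidHom.neg_apply] at hx ⊢; rw [hx]
    | hadd x y hx hy =>
      simp only [mul_def, map_add, AddMonoidHom.add_apply] at hx hy ⊢; rw [hx, hy]
    | hof s =>
      induction y using ind with
      | hneg x hx => simp only [mul_def, map_neg, AddMonoidHom.neg_apply] at hx ⊢; rw [hx]
      | hadd x y hx hy =>
        simp only [mul_def, map_add, AddMonoidHom.add_apply] at hx hy ⊢; rw [hx, hy]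
      | hof t =>
        induction z using ind with
        | hneg x hx => simp only [mul_def, map_neg] at hx ⊢; rw [hx]
        | hadd x y hx hy => simp only [mul_def, map_add] at hx hy ⊢; rw [hx, hy]
        | hof r => simp only [← of_mul, mul_assoc]

end Completion

/-- The Green ring `r(H)`: the abelian group generated by the isomorphism classes `[M]` of finite
dimensional `H`-modules modulo `[M ⊕ N] = [M] + [N]`, with `[M][N] = [M ⊗ N]`. -/
abbrev GreenRing (K : Type u) (H : Type v) [Field K] [Ring H] [Bialgebra K H] :
    Type (max (u + 1) v) :=
  Completion (IsoClass K H)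

/-- The class `[M]` in the Green ring. -/
def cls {K : Type u} {H : Type v} [Field K] [Ring H] [Bialgebra K H] (M : FDMod K H) :
    GreenRing K H :=
  Completion.of (S := IsoClass K H) (Quotient.mk (FDMod.setoid K H) M)

theorem cls_sum {K : Type u} {H : Type v} [Field K] [Ring H] [Bialgebra K H] (M N : FDMod K H) :
    cls (M.sum N) = cls M + cls N :=
  (Completion.of (S := IsoClass K H)).map_add (Quotient.mk (FDMod.setoid K H) M)
    (Quotient.mk (FDMod.setoid K H) N)

theorem cls_tensor {K : Type u} {H : Type v} [Field K] [Ring H] [Bialgebra K H]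
    (M N : FDMod K H) : cls (M.tensor N) = cls M * cls N :=
  Completion.of_mul (S := IsoClass K H) (Quotient.mk (FDMod.setoid K H) M)
    (Quotient.mk (FDMod.setoid K H) N)

/-- The projective class ring `r_p(H)`: the subring of `r(H)` generated by the classes of the
projective modules and of the simple modules. -/
def projectiveClassRing (K : Type u) (H : Type v) [Field K] [Ring H] [Bialgebra K H] :
    Subring (GreenRing K H) :=
  Subring.closure
    {z | ∃ M : FDMod K H,
      (Module.Projective H M.carrier ∨ IsSimpleModule H M.carrier) ∧ z = cls M}

end Green

namespace Taft

/-! ### The Hopf algebras `H_n(p, q)` -/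

/-- The quantum integer `(m)_q = 1 + q + ⋯ + q^(m-1)`. -/
def qInt {K : Type u} [Field K] (q : K) (m : ℕ) : K := ∑ k ∈ Finset.range m, q ^ k

section qbinomial

variable {K : Type u} [Field K] (q : K)

theorem qInt_add (i j : ℕ) : qInt q (i + j) = qInt q i + q ^ i * qInt q j := by
  simp [qInt, Finset.sum_range_add, pow_add, Finset.mul_sum]

/-- The coefficient of `x ^ i * y ^ j` in `(x + y) ^ (i + j)` if `y x = q x y`. -/
def qBinom : ℕ → ℕ → K
  | 0, _ => 1
  | _ + 1, 0 => 1
  | i + 1, j + 1 => qBinom i (j + 1) + q ^ (i + 1) * qBinom (i + 1) j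
termination_by i j => i + j

/-- The quantum factorial. -/
def qFact (m : ℕ) : K := ∏ k ∈ Finset.range m, qInt q (k + 1)

theorem qFact_succ (m : ℕ) : qFact q (m + 1) = qFact q m * qInt q (m + 1) :=
  Finset.prod_range_succ _ _

theorem qBinom_zero_left (j : ℕ) : qBinom q 0 j = 1 := by simp [qBinom]

theorem qBinom_zero_right (i : ℕ) : qBinom q i 0 = 1 := by cases i <;> simp [qBinom]

theorem qBinom_succ (i j : ℕ) : qBinom q (i + 1) (j + 1) =
    qBinom q i (j + 1) + q ^ (i + 1) * qBinom q (i + 1) j := by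
  rw [qBinom]

theorem qBinom_mul_qFact : ∀ i j : ℕ,
    qBinom q i j * (qFact q i * qFact q j) = qFact q (i + j)
  | 0, j => by simp [qBinom_zero_left, qFact]
  | i + 1, 0 => by simp [qBinom_zero_right, qFact]
  | i + 1, j + 1 => by
    have h₁ := qBinom_mul_qFact i (j + 1)
    have h₂ := qBinom_mul_qFact (i + 1) j
    have e : i + (j + 1) = i + 1 + j := by ring
    rw [e] at h₁
    rw [qBinom_succ, show i + 1 + (j + 1) = (i + 1 + j) + 1 by ring, qFact_succ q (i + 1 + j),
      show i + 1 + j + 1 = (i + 1) + (j + 1) by ring, qInt_add, mul_add, ← h₁]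
    rw [h₁, ← h₂]
    rw [← h₂] at h₁
    rw [qFact_succ q j] at h₁ ⊢
    rw [qFact_succ q i] at h₁ ⊢
    linear_combination (qInt q (i + 1)) * h₁
termination_by i j => i + j

variable {q}

theorem qInt_eq_zero {n : ℕ} (hq : IsPrimitiveRoot q n) (hn : 1 < n) : qInt q n = 0 :=
  hq.geom_sum_eq_zero hn

theorem qInt_ne_zero {n m : ℕ} (hq : IsPrimitiveRoot q n) (hm : 0 < m) (hmn : m < n) :
    qInt q m ≠ 0 := by
  intro h
  have := geom_sum_mul q m
  rw [show ∑ i ∈ Finset.range m, q ^ i = qInt q m from rfl, h, zero_mul] at this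
  exact hq.pow_ne_one_of_pos_of_lt hm.ne' hmn (sub_eq_zero.1 this.symm)

theorem qFact_ne_zero {n m : ℕ} (hq : IsPrimitiveRoot q n) (hmn : m < n) : qFact q m ≠ 0 :=
  Finset.prod_ne_zero_iff.2 fun k hk =>
    qInt_ne_zero hq k.succ_pos (by have := Finset.mem_range.1 hk; omega)

theorem qBinom_eq_zero {n i j : ℕ} (hq : IsPrimitiveRoot q n) (h : i + j = n) (hi : i ≠ 0)
    (hj : j ≠ 0) : qBinom q i j = 0 := by
  have h₁ := qBinom_mul_qFact q i j
  obtain ⟨m, rfl⟩ : ∃ m, n = m + 1 := ⟨n - 1, by omega⟩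
  rw [h, qFact_succ, qInt_eq_zero hq (by omega), mul_zero] at h₁
  exact (mul_eq_zero.1 h₁).resolve_right
    (mul_ne_zero (qFact_ne_zero hq (by omega)) (qFact_ne_zero hq (by omega)))

variable {R : Type*} [Ring R] [Algebra K R] {x y : R}

theorem mul_pow_of_qcomm (h : y * x = q • (x * y)) (k : ℕ) : y * x ^ k = q ^ k • (x ^ k * y) := by
  induction k with
  | zero => simp
  | succ k ih =>
    rw [pow_succ x, ← mul_assoc, ih, smul_mul_assoc, mul_assoc, h, mul_smul_comm, smul_smul,
      pow_succ q, mul_assoc]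

theorem add_pow_of_qcomm (h : y * x = q • (x * y)) (m : ℕ) :
    (x + y) ^ m = ∑ p ∈ Finset.HasAntidiagonal.antidiagonal m, qBinom q p.1 p.2 • (x ^ p.1 * y ^ p.2) := by
  induction m with
  | zero => simp [qBinom_zero_left]
  | succ m ih =>
    have hx : x * ∑ p ∈ Finset.HasAntidiagonal.antidiagonal m, qBinom q p.1 p.2 • (x ^ p.1 * y ^ p.2) =
        ∑ p ∈ Finset.HasAntidiagonal.antidiagonal m, qBinom q p.1 p.2 • (x ^ (p.1 + 1) * y ^ p.2) := by
      rw [Finset.mul_sum]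
      refine Finset.sum_congr rfl fun p _ => ?_
      rw [mul_smul_comm, ← mul_assoc, ← pow_succ']
    have hy : y * ∑ p ∈ Finset.HasAntidiagonal.antidiagonal m, qBinom q p.1 p.2 • (x ^ p.1 * y ^ p.2) =
        ∑ p ∈ Finset.HasAntidiagonal.antidiagonal m, (q ^ p.1 * qBinom q p.1 p.2) • (x ^ p.1 * y ^ (p.2 + 1)) := by
      rw [Finset.mul_sum]
      refine Finset.sum_congr rfl fun p _ => ?_
      rw [mul_smul_comm, ← mul_assoc, mul_pow_of_qcomm h, smul_mul_assoc, smul_smul, mul_assoc,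
        ← pow_succ', mul_comm]
    rw [pow_succ', ih, add_mul, hx, hy]
    let f : ℕ × ℕ → K := fun p => if p.1 = 0 then 0 else qBinom q (p.1 - 1) p.2
    let g : ℕ × ℕ → K := fun p => if p.2 = 0 then 0 else q ^ p.1 * qBinom q p.1 (p.2 - 1)
    have hfg : ∀ p ∈ Finset.HasAntidiagonal.antidiagonal (m + 1),
        qBinom q p.1 p.2 • (x ^ p.1 * y ^ p.2) =
          f p • (x ^ p.1 * y ^ p.2) + g p • (x ^ p.1 * y ^ p.2) := by
      rintro ⟨i, j⟩ hp
      rw [Finset.HasAntidiagonal.mem_antidiagonal] at hp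
      rw [← add_smul]
      congr 1
      cases i with
      | zero =>
        have : j ≠ 0 := by rintro rfl; simp at hp
        simp [f, g, qBinom_zero_left, this]
      | succ i =>
        cases j with
        | zero => simp [f, g, qBinom_zero_right]
        | succ j => simp [f, g, qBinom_succ]
    rw [Finset.sum_congr rfl hfg, Finset.sum_add_distrib, Finset.Nat.sum_antidiagonal_succ,
      Finset.Nat.sum_antidiagonal_succ' (f := fun p => g p • (x ^ p.1 * y ^ p.2))]
    simp [f, g]

theorem add_pow_of_primitive {n : ℕ} (hq : IsPrimitiveRoot q n) (hx : x ^ n = 0) (hy : y ^ n = 0)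
    (h : y * x = q • (x * y)) : (x + y) ^ n = 0 := by
  rw [add_pow_of_qcomm h]
  refine Finset.sum_eq_zero fun p hp => ?_
  rw [Finset.HasAntidiagonal.mem_antidiagonal] at hp
  by_cases h1 : p.1 = 0
  · rw [h1, zero_add] at hp
    rw [hp, hy, mul_zero, smul_zero]
  by_cases h2 : p.2 = 0
  · rw [h2, add_zero] at hp
    rw [hp, hx, zero_mul, smul_zero]
  rw [qBinom_eq_zero hq hp h1 h2, zero_smul]

end qbinomial

/-- The four generators `a, b, c, d`. -/
inductive Gen
  | a | b | c | d

/-- The defining relations of `H_n(p, q)` for four elements of a `K`-algebra. -/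
structure Relations {K : Type u} [Field K] (n : ℕ) (p q : K) {R : Type*} [Ring R] [Algebra K R]
    (a b c d : R) : Prop where
  ba : b * a = q • (a * b)
  db : d * b = q • (b * d)
  ca : c * a = q • (a * c)
  dc : d * c = q • (c * d)
  bc : b * c = c * b
  an : a ^ n = 0
  bn : b ^ n = 1
  cn : c ^ n = 1
  dn : d ^ n = 0
  da : d * a - q • (a * d) = p • (1 - b * c)

open FreeAlgebra in
/-- The defining relations of `H_n(p, q)` in the free algebra on `a, b, c, d`. -/
inductive Rel {K : Type u} [Field K] (n : ℕ) (p q : K) :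
    FreeAlgebra K Gen → FreeAlgebra K Gen → Prop
  | ba : Rel n p q (ι K Gen.b * ι K Gen.a) (q • (ι K Gen.a * ι K Gen.b))
  | db : Rel n p q (ι K Gen.d * ι K Gen.b) (q • (ι K Gen.b * ι K Gen.d))
  | ca : Rel n p q (ι K Gen.c * ι K Gen.a) (q • (ι K Gen.a * ι K Gen.c))
  | dc : Rel n p q (ι K Gen.d * ι K Gen.c) (q • (ι K Gen.c * ι K Gen.d))
  | bc : Rel n p q (ι K Gen.b * ι K Gen.c) (ι K Gen.c * ι K Gen.b)
  | an : Rel n p q (ι K Gen.a ^ n) 0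
  | bn : Rel n p q (ι K Gen.b ^ n) 1
  | cn : Rel n p q (ι K Gen.c ^ n) 1
  | dn : Rel n p q (ι K Gen.d ^ n) 0
  | da : Rel n p q (ι K Gen.d * ι K Gen.a - q • (ι K Gen.a * ι K Gen.d))
      (p • (1 - ι K Gen.b * ι K Gen.c))

/-- The algebra `H_n(p, q)`, presented by the generators `a, b, c, d` and the relations `Rel`. -/
def Hn {K : Type u} [Field K] (n : ℕ) (p q : K) : Type u := RingQuot (Rel n p q)

namespace Hn

variable {K : Type u} [Field K] {n : ℕ} {p q : K}

instance : Ring (Hn n p q) := inferInstanceAs (Ring (RingQuot (Rel n p q)))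

instance : Algebra K (Hn n p q) := inferInstanceAs (Algebra K (RingQuot (Rel n p q)))

variable (n p q) in
/-- The generators of `H_n(p, q)`. -/
def gen (g : Gen) : Hn n p q := RingQuot.mkAlgHom K (Rel n p q) (FreeAlgebra.ι K g)

variable (n p q) in
theorem relations : Relations n p q (gen n p q .a) (gen n p q .b) (gen n p q .c) (gen n p q .d) where
  ba := by simpa using! RingQuot.mkAlgHom_rel K (Rel.ba (n := n) (p := p) (q := q))
  db := by simpa using! RingQuot.mkAlgHom_rel K (Rel.db (n := n) (p := p) (q := q))
  ca := by simpa using! RingQuot.mkAlgHom_rel K (Rel.ca (n := n) (p := p) (q := q))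
  dc := by simpa using! RingQuot.mkAlgHom_rel K (Rel.dc (n := n) (p := p) (q := q))
  bc := by simpa using! RingQuot.mkAlgHom_rel K (Rel.bc (n := n) (p := p) (q := q))
  an := by simpa using! RingQuot.mkAlgHom_rel K (Rel.an (n := n) (p := p) (q := q))
  bn := by simpa using! RingQuot.mkAlgHom_rel K (Rel.bn (n := n) (p := p) (q := q))
  cn := by simpa using! RingQuot.mkAlgHom_rel K (Rel.cn (n := n) (p := p) (q := q))
  dn := by simpa using! RingQuot.mkAlgHom_rel K (Rel.dn (n := n) (p := p) (q := q))
  da := by simpa using! RingQuot.mkAlgHom_rel K (Rel.da (n := n) (p := p) (q := q))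

section lift

variable {R : Type*} [Ring R] [Algebra K R] {a b c d : R}

/-- The values of an algebra map on the generators. -/
def vals (a b c d : R) : Gen → R
  | .a => a
  | .b => b
  | .c => c
  | .d => d

/-- The universal property of the presentation. -/
def lift (h : Relations n p q a b c d) : Hn n p q →ₐ[K] R :=
  RingQuot.liftAlgHom K ⟨FreeAlgebra.lift K (vals a b c d), by
    intro x y hxy
    cases hxy
    · simpa [vals] using h.ba
    · simpa [vals] using h.db
    · simpa [vals] using h.ca
    · simpa [vals] using h.dc
    · simpa [vals] using h.bc
    · simpa [vals] using h.an
    · simpa [vals] using h.bn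
    · simpa [vals] using h.cn
    · simpa [vals] using h.dn
    · simpa [vals] using h.da⟩

theorem lift_gen (h : Relations n p q a b c d) (g : Gen) :
    lift h (gen n p q g) = vals a b c d g :=
  (RingQuot.liftAlgHom_mkAlgHom_apply K _ _ _).trans (FreeAlgebra.lift_ι_apply _ _)

theorem algHom_ext {f g : Hn n p q →ₐ[K] R} (h : ∀ x, f (gen n p q x) = g (gen n p q x)) :
    f = g := by
  refine RingQuot.ringQuot_ext' K f g (FreeAlgebra.hom_ext ?_)
  funext x
  exact h x

end lift

/-- An induction principle: a subalgebra containing the generators is everything. -/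
theorem gen_induction (S : Subalgebra K (Hn n p q)) (h : ∀ g, gen n p q g ∈ S) (x : Hn n p q) :
    x ∈ S := by
  obtain ⟨x, rfl⟩ := RingQuot.mkAlgHom_surjective K (Rel n p q) x
  induction x using FreeAlgebra.induction with
  | grade0 r => exact (AlgHom.commutes (RingQuot.mkAlgHom K (Rel n p q)) r) ▸ S.algebraMap_mem r
  | grade1 g => exact h g
  | mul x y hx hy => rw [map_mul]; exact S.mul_mem hx hy
  | add x y hx hy => rw [map_add]; exact S.add_mem hx hy

end Hn

/-! ### The Hopf algebra structure -/

section hopf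

variable {K : Type u} [Field K] {n : ℕ} {p q : K}

/-- The images of `a, b, c, d` under the comultiplication satisfy the defining relations. -/
theorem Relations.comul {R : Type*} [Ring R] [Algebra K R] {a b c d : R}
    (h : Relations n p q a b c d) (hq : IsPrimitiveRoot q n) :
    Relations n p q (a ⊗ₜ[K] b + 1 ⊗ₜ[K] a) (b ⊗ₜ[K] b) (c ⊗ₜ[K] c)
      (d ⊗ₜ[K] c + 1 ⊗ₜ[K] d) where
  ba := by
    simp only [mul_add, add_mul, Algebra.TensorProduct.tmul_mul_tmul, h.ba, mul_one, one_mul,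
      smul_add, TensorProduct.tmul_smul, TensorProduct.smul_tmul']
  db := by
    simp only [mul_add, add_mul, Algebra.TensorProduct.tmul_mul_tmul, h.db, h.bc, mul_one, one_mul,
      smul_add, TensorProduct.tmul_smul, TensorProduct.smul_tmul']
  ca := by
    simp only [mul_add, add_mul, Algebra.TensorProduct.tmul_mul_tmul, h.ca, h.bc, mul_one, one_mul,
      smul_add, TensorProduct.tmul_smul, TensorProduct.smul_tmul']
  dc := by
    simp only [mul_add, add_mul, Algebra.TensorProduct.tmul_mul_tmul, h.dc, mul_one, one_mul,
      smul_add, TensorProduct.tmul_smul, TensorProduct.smul_tmul']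
  bc := by simp only [Algebra.TensorProduct.tmul_mul_tmul, h.bc]
  an := by
    rw [add_comm]
    refine add_pow_of_primitive hq ?_ ?_ ?_
    · rw [Algebra.TensorProduct.tmul_pow, h.an, TensorProduct.tmul_zero]
    · rw [Algebra.TensorProduct.tmul_pow, h.an, TensorProduct.zero_tmul]
    · simp only [Algebra.TensorProduct.tmul_mul_tmul, h.ba, mul_one, one_mul,
        TensorProduct.tmul_smul]
  bn := by rw [Algebra.TensorProduct.tmul_pow, h.bn, Algebra.TensorProduct.one_def]
  cn := by rw [Algebra.TensorProduct.tmul_pow, h.cn, Algebra.TensorProduct.one_def]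
  dn := by
    refine add_pow_of_primitive hq ?_ ?_ ?_
    · rw [Algebra.TensorProduct.tmul_pow, h.dn, TensorProduct.zero_tmul]
    · rw [Algebra.TensorProduct.tmul_pow, h.dn, TensorProduct.tmul_zero]
    · simp only [Algebra.TensorProduct.tmul_mul_tmul, h.dc, mul_one, one_mul,
        TensorProduct.tmul_smul]
  da := by
    have hda : d * a = q • (a * d) + p • (1 - b * c) := by rw [← h.da]; abel
    simp only [mul_add, add_mul, Algebra.TensorProduct.tmul_mul_tmul, h.db, h.ca, h.bc, mul_one,
      one_mul, hda, smul_add, smul_sub, TensorProduct.tmul_smul, TensorProduct.smul_tmul',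
      TensorProduct.add_tmul, TensorProduct.tmul_add, TensorProduct.sub_tmul,
      TensorProduct.tmul_sub, Algebra.TensorProduct.one_def]
    abel

/-- The values `0, 1, 1, 0` of the counit satisfy the defining relations. -/
theorem Relations.counit [NeZero n] : Relations n p q (0 : K) 1 1 0 where
  ba := by simp
  db := by simp
  ca := by simp
  dc := by simp
  bc := by simp
  an := by simp [NeZero.ne n]
  bn := by simp
  cn := by simp
  dn := by simp [NeZero.ne n]
  da := by simp

open MulOpposite in
/-- The images of `a, b, c, d` under the antipode satisfy the defining relations in the opposite
algebra. -/
theorem Relations.antipode {R : Type*} [Ring R] [Algebra K R] {a b c d : R} [NeZero n]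
    (h : Relations n p q a b c d) (hq : IsPrimitiveRoot q n) :
    Relations n p q (op (-(a * b ^ (n - 1)))) (op (b ^ (n - 1))) (op (c ^ (n - 1)))
      (op (-(d * c ^ (n - 1)))) := by
  have hq0 : q ≠ 0 := hq.ne_zero (NeZero.ne n)
  have hn : n - 1 + 1 = n := Nat.succ_pred_eq_of_pos (NeZero.pos n)
  have bB : b * b ^ (n - 1) = 1 := by rw [← pow_succ', hn, h.bn]
  have Bb : b ^ (n - 1) * b = 1 := by rw [← pow_succ, hn, h.bn]
  have cC : c * c ^ (n - 1) = 1 := by rw [← pow_succ', hn, h.cn]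
  have Cc : c ^ (n - 1) * c = 1 := by rw [← pow_succ, hn, h.cn]
  have BC : b ^ (n - 1) * c ^ (n - 1) = c ^ (n - 1) * b ^ (n - 1) :=
    (Commute.pow_pow (show Commute b c from h.bc) _ _)
  have hBn : (b ^ (n - 1)) ^ n = 1 := by rw [← pow_mul, mul_comm, pow_mul, h.bn, one_pow]
  have hCn : (c ^ (n - 1)) ^ n = 1 := by rw [← pow_mul, mul_comm, pow_mul, h.cn, one_pow]
  have bC : Commute b (c ^ (n - 1)) := Commute.pow_right h.bc _
  have cB : Commute c (b ^ (n - 1)) := Commute.pow_right (Commute.symm h.bc) _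
  generalize b ^ (n - 1) = B at *
  generalize c ^ (n - 1) = C at *
  have aux : ∀ {x y Y : R}, y * Y = 1 → Y * y = 1 → y * x = q • (x * y) →
      x * Y = q • (Y * x) := by
    intro x y Y h₁ h₂ h₃
    calc x * Y = Y * (y * x) * Y := by rw [← mul_assoc, h₂, one_mul]
      _ = q • (Y * x) := by
        rw [h₃, mul_smul_comm, smul_mul_assoc, mul_assoc, mul_assoc, h₁, mul_one]
  have aux' : ∀ {x y Y : R}, y * Y = 1 → Y * y = 1 → x * y = q • (y * x) →
      Y * x = q • (x * Y) := by
    intro x y Y h₁ h₂ h₃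
    calc Y * x = Y * (x * y) * Y := by rw [mul_assoc, mul_assoc, h₁, mul_one]
      _ = q • (x * Y) := by
        rw [h₃, mul_smul_comm, smul_mul_assoc, ← mul_assoc Y, h₂, one_mul]
  have aB : a * B = q • (B * a) := aux bB Bb h.ba
  have aC : a * C = q • (C * a) := aux cC Cc h.ca
  have Bd : B * d = q • (d * B) := aux' bB Bb h.db
  have Cd : C * d = q • (d * C) := aux' cC Cc h.dc
  have hnil : ∀ {x Y : R} {r : K}, r ≠ 0 → x * Y = r • (Y * x) → x ^ n = 0 →
      (x * Y) ^ n = 0 := by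
    intro x Y r hr hxY hx
    have hYx : Y * x = r⁻¹ • (x * Y) := by rw [hxY, smul_smul, inv_mul_cancel₀ hr, one_smul]
    have : ∀ m : ℕ, ∃ s : K, (x * Y) ^ m = s • (x ^ m * Y ^ m) := by
      intro m
      induction m with
      | zero => exact ⟨1, by simp⟩
      | succ m ih =>
        obtain ⟨s, hs⟩ := ih
        refine ⟨(r⁻¹) ^ m * s, ?_⟩
        rw [pow_succ', hs, mul_smul_comm, mul_assoc x Y, ← mul_assoc Y, mul_pow_of_qcomm hYx,
          smul_mul_assoc, mul_smul_comm, smul_smul, mul_assoc (x ^ m) Y, ← pow_succ', ← mul_assoc,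
          ← pow_succ', mul_comm]
    obtain ⟨s, hs⟩ := this n
    rw [hs, hx, zero_mul, smul_zero]
  refine ⟨?_, ?_, ?_, ?_, ?_, ?_, ?_, ?_, ?_, ?_⟩
  · rw [← op_mul, ← op_mul, ← op_smul, neg_mul, mul_neg, ← mul_assoc, smul_neg, aB,
      smul_mul_assoc]
  · rw [← op_mul, ← op_mul, ← op_smul, neg_mul, mul_neg, ← mul_assoc, Bd, smul_mul_assoc,
      mul_assoc, mul_assoc, BC, smul_neg]
  · rw [← op_mul, ← op_mul, ← op_smul, neg_mul, mul_neg, mul_assoc, BC, ← mul_assoc, aC,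
      smul_mul_assoc, smul_neg, mul_assoc]
  · rw [← op_mul, ← op_mul, ← op_smul, neg_mul, mul_neg, ← mul_assoc, Cd, smul_mul_assoc, smul_neg]
  · rw [← op_mul, ← op_mul, BC]
  · rw [← op_pow, neg_pow, hnil hq0 aB h.an, mul_zero, op_zero]
  · rw [← op_pow, hBn, op_one]
  · rw [← op_pow, hCn, op_one]
  · rw [← op_pow, neg_pow, hnil (r := q⁻¹) (inv_ne_zero hq0) ?_ h.dn, mul_zero, op_zero]
    rw [Cd, smul_smul, inv_mul_cancel₀ hq0, one_smul]
  · rw [← op_mul, ← op_mul, ← op_mul, ← op_smul, ← op_one, ← op_sub, ← op_sub, ← op_smul, neg_mul_neg,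
      neg_mul_neg]
    congr 1
    have e₁ : a * B * (d * C) = q • (a * d * (B * C)) := by
      rw [mul_assoc, ← mul_assoc B, Bd, smul_mul_assoc, mul_smul_comm, mul_assoc, mul_assoc]
    have e₂ : q • (d * C * (a * B)) = d * a * (B * C) := by
      rw [mul_assoc, ← mul_assoc C, ← mul_smul_comm, ← smul_mul_assoc, ← aC, mul_assoc, mul_assoc,
        BC]
    have e₃ : b * c * (B * C) = 1 := by
      rw [mul_assoc, ← mul_assoc c, cB.eq, mul_assoc, cC, mul_one, bB]
    rw [e₁, e₂, ← smul_mul_assoc, ← sub_mul, ← neg_sub, h.da, neg_mul, smul_mul_assoc, sub_mul, e₃,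
      one_mul, ← smul_neg, neg_sub, BC]

variable [NeZero n] [hq : Fact (IsPrimitiveRoot q n)]

/-- `Δ(a) = a ⊗ b + 1 ⊗ a`, `Δ(b) = b ⊗ b`, `Δ(c) = c ⊗ c`, `Δ(d) = d ⊗ c + 1 ⊗ d` and
`ε(a) = ε(d) = 0`, `ε(b) = ε(c) = 1`. -/
instance Hn.instBialgebra : Bialgebra K (Hn n p q) :=
  Bialgebra.ofAlgHom (Hn.lift ((Hn.relations n p q).comul hq.out)) (Hn.lift Relations.counit)
    (by
      refine Hn.algHom_ext fun g => ?_
      cases g <;>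
        simp [Hn.lift_gen, Hn.vals, TensorProduct.add_tmul, TensorProduct.tmul_add,
          Algebra.TensorProduct.one_def, add_assoc])
    (by
      refine Hn.algHom_ext fun g => ?_
      cases g <;> simp [Hn.lift_gen, Hn.vals])
    (by
      refine Hn.algHom_ext fun g => ?_
      cases g <;> simp [Hn.lift_gen, Hn.vals])

theorem Hn.comul_eq (x : Hn n p q) :
    Coalgebra.comul (R := K) x = Hn.lift ((Hn.relations n p q).comul hq.out) x := rfl

theorem Hn.counit_eq (x : Hn n p q) :
    Coalgebra.counit (R := K) x = Hn.lift (n := n) (p := p) (q := q) Relations.counit x := rfl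

variable (n p q) in
/-- `S(a) = -a b^(n-1)`, `S(b) = b^(n-1)`, `S(c) = c^(n-1)`, `S(d) = -d c^(n-1)`, as an algebra
map to the opposite algebra. -/
def Hn.antipodeHom : Hn n p q →ₐ[K] (Hn n p q)ᵐᵒᵖ :=
  Hn.lift ((Hn.relations n p q).antipode hq.out)

variable (n p q) in
/-- The antipode of `H_n(p, q)`. -/
def Hn.antipodeLin : Hn n p q →ₗ[K] Hn n p q :=
  (MulOpposite.opLinearEquiv K).symm.toLinearMap ∘ₗ (Hn.antipodeHom n p q).toLinearMap

theorem Hn.antipodeLin_mul (x y : Hn n p q) :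
    Hn.antipodeLin n p q (x * y) = Hn.antipodeLin n p q y * Hn.antipodeLin n p q x := by
  simp [Hn.antipodeLin]

theorem Hn.antipodeLin_one : Hn.antipodeLin n p q 1 = 1 := by
  simp [Hn.antipodeLin]

theorem Hn.antipode_left (x : Hn n p q) :
    LinearMap.mul' K (Hn n p q) ((Hn.antipodeLin n p q).rTensor _ (Coalgebra.comul x)) =
      algebraMap K _ (Coalgebra.counit x) := by
  let f := LinearMap.mul' K (Hn n p q) ∘ₗ (Hn.antipodeLin n p q).rTensor (Hn n p q)
  have hf : ∀ (t : Hn n p q ⊗[K] Hn n p q) (x y : Hn n p q),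
      f (t * x ⊗ₜ y) = Hn.antipodeLin n p q x * f t * y := by
    intro t x y
    induction t using TensorProduct.induction_on with
    | zero => simp
    | add s t hs ht => simp only [add_mul, mul_add, map_add, hs, ht]
    | tmul z w => simp [f, Hn.antipodeLin_mul, mul_assoc]
  let S : Subalgebra K (Hn n p q) :=
    { carrier := {x | f (Coalgebra.comul x) = algebraMap K _ (Coalgebra.counit (R := K) x)}
      mul_mem' := by
        intro x y hx hy
        simp only [Set.mem_ofPred_eq] at hx hy ⊢
        have : ∀ s, f (Coalgebra.comul x * s) =
            algebraMap K _ (Coalgebra.counit (R := K) x) * f s := by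
          intro s
          induction s using TensorProduct.induction_on with
          | zero => simp
          | add s t hs ht => simp only [mul_add, map_add, hs, ht]
          | tmul z w =>
            rw [hf, hx, ← Algebra.commutes, mul_assoc]
            simp [f]
        rw [Bialgebra.comul_mul, this, hy, Bialgebra.counit_mul, map_mul]
      add_mem' := by
        intro x y hx hy
        simp only [Set.mem_ofPred_eq] at hx hy ⊢
        simp only [map_add, hx, hy]
      algebraMap_mem' := by
        intro r
        have h1 : f 1 = 1 := by simp [f, Algebra.TensorProduct.one_def, Hn.antipodeLin_one]
        simp only [Set.mem_ofPred_eq, Algebra.algebraMap_eq_smul_one, map_smul,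
          Bialgebra.comul_one, Bialgebra.counit_one, h1, smul_eq_mul, mul_one] }
  refine Hn.gen_induction S (fun g => ?_) x
  change f (Coalgebra.comul (gen n p q g)) = algebraMap K _ (Coalgebra.counit (R := K) (gen n p q g))
  have hn : n - 1 + 1 = n := Nat.succ_pred_eq_of_pos (NeZero.pos n)
  have h := Hn.relations n p q
  rw [Hn.comul_eq, Hn.counit_eq, Hn.lift_gen, Hn.lift_gen]
  cases g
  · simp [f, Hn.vals, Hn.antipodeLin, Hn.antipodeHom, Hn.lift_gen, mul_assoc,
      ← pow_succ, hn, h.bn]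
  · simp [f, Hn.vals, Hn.antipodeLin, Hn.antipodeHom, Hn.lift_gen, ← pow_succ, hn, h.bn]
  · simp [f, Hn.vals, Hn.antipodeLin, Hn.antipodeHom, Hn.lift_gen, ← pow_succ, hn, h.cn]
  · simp [f, Hn.vals, Hn.antipodeLin, Hn.antipodeHom, Hn.lift_gen, mul_assoc,
      ← pow_succ, hn, h.cn]

theorem Hn.antipode_right (x : Hn n p q) :
    LinearMap.mul' K (Hn n p q) ((Hn.antipodeLin n p q).lTensor _ (Coalgebra.comul x)) =
      algebraMap K _ (Coalgebra.counit x) := by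
  let f := LinearMap.mul' K (Hn n p q) ∘ₗ (Hn.antipodeLin n p q).lTensor (Hn n p q)
  have hf : ∀ (t : Hn n p q ⊗[K] Hn n p q) (x y : Hn n p q),
      f (x ⊗ₜ y * t) = x * f t * Hn.antipodeLin n p q y := by
    intro t x y
    induction t using TensorProduct.induction_on with
    | zero => simp
    | add s t hs ht => simp only [add_mul, mul_add, map_add, hs, ht]
    | tmul z w => simp [f, Hn.antipodeLin_mul, mul_assoc]
  let S : Subalgebra K (Hn n p q) :=
    { carrier := {x | f (Coalgebra.comul x) = algebraMap K _ (Coalgebra.counit (R := K) x)}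
      mul_mem' := by
        intro x y hx hy
        simp only [Set.mem_ofPred_eq] at hx hy ⊢
        have : ∀ s, f (s * Coalgebra.comul y) =
            f s * algebraMap K _ (Coalgebra.counit (R := K) y) := by
          intro s
          induction s using TensorProduct.induction_on with
          | zero => simp
          | add s t hs ht => simp only [add_mul, map_add, hs, ht]
          | tmul z w =>
            rw [hf, hy, mul_assoc, Algebra.commutes, ← mul_assoc]
            simp [f]
        rw [Bialgebra.comul_mul, this, hx, Bialgebra.counit_mul, map_mul]
      add_mem' := by
        intro x y hx hy
        simp only [Set.mem_ofPred_eq] at hx hy ⊢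
        simp only [map_add, hx, hy]
      algebraMap_mem' := by
        intro r
        have h1 : f 1 = 1 := by simp [f, Algebra.TensorProduct.one_def, Hn.antipodeLin_one]
        simp only [Set.mem_ofPred_eq, Algebra.algebraMap_eq_smul_one, map_smul,
          Bialgebra.comul_one, Bialgebra.counit_one, h1, smul_eq_mul, mul_one] }
  refine Hn.gen_induction S (fun g => ?_) x
  change f (Coalgebra.comul (gen n p q g)) = algebraMap K _ (Coalgebra.counit (R := K) (gen n p q g))
  have hn : n - 1 + 1 = n := Nat.succ_pred_eq_of_pos (NeZero.pos n)
  have h := Hn.relations n p q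
  rw [Hn.comul_eq, Hn.counit_eq, Hn.lift_gen, Hn.lift_gen]
  cases g
  · simp [f, Hn.vals, Hn.antipodeLin, Hn.antipodeHom, Hn.lift_gen]
  · simp [f, Hn.vals, Hn.antipodeLin, Hn.antipodeHom, Hn.lift_gen, ← pow_succ', hn, h.bn]
  · simp [f, Hn.vals, Hn.antipodeLin, Hn.antipodeHom, Hn.lift_gen, ← pow_succ', hn, h.cn]
  · simp [f, Hn.vals, Hn.antipodeLin, Hn.antipodeHom, Hn.lift_gen]

/-- `H_n(p, q)` is a Hopf algebra. -/
instance Hn.instHopfAlgebra : HopfAlgebra K (Hn n p q) where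
  antipode := Hn.antipodeLin n p q
  mul_antipode_rTensor_comul := LinearMap.ext Hn.antipode_left
  mul_antipode_lTensor_comul := LinearMap.ext Hn.antipode_right

end hopf

/-! ### The modules `V(l, r)` -/

section simple

variable {K : Type u} [Field K] (q : K) (l : ℕ) (r : ℤ)

/-- The standard basis vectors `v_0, …, v_{l-1}` of `K ^ l`, with `v_k = 0` for `k ≥ l`. -/
def vec (K : Type u) [Field K] (l k : ℕ) : Fin l → K :=
  if h : k < l then Pi.single ⟨k, h⟩ 1 else 0

/-- `a v_i = v_{i+1}`, where `v_l = 0`. -/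
def opA (K : Type u) [Field K] (l : ℕ) : Module.End K (Fin l → K) :=
  (Pi.basisFun K (Fin l)).constr K fun i => vec K l (i + 1)

/-- `b v_i = q^(r+i) v_i`. -/
def opB : Module.End K (Fin l → K) :=
  (Pi.basisFun K (Fin l)).constr K fun i => q ^ (r + (i : ℕ)) • vec K l i

/-- `c v_i = q^(i+1-r-l) v_i`. -/
def opC : Module.End K (Fin l → K) :=
  (Pi.basisFun K (Fin l)).constr K fun i => q ^ ((i : ℕ) + 1 - r - l : ℤ) • vec K l i

/-- `d v_i = (i)_q (1 - q^(i-l)) v_{i-1}`, which is `0` for `i = 0`. -/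
def opD : Module.End K (Fin l → K) :=
  (Pi.basisFun K (Fin l)).constr K fun i =>
    (qInt q i * (1 - q ^ ((i : ℕ) - l : ℤ))) • vec K l (i - 1)

theorem vec_of_le {k : ℕ} (h : l ≤ k) : vec K l k = 0 := dif_neg (by omega)

theorem vec_coe (i : Fin l) : vec K l i = Pi.single i 1 := by simp [vec]

theorem constr_vec (f : ℕ → Fin l → K) {k : ℕ} (hk : k < l) :
    ((Pi.basisFun K (Fin l)).constr K fun i => f i) (vec K l k) = f k := by
  have := (Pi.basisFun K (Fin l)).constr_basis K (fun i => f i) ⟨k, hk⟩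
  rwa [Pi.basisFun_apply, ← vec_coe] at this

theorem opA_vec (k : ℕ) : opA K l (vec K l k) = vec K l (k + 1) := by
  by_cases hk : k < l
  · exact constr_vec l (fun k => vec K l (k + 1)) hk
  · rw [vec_of_le l (by omega), vec_of_le l (by omega), map_zero]

theorem opB_vec (k : ℕ) : opB q l r (vec K l k) = q ^ (r + k) • vec K l k := by
  by_cases hk : k < l
  · exact constr_vec l (fun k => q ^ (r + k) • vec K l k) hk
  · rw [vec_of_le l (by omega), map_zero, smul_zero]

theorem opC_vec (k : ℕ) : opC q l r (vec K l k) = q ^ (k + 1 - r - l : ℤ) • vec K l k := by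
  by_cases hk : k < l
  · exact constr_vec l (fun k => q ^ (k + 1 - r - l : ℤ) • vec K l k) hk
  · rw [vec_of_le l (by omega), map_zero, smul_zero]

theorem opD_vec {k : ℕ} (hk : k ≤ l) :
    opD q l (vec K l k) = (qInt q k * (1 - q ^ (k - l : ℤ))) • vec K l (k - 1) := by
  rcases hk.lt_or_eq with hk | rfl
  · exact constr_vec l (fun k => (qInt q k * (1 - q ^ (k - l : ℤ))) • vec K l (k - 1)) hk
  · rw [vec_of_le k le_rfl, map_zero]; simp

theorem end_ext {f g : Module.End K (Fin l → K)}
    (h : ∀ k, k < l → f (vec K l k) = g (vec K l k)) : f = g := by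
  refine (Pi.basisFun K (Fin l)).ext fun i => ?_
  rw [Pi.basisFun_apply, ← vec_coe]
  exact h i i.2

theorem opA_pow_vec (m k : ℕ) : (opA K l ^ m) (vec K l k) = vec K l (k + m) := by
  induction m with
  | zero => simp
  | succ m ih => rw [pow_succ', Module.End.mul_apply, ih, opA_vec, add_assoc]

theorem opB_pow_vec (m k : ℕ) :
    (opB q l r ^ m) (vec K l k) = (q ^ (r + k)) ^ m • vec K l k := by
  induction m with
  | zero => simp
  | succ m ih => rw [pow_succ', Module.End.mul_apply, ih, map_smul, opB_vec, smul_smul, pow_succ]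

theorem opC_pow_vec (m k : ℕ) :
    (opC q l r ^ m) (vec K l k) = (q ^ (k + 1 - r - l : ℤ)) ^ m • vec K l k := by
  induction m with
  | zero => simp
  | succ m ih => rw [pow_succ', Module.End.mul_apply, ih, map_smul, opC_vec, smul_smul, pow_succ]

theorem opD_pow_vec (m : ℕ) : ∀ k, k < l → k < m → (opD q l ^ m) (vec K l k) = 0 := by
  induction m with
  | zero => intro k _ h; omega
  | succ m ih =>
    intro k hk hm
    rw [pow_succ, Module.End.mul_apply, opD_vec q l hk.le, map_smul]
    rcases Nat.eq_zero_or_pos k with rfl | h0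
    · simp [qInt]
    · rw [ih (k - 1) (by omega) (by omega), smul_zero]

variable {n : ℕ} {l}

theorem relations_op (hq : IsPrimitiveRoot q n) (hl : l ≤ n) :
    Relations n 1 q (opA K l) (opB q l r) (opC q l r) (opD q l) := by
  by_cases hl0 : l = 0
  · subst hl0
    exact ⟨Subsingleton.elim _ _, Subsingleton.elim _ _, Subsingleton.elim _ _,
      Subsingleton.elim _ _, Subsingleton.elim _ _, Subsingleton.elim _ _,
      Subsingleton.elim _ _, Subsingleton.elim _ _, Subsingleton.elim _ _, Subsingleton.elim _ _⟩
  have hq0 : q ≠ 0 := hq.ne_zero (by omega)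
  have hz : ∀ z : ℤ, (q ^ z) ^ n = 1 := fun z => by
    rw [← zpow_natCast, ← zpow_mul, mul_comm, zpow_mul, zpow_natCast, hq.pow_eq_one, one_zpow]
  refine ⟨?_, ?_, ?_, ?_, ?_, ?_, ?_, ?_, ?_, ?_⟩ <;> refine end_ext l fun k hk => ?_
  · simp only [Module.End.mul_apply, LinearMap.smul_apply, opA_vec, opB_vec, map_smul, smul_smul]
    congr 1
    rw [← zpow_one_add₀ hq0]; congr 1; push_cast; ring
  · simp only [Module.End.mul_apply, LinearMap.smul_apply, opB_vec, opD_vec q l hk.le, map_smul,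
      smul_smul]
    rcases Nat.eq_zero_or_pos k with rfl | h0
    · simp [qInt]
    · congr 1
      have : q ^ (r + k) = q * q ^ (r + ((k - 1 : ℕ) : ℤ)) := by
        rw [← zpow_one_add₀ hq0]; congr 1; push_cast [h0]; ring
      rw [this]; ring
  · simp only [Module.End.mul_apply, LinearMap.smul_apply, opA_vec, opC_vec, map_smul, smul_smul]
    congr 1
    rw [← zpow_one_add₀ hq0]; congr 1; push_cast; ring
  · simp only [Module.End.mul_apply, LinearMap.smul_apply, opC_vec, opD_vec q l hk.le, map_smul,
      smul_smul]
    rcases Nat.eq_zero_or_pos k with rfl | h0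
    · simp [qInt]
    · congr 1
      have : q ^ (k + 1 - r - l : ℤ) = q * q ^ (((k - 1 : ℕ) : ℤ) + 1 - r - l) := by
        rw [← zpow_one_add₀ hq0]; congr 1; push_cast [h0]; ring
      rw [this]; ring
  · simp only [Module.End.mul_apply, opB_vec, opC_vec, map_smul, smul_smul, mul_comm]
  · rw [opA_pow_vec, vec_of_le l (by omega)]; rfl
  · rw [opB_pow_vec, hz, one_smul]; rfl
  · rw [opC_pow_vec, hz, one_smul]; rfl
  · rw [opD_pow_vec q l n k hk (by omega)]; rfl
  · simp only [Module.End.mul_apply, LinearMap.smul_apply, LinearMap.sub_apply, opA_vec, opB_vec,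
      opC_vec, opD_vec q l hk.le, opD_vec q l (show k + 1 ≤ l by omega), map_smul,
      Module.End.one_apply, smul_smul, one_smul, Nat.add_sub_cancel]
    have e : (qInt q k * (1 - q ^ (k - l : ℤ))) • vec K l (k - 1 + 1) =
        (qInt q k * (1 - q ^ (k - l : ℤ))) • vec K l k := by
      rcases Nat.eq_zero_or_pos k with rfl | h0
      · simp [qInt]
      · rw [Nat.sub_add_cancel h0]
    rw [mul_smul q, e, smul_smul, ← sub_smul]
    nth_rewrite 2 [← one_smul K (vec K l k)]
    rw [← sub_smul]
    congr 1
    have e₁ : qInt q (k + 1) = 1 + q * qInt q k := by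
      rw [add_comm k 1, qInt_add]; simp [qInt]
    have e₂ : qInt q (k + 1) = qInt q k + q ^ k := by
      rw [qInt_add]; simp [qInt]
    have e₃ : q ^ (((k + 1 : ℕ) : ℤ) - l) = q * q ^ (k - l : ℤ) := by
      rw [← zpow_one_add₀ hq0]; congr 1; push_cast; ring
    have e₄ : q ^ (k + 1 - r - l : ℤ) * q ^ (r + k) = q * q ^ (k - l : ℤ) * q ^ k := by
      rw [← zpow_natCast q k, ← zpow_add₀ hq0, ← zpow_one_add₀ hq0, ← zpow_add₀ hq0]
      congr 1; ring
    rw [e₃, e₄]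
    linear_combination e₁ - q * q ^ (k - l : ℤ) * e₂

end simple

/-- The module `V(l, r)` over `H_n(1, q)`, for `l ≤ n`: it has a basis `v_0, …, v_{l-1}` with
`a v_i = v_{i+1}`, `b v_i = q^(r+i) v_i`, `c v_i = q^(i+1-r-l) v_i` and
`d v_i = (i)_q (1 - q^(i-l)) v_{i-1}`, where `v_l = 0`. It depends on `r` only modulo `n`. -/
def V {K : Type u} [Field K] {n : ℕ} {q : K} [hq : Fact (IsPrimitiveRoot q n)] (l : ℕ)
    (hl : l ≤ n) (r : ℤ) : Green.FDMod K (Hn n 1 q) where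
  carrier := Fin l → K
  ρ := Hn.lift (relations_op q r hq.out hl)

/-! ### The ideal of relations -/

/-- `n / (n - i) * C(n - i, i)`, an integer for `2 * i ≤ n` and `0 < n`. -/
def lucasCoeff (n i : ℕ) : ℕ := n * (n - i).choose i / (n - i)

/-- The division in `lucasCoeff` is exact. -/
theorem sub_mul_lucasCoeff {n i : ℕ} (hn : 0 < n) (h : 2 * i ≤ n) :
    (n - i) * lucasCoeff n i = n * (n - i).choose i := by
  refine Nat.mul_div_cancel' ?_
  rcases Nat.eq_zero_or_pos i with rfl | hi
  · simp
  · obtain ⟨j, rfl⟩ : ∃ j, i = j + 1 := ⟨i - 1, by omega⟩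
    obtain ⟨m, hm⟩ : ∃ m, n - (j + 1) = m + 1 := ⟨n - (j + 1) - 1, by omega⟩
    have hn' : n = (m + 1) + (j + 1) := by omega
    rw [hm]
    refine ⟨(m + 1).choose (j + 1) + m.choose j, ?_⟩
    have := Nat.add_one_mul_choose_eq m j
    rw [hn', mul_add (m + 1), this]
    ring

open MvPolynomial in
/-- The ideal `I` of `ℤ[x, y]`, with `x = X 0` and `y = X 1`. -/
def relIdeal (n : ℕ) : Ideal (MvPolynomial (Fin 2) ℤ) :=
  Ideal.span
    {X 0 ^ n - 1,
      (∑ i ∈ Finset.range (n / 2 + 1),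
          (-1) ^ i * (lucasCoeff n i : MvPolynomial (Fin 2) ℤ) * X 0 ^ i * X 1 ^ (n - 2 * i) - 2) *
        ∑ i ∈ Finset.range ((n - 1) / 2 + 1),
          (-1) ^ i * ((n - 1 - i).choose i : MvPolynomial (Fin 2) ℤ) * X 0 ^ i *
            X 1 ^ (n - 1 - 2 * i)}

end Taft
end

noncomputable section

namespace Green

namespace FDMod

section algebra

variable {K : Type u} {H : Type v} [Field K] [Ring H] [Algebra K H]

/-! ### Homomorphisms of finite dimensional modules -/

/-! Write x = [V(1,1)], y = [V(2,0)], and P(l,r) for the projective cover of V(l,r). Let U and V be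
the Lucas sequences of (x, y): both satisfy s(k+2) = y s(k+1) - x s(k), and they start with 0, 1 and
2, y. The two factors in the ideal are V_n - 2 and U_n.

Simple modules. A vector killed by d with suitable b- and c-weights generates an image of V(l,r) as
soon as a^l kills it. This classifies the simple modules (`exists_equiv_V`), gives V(2,0) ⊗ V(l,r) ≅
V(l+1,r) ⊕ V(l-1,r+1) for 0 < l < n (`equiv_twoTensor`), and so [V(l,k)] = x^k U_l.

Projective modules. V(n,r) is projective. V(2,0) has the dual V(2,-1), so tensoring with V(2,0)
preserves projectivity and dim Hom(V(2,0) ⊗ P, S) = dim Hom(P, V(2,-1) ⊗ S). For projective P the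
right side depends only on the composition factors of V(2,-1) ⊗ S, which are known also for S =
V(n,r) (`homDim_twoTensor`). The class of a projective module is determined by the dimensions of its
Hom spaces to the simple modules (`cls_eq_of_homDim`), so the products y[P(l,r)] can be read off.
They form a recursion with solution [P(n-j,j+k)] = x^k V_j U_n for 0 < j < n (`CoverOf.cls_eq_map`),
and its last instance, at l = 1, says V_n U_n = 2 U_n (`map_lucasV_mul_lucasU`).

Hence ℤ[x,y]/I maps onto r_p. Since V_n U_n = U_{2n} is monic of degree 2n-1 in y, the n(2n-1)
monomials span the quotient. In the Green ring the n(n-1) non-projective simple modules and the n^2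
projective covers have independent classes, as additive functions built from Hom dimensions show
(`linearIndependent_simple_cover`). All of them lie in the image and n(n-1) + n^2 = n(2n-1), so the
images of the monomials are independent too. This gives injectivity and the basis at once.

Projectivity is used only as lifting against finite dimensional modules, so neither the dimension of
H nor a basis of it is needed. Krull-Schmidt is not needed either. -/

theorem smul_eq (M : FDMod K H) (h : H) (m : M.carrier) : h • m = M.ρ h m := rfl

instance instIsScalarTower (M : FDMod K H) : IsScalarTower K H M.carrier :=
  ⟨fun k h m => by simp [smul_eq]⟩

instance instSMulCommClass (M : FDMod K H) : SMulCommClass H K M.carrier :=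
  ⟨fun h k m => by simp [smul_eq]⟩

theorem iso_iff {M N : FDMod K H} : Iso M N ↔ Nonempty (M.carrier ≃ₗ[H] N.carrier) := by
  constructor
  · rintro ⟨e, he⟩
    exact ⟨{ e with map_smul' := he }⟩
  · rintro ⟨e⟩
    exact ⟨e.restrictScalars K, fun h m => e.map_smul h m⟩

/-- The `K`-dimension of a module. -/
def dim (M : FDMod K H) : ℕ := Module.finrank K M.carrier

instance (M : FDMod K H) : IsNoetherian H M.carrier := isNoetherian_of_tower K inferInstance

instance (M : FDMod K H) : IsArtinian H M.carrier := isArtinian_of_tower K inferInstance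

instance (M : FDMod K H) (N : Submodule H M.carrier) : Module.Finite K N :=
  inferInstanceAs (Module.Finite K (N.restrictScalars K))

instance (M : FDMod K H) (N : Submodule H M.carrier) : Module.Finite K (M.carrier ⧸ N) :=
  Module.Finite.of_surjective (N.mkQ.restrictScalars K) N.mkQ_surjective

instance (M N : FDMod K H) : Module.Finite K (M.carrier →ₗ[H] N.carrier) :=
  Module.Finite.of_injective (LinearMap.restrictScalarsₗ K H M.carrier N.carrier K)
    (LinearMap.restrictScalars_injective K)

section of

variable (K) (X : Type u) [AddCommGroup X] [Module K X] [Module H X] [IsScalarTower K H X]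
  [Module.Finite K X]

variable (H) in
/-- A finite dimensional `H`-module as a bundled one. -/
def of : FDMod K H where
  carrier := X
  ρ := Algebra.lsmul K K X

variable (H) in
/-- The identity map, from the bundled module. -/
def ofEquiv : (of K H X).carrier ≃ₗ[H] X :=
  { LinearEquiv.refl K X with map_smul' := fun _ _ => rfl }

end of

/-- The dimension of the space of `H`-linear maps `M → N`. -/
def homDim (M N : FDMod K H) : ℕ := Module.finrank K (M.carrier →ₗ[H] N.carrier)

/-- Composition with a fixed `H`-linear map, as a `K`-linear map. -/
def postcomp (P : FDMod K H) {M N : FDMod K H} (g : M.carrier →ₗ[H] N.carrier) :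
    (P.carrier →ₗ[H] M.carrier) →ₗ[K] (P.carrier →ₗ[H] N.carrier) where
  toFun f := g ∘ₗ f
  map_add' f f' := LinearMap.comp_add _ _ _
  map_smul' k f := by
    ext m
    exact (g.restrictScalars K).map_smul k (f m)

/-- Precomposition with a fixed `H`-linear map, as a `K`-linear map. -/
def precomp (P : FDMod K H) {M N : FDMod K H} (g : M.carrier →ₗ[H] N.carrier) :
    (N.carrier →ₗ[H] P.carrier) →ₗ[K] (M.carrier →ₗ[H] P.carrier) where
  toFun f := f ∘ₗ g
  map_add' _ _ := rfl
  map_smul' _ _ := rfl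

theorem homDim_congr_left {M M' : FDMod K H} (e : M.carrier ≃ₗ[H] M'.carrier) (N : FDMod K H) :
    homDim M N = homDim M' N :=
  LinearEquiv.finrank_eq (LinearEquiv.ofLinearMap (precomp N e.symm.toLinearMap)
    (precomp N e.toLinearMap) (by ext f x; simp [precomp]) (by ext f x; simp [precomp]))

theorem homDim_congr_right (M : FDMod K H) {N N' : FDMod K H} (e : N.carrier ≃ₗ[H] N'.carrier) :
    homDim M N = homDim M N' :=
  LinearEquiv.finrank_eq (LinearEquiv.ofLinearMap (postcomp M e.toLinearMap)
    (postcomp M e.symm.toLinearMap) (by ext f x; simp [postcomp]) (by ext f x; simp [postcomp]))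

theorem dim_congr {M N : FDMod K H} (e : M.carrier ≃ₗ[H] N.carrier) : M.dim = N.dim :=
  (e.restrictScalars K).finrank_eq

/-- The first inclusion into a direct sum. -/
def inl (M N : FDMod K H) : M.carrier →ₗ[H] (sum M N).carrier where
  toFun m := (m, 0)
  map_add' _ _ := Prod.ext rfl (add_zero 0).symm
  map_smul' h _ := Prod.ext rfl (map_zero (N.ρ h)).symm

/-- The second inclusion into a direct sum. -/
def inr (M N : FDMod K H) : N.carrier →ₗ[H] (sum M N).carrier where
  toFun n := (0, n)
  map_add' _ _ := Prod.ext (add_zero 0).symm rfl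
  map_smul' h _ := Prod.ext (map_zero (M.ρ h)).symm rfl

/-- The first projection from a direct sum. -/
def fst (M N : FDMod K H) : (sum M N).carrier →ₗ[H] M.carrier where
  toFun m := m.1
  map_add' _ _ := rfl
  map_smul' _ _ := rfl

/-- The second projection from a direct sum. -/
def snd (M N : FDMod K H) : (sum M N).carrier →ₗ[H] N.carrier where
  toFun m := m.2
  map_add' _ _ := rfl
  map_smul' _ _ := rfl

theorem inl_fst_add_inr_snd (M N : FDMod K H) (x : (sum M N).carrier) :
    inl M N (fst M N x) + inr M N (snd M N x) = x :=
  Prod.ext (add_zero _) (zero_add _)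

theorem homDim_sum_left (M N P : FDMod K H) :
    homDim (sum M N) P = homDim M P + homDim N P := by
  have e : ((sum M N).carrier →ₗ[H] P.carrier) ≃ₗ[K]
      (M.carrier →ₗ[H] P.carrier) × (N.carrier →ₗ[H] P.carrier) :=
    LinearEquiv.ofLinearMap ((precomp P (inl M N)).prod (precomp P (inr M N)))
      ((precomp P (fst M N)).coprod (precomp P (snd M N)))
      (by
        refine LinearMap.ext fun f => Prod.ext (LinearMap.ext fun m => ?_) (LinearMap.ext fun m => ?_)
        · change f.1 m + f.2 0 = f.1 m; simp
        · change f.1 0 + f.2 m = f.2 m; simp)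
      (by
        refine LinearMap.ext fun f => LinearMap.ext fun m => ?_
        change f (inl M N (fst M N m)) + f (inr M N (snd M N m)) = f m
        rw [← map_add, inl_fst_add_inr_snd])
  rw [homDim, e.finrank_eq, Module.finrank_prod]; rfl

theorem homDim_sum_right (M N P : FDMod K H) :
    homDim P (sum M N) = homDim P M + homDim P N := by
  have e : (P.carrier →ₗ[H] (sum M N).carrier) ≃ₗ[K]
      (P.carrier →ₗ[H] M.carrier) × (P.carrier →ₗ[H] N.carrier) :=
    LinearEquiv.ofLinearMap ((postcomp P (fst M N)).prod (postcomp P (snd M N)))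
      ((postcomp P (inl M N)).coprod (postcomp P (inr M N)))
      (by
        refine LinearMap.ext fun f => Prod.ext (LinearMap.ext fun m => ?_) (LinearMap.ext fun m => ?_)
        · exact add_zero _
        · exact zero_add _)
      (by
        refine LinearMap.ext fun f => LinearMap.ext fun m => ?_
        exact inl_fst_add_inr_snd _ _ _)
  rw [homDim, e.finrank_eq, Module.finrank_prod]; rfl

theorem dim_sum (M N : FDMod K H) : (sum M N).dim = M.dim + N.dim :=
  Module.finrank_prod

theorem dim_eq_zero_iff {M : FDMod K H} : M.dim = 0 ↔ Subsingleton M.carrier :=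
  Module.finrank_zero_iff

theorem homDim_eq_zero_iff {M N : FDMod K H} :
    homDim M N = 0 ↔ ∀ f : M.carrier →ₗ[H] N.carrier, f = 0 := by
  rw [homDim, Module.finrank_zero_iff]
  exact ⟨fun h f => Subsingleton.elim _ _, fun h => ⟨fun f g => (h f).trans (h g).symm⟩⟩

theorem homDim_eq_zero_of_dim {M N : FDMod K H} (h : N.dim = 0) : homDim M N = 0 := by
  have := dim_eq_zero_iff.1 h
  exact homDim_eq_zero_iff.2 fun f => LinearMap.ext fun m => Subsingleton.elim _ _

/-- A module is the direct sum of two modules if a surjection onto the second one with the first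
one as kernel has a section. -/
theorem exists_equiv_sum_of_section {P Q : FDMod K H} (g : P.carrier →ₗ[H] Q.carrier)
    (s : Q.carrier →ₗ[H] P.carrier) (h : g ∘ₗ s = LinearMap.id) :
    Nonempty (P.carrier ≃ₗ[H] (sum Q (of K H (LinearMap.ker g))).carrier) := by
  have hgs : ∀ x, g (s x) = x := fun x => DFunLike.congr_fun h x
  refine ⟨LinearEquiv.symm (LinearEquiv.ofBijective
    (s ∘ₗ fst _ _ + (LinearMap.ker g).subtype ∘ₗ (ofEquiv K H _).toLinearMap ∘ₗ snd _ _)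
    ⟨(injective_iff_map_eq_zero _).2 ?_, ?_⟩)⟩
  · rintro ⟨x, y⟩ hxy
    obtain ⟨y, hy⟩ : LinearMap.ker g := y
    change s x + y = 0 at hxy
    have hx : x = 0 := by
      have := congrArg g hxy
      rwa [map_add, hgs, LinearMap.mem_ker.1 hy, add_zero, map_zero] at this
    subst hx
    rw [map_zero, zero_add] at hxy
    subst hxy
    rfl
  · intro p
    refine ⟨(g p, (⟨p - s (g p), by simp [hgs]⟩ : LinearMap.ker g)), ?_⟩
    change s (g p) + (p - s (g p)) = p
    abel

/-! ### Relatively projective modules -/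

/-- `P` has the lifting property against surjections of finite dimensional modules. -/
def IsFDProjective (P : FDMod K H) : Prop :=
  ∀ (N N' : FDMod K H) (g : N.carrier →ₗ[H] N'.carrier) (f : P.carrier →ₗ[H] N'.carrier),
    Function.Surjective g → ∃ f' : P.carrier →ₗ[H] N.carrier, g ∘ₗ f' = f

/-- The converse is never needed: `Module.Projective` occurs only among the generators of the
projective class ring, and the covers constructed below are not used as such generators. -/
theorem isFDProjective_of_projective {P : FDMod K H} (h : Module.Projective H P.carrier) :
    IsFDProjective P :=
  fun _ _ g f hg => Module.projective_lifting_property g f hg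

theorem IsFDProjective.of_retract {P Q : FDMod K H} (hP : IsFDProjective P)
    (i : Q.carrier →ₗ[H] P.carrier) (p : P.carrier →ₗ[H] Q.carrier) (h : p ∘ₗ i = LinearMap.id) :
    IsFDProjective Q := by
  intro N N' g f hg
  obtain ⟨f', hf'⟩ := hP N N' g (f ∘ₗ p) hg
  refine ⟨f' ∘ₗ i, ?_⟩
  rw [← LinearMap.comp_assoc, hf', LinearMap.comp_assoc, h, LinearMap.comp_id]

theorem IsFDProjective.of_equiv {P Q : FDMod K H} (hP : IsFDProjective P)
    (e : P.carrier ≃ₗ[H] Q.carrier) : IsFDProjective Q :=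
  hP.of_retract e.symm.toLinearMap e.toLinearMap (by ext; simp)

theorem IsFDProjective.right_of_sum {P Q : FDMod K H} (h : IsFDProjective (sum P Q)) :
    IsFDProjective Q :=
  h.of_retract (inr P Q) (snd P Q) rfl

/-- `Hom(P, -)` is exact for projective `P`. -/
theorem IsFDProjective.homDim_eq {P A M N : FDMod K H} (hP : IsFDProjective P)
    (i : A.carrier →ₗ[H] M.carrier) (hi : Function.Injective i)
    (g : M.carrier →ₗ[H] N.carrier) (hg : Function.Surjective g)
    (h : LinearMap.range i = LinearMap.ker g) : homDim P M = homDim P A + homDim P N := by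
  have hs : Function.Surjective (postcomp P g) := fun f => hP M N g f hg
  have hinj : Function.Injective (postcomp P i) := fun f f' hff => by
    ext x
    exact hi (DFunLike.congr_fun hff x)
  have hrange : LinearMap.range (postcomp P i) = LinearMap.ker (postcomp P g) := by
    ext f
    constructor
    · rintro ⟨f, rfl⟩
      refine LinearMap.ext fun x => ?_
      have hx : i (f x) ∈ LinearMap.ker g := h ▸ LinearMap.mem_range_self i (f x)
      exact hx
    · intro hf
      have hx : ∀ x, f x ∈ LinearMap.range i := fun x => by
        rw [h, LinearMap.mem_ker]
        exact DFunLike.congr_fun (LinearMap.mem_ker.1 hf) x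
      refine ⟨(LinearEquiv.ofInjective i hi).symm.toLinearMap ∘ₗ f.codRestrict _ hx, ?_⟩
      refine LinearMap.ext fun x => ?_
      have := LinearEquiv.apply_symm_apply (LinearEquiv.ofInjective i hi) ⟨f x, hx x⟩
      exact congrArg Subtype.val this
  have h₁ := LinearMap.finrank_range_add_finrank_ker (postcomp P g)
  rw [LinearMap.range_eq_top.2 hs, finrank_top, ← hrange, LinearMap.finrank_range_of_inj hinj] at h₁
  rw [homDim, homDim, homDim, ← h₁, add_comm]

/-! ### Projective covers -/

/-- `Q` is projective and all its proper submodules lie in the kernel of the surjection `π`. -/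
structure IsCover {Q S : FDMod K H} (π : Q.carrier →ₗ[H] S.carrier) : Prop where
  projective : IsFDProjective Q
  surjective : Function.Surjective π
  eq_top : ∀ N : Submodule H Q.carrier, ¬ N ≤ LinearMap.ker π → N = ⊤

/-- A simple module that is a quotient of a projective module has a projective cover. -/
theorem exists_isCover {P S : FDMod K H} (hP : IsFDProjective P) [hS : IsSimpleModule H S.carrier]
    {f : P.carrier →ₗ[H] S.carrier} (hf : f ≠ 0) :
    ∃ (Q : FDMod K H) (π : Q.carrier →ₗ[H] S.carrier), IsCover π := by
  classical
  -- The cover is a projective module of least dimension among those with a nonzero map to S.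
  have hex : ∃ d : ℕ, ∃ (Q : FDMod K H) (π : Q.carrier →ₗ[H] S.carrier),
      IsFDProjective Q ∧ π ≠ 0 ∧ Q.dim = d := ⟨_, P, f, hP, hf, rfl⟩
  obtain ⟨Q, π, hQ, hπ, hd⟩ := Nat.find_spec hex
  have hmin : ∀ (Q' : FDMod K H) (π' : Q'.carrier →ₗ[H] S.carrier), IsFDProjective Q' → π' ≠ 0 →
      Q.dim ≤ Q'.dim := fun Q' π' h₁ h₂ => hd.trans_le (Nat.find_min' hex ⟨Q', π', h₁, h₂, rfl⟩)
  have hπs : Function.Surjective π := (LinearMap.surjective_or_eq_zero π).resolve_right hπ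
  refine ⟨Q, π, hQ, hπs, fun N hN => ?_⟩
  have hN' : Function.Surjective (π ∘ₗ N.subtype ∘ₗ (ofEquiv K H N).toLinearMap) := by
    refine (LinearMap.surjective_or_eq_zero _).resolve_right fun h => hN fun x hx => ?_
    exact DFunLike.congr_fun h (⟨x, hx⟩ : N)
  obtain ⟨g₀, hg₀⟩ := hQ (of K H N) S _ π hN'
  -- Lifting π through N gives an endomorphism g of Q with image in N and π ∘ g = π.
  let g : Module.End H Q.carrier := N.subtype ∘ₗ (ofEquiv K H N).toLinearMap ∘ₗ g₀
  have hg : ∀ x, π (g x) = π x := fun x => DFunLike.congr_fun hg₀ x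
  have hgk : ∀ (k : ℕ) x, π ((g ^ k) x) = π x := by
    intro k
    induction k with
    | zero => intro x; rfl
    | succ k ih => intro x; rw [pow_succ, Module.End.mul_apply, ih, hg]
  -- Fitting's lemma: the image R of a high power of g is a direct summand, hence projective, and π
  -- does not vanish on it. By minimality R = Q. The exponent k + 1 is positive, so R lies in N.
  obtain ⟨k, hk⟩ := Filter.eventually_atTop.1 (LinearMap.eventually_isCompl_ker_pow_range_pow g)
  obtain hc := hk (k + 1) (Nat.le_succ k)
  set R := LinearMap.range (g ^ (k + 1)) with hR
  have hRproj : IsFDProjective (of K H R) := by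
    refine hQ.of_retract (R.subtype ∘ₗ (ofEquiv K H R).toLinearMap)
      ((ofEquiv K H R).symm.toLinearMap ∘ₗ Submodule.projectionOnto R _ hc.symm) ?_
    refine LinearMap.ext fun x => ?_
    exact Submodule.projectionOnto_apply_left hc.symm x
  have hRπ : π ∘ₗ R.subtype ∘ₗ (ofEquiv K H R).toLinearMap ≠ 0 := by
    intro h
    refine hπ (LinearMap.ext fun x => ?_)
    rw [← hgk (k + 1) x]
    exact DFunLike.congr_fun h (⟨(g ^ (k + 1)) x, LinearMap.mem_range_self _ x⟩ : R)
  have hle := hmin _ _ hRproj hRπ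
  have htop : R.restrictScalars K = ⊤ :=
    Submodule.eq_top_of_finrank_eq (le_antisymm (Submodule.finrank_le _) hle)
  refine top_unique fun x _ => ?_
  have hx : x ∈ R.restrictScalars K := htop ▸ Submodule.mem_top
  obtain ⟨y, rfl⟩ := LinearMap.mem_range.1 ((Submodule.restrictScalars_mem K R x).1 hx)
  rw [pow_succ', Module.End.mul_apply]
  exact (ofEquiv K H N (g₀ ((g ^ k) y))).2

/-- The kernel of f is a proper submodule, so the cover property puts it inside ker π. It is maximal
because T is simple, and ker π is proper. -/
theorem IsCover.ker_eq {Q S T : FDMod K H} {π : Q.carrier →ₗ[H] S.carrier} (hπ : IsCover π)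
    [IsSimpleModule H S.carrier] [IsSimpleModule H T.carrier] {f : Q.carrier →ₗ[H] T.carrier}
    (hf : f ≠ 0) : LinearMap.ker f = LinearMap.ker π := by
  have hle : LinearMap.ker f ≤ LinearMap.ker π := by
    by_contra h
    exact hf (LinearMap.ker_eq_top.1 (hπ.eq_top _ h))
  have hmax : IsCoatom (LinearMap.ker f) :=
    (LinearMap.isCoatom_ker_of_surjective ((LinearMap.surjective_or_eq_zero f).resolve_right hf))
  refine (hmax.le_iff.1 hle).elim (fun h => ?_) fun h => h.symm
  have h0 : π = 0 := LinearMap.ker_eq_top.1 h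
  have := IsSimpleModule.nontrivial H S.carrier
  obtain ⟨s, hs⟩ := exists_ne (0 : S.carrier)
  obtain ⟨x, rfl⟩ := hπ.surjective s
  exact absurd (by rw [h0]; rfl) hs

/-- The maps of a projective cover of `S` to a simple module factor through `S`. -/
theorem IsCover.homDim_eq {Q S T : FDMod K H} {π : Q.carrier →ₗ[H] S.carrier} (hπ : IsCover π)
    [IsSimpleModule H S.carrier] [IsSimpleModule H T.carrier] : homDim Q T = homDim S T := by
  have hinj : Function.Injective (precomp T π) := fun f g hfg => by
    ext s
    obtain ⟨x, rfl⟩ := hπ.surjective s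
    exact DFunLike.congr_fun hfg x
  have hsurj : Function.Surjective (precomp T π) := by
    intro f
    by_cases hf : f = 0
    · exact ⟨0, by rw [hf, map_zero]⟩
    have hker := hπ.ker_eq hf
    refine ⟨(LinearMap.ker π).liftQ f hker.ge ∘ₗ
      (LinearMap.quotKerEquivOfSurjective π hπ.surjective).symm.toLinearMap, ?_⟩
    refine LinearMap.ext fun x => ?_
    change (LinearMap.ker π).liftQ f hker.ge
      ((LinearMap.quotKerEquivOfSurjective π hπ.surjective).symm (π x)) = f x
    have : (LinearMap.quotKerEquivOfSurjective π hπ.surjective).symm (π x) =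
        Submodule.Quotient.mk x := by
      rw [LinearEquiv.symm_apply_eq]; rfl
    rw [this]; rfl
  exact (LinearEquiv.ofBijective _ ⟨hinj, hsurj⟩).finrank_eq.symm

/-- A projective module that maps onto `S` has the projective cover of `S` as a summand. -/
theorem IsCover.exists_equiv_sum {P Q S : FDMod K H} {π : Q.carrier →ₗ[H] S.carrier}
    (hπ : IsCover π) [IsSimpleModule H S.carrier] (hP : IsFDProjective P)
    {f : P.carrier →ₗ[H] S.carrier} (hf : f ≠ 0) :
    ∃ P' : FDMod K H, IsFDProjective P' ∧ Nonempty (P.carrier ≃ₗ[H] (sum Q P').carrier) := by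
  obtain ⟨g, hg⟩ := hP Q S π f hπ.surjective
  have hgs : Function.Surjective g := by
    refine LinearMap.range_eq_top.1 (hπ.eq_top _ fun h => hf (LinearMap.ext fun x => ?_))
    rw [← hg]
    exact h (LinearMap.mem_range_self g x)
  obtain ⟨s, hs⟩ := hπ.projective P Q g LinearMap.id hgs
  obtain ⟨e⟩ := exists_equiv_sum_of_section g s hs
  exact ⟨_, (hP.of_equiv e).right_of_sum, ⟨e⟩⟩

end algebra

end FDMod

end Green
end

noncomputable section

namespace Green

open FDMod

/-! ### Additive invariants on the Green ring -/

section greenRing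

variable {K : Type u} {H : Type v} [Field K] [Ring H] [Bialgebra K H]

theorem cls_congr {M N : FDMod K H} (e : M.carrier ≃ₗ[H] N.carrier) : cls M = cls N :=
  congrArg (Completion.of (S := IsoClass K H)) (Quotient.sound (iso_iff.2 ⟨e⟩))

theorem cls_zero : cls (FDMod.zero K H) = 0 :=
  (Completion.of (S := IsoClass K H)).map_zero

theorem cls_one : cls (FDMod.unit K H) = 1 := rfl

theorem cls_eq_zero {M : FDMod K H} (h : M.dim = 0) : cls M = 0 := by
  have h₁ := dim_eq_zero_iff.1 h
  have h₂ : Subsingleton (FDMod.zero K H).carrier := inferInstanceAs (Subsingleton PUnit)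
  rw [← cls_zero]
  exact cls_congr ⟨0, 0, fun _ => Subsingleton.elim _ _, fun _ => Subsingleton.elim _ _⟩

/-- The additive map `[M] ↦ dim Hom(M, N)`. -/
def homDimHom (N : FDMod K H) : GreenRing K H →+ ℤ :=
  Completion.lift (S := IsoClass K H)
    { toFun := Quotient.lift (fun M => (homDim M N : ℤ)) fun M M' h => by
        obtain ⟨e⟩ := iso_iff.1 (show Iso M M' from h)
        exact congrArg _ (homDim_congr_left e N)
      map_zero' := by
        have : Subsingleton (FDMod.zero K H).carrier := inferInstanceAs (Subsingleton PUnit)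
        refine congrArg (Nat.cast (R := ℤ)) (homDim_eq_zero_iff.2 fun f => LinearMap.ext fun m => ?_)
        rw [Subsingleton.elim m 0, map_zero, map_zero]
      map_add' := by
        rintro ⟨M⟩ ⟨M'⟩
        exact (congrArg (Nat.cast (R := ℤ)) (homDim_sum_left M M' N)).trans (Nat.cast_add _ _) }

@[simp] theorem homDimHom_cls (M N : FDMod K H) : homDimHom N (cls M) = homDim M N :=
  Completion.lift_of (S := IsoClass K H) _ _

/-- The additive map that sends `[M]` to the dimension of the space of maps `M → S` that factor
through `π : Q → S`. -/
def factorHom {Q S : FDMod K H} (π : Q.carrier →ₗ[H] S.carrier) : GreenRing K H →+ ℤ :=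
  homDimHom Q - homDimHom (of K H (LinearMap.ker π))

/-- Every map P → S lifts through π: Hom(P, -) is exact on ker π → Q → S. -/
theorem factorHom_of_projective {Q S P : FDMod K H} {π : Q.carrier →ₗ[H] S.carrier}
    (hπ : Function.Surjective π) (hP : IsFDProjective P) :
    factorHom π (cls P) = homDim P S := by
  have := hP.homDim_eq ((LinearMap.ker π).subtype ∘ₗ (ofEquiv K H _).toLinearMap)
    (Subtype.val_injective.comp (ofEquiv K H _).injective) π hπ (by
      rw [LinearMap.range_comp, LinearEquiv.range, Submodule.map_top, Submodule.range_subtype])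
  rw [factorHom, AddMonoidHom.sub_apply, homDimHom_cls, homDimHom_cls, this]
  push_cast
  ring

/-- Under this hypothesis all maps M → Q have image in ker π, so the two Hom spaces in the
difference agree. -/
theorem factorHom_eq_zero {Q S M : FDMod K H} {π : Q.carrier →ₗ[H] S.carrier}
    (h : ∀ f : M.carrier →ₗ[H] Q.carrier, π ∘ₗ f = 0) : factorHom π (cls M) = 0 := by
  rw [factorHom, AddMonoidHom.sub_apply, homDimHom_cls, homDimHom_cls, sub_eq_zero, Nat.cast_inj]
  let i : (of K H (LinearMap.ker π)).carrier →ₗ[H] Q.carrier :=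
    (LinearMap.ker π).subtype ∘ₗ (ofEquiv K H _).toLinearMap
  refine (LinearEquiv.ofBijective (postcomp M i) ⟨fun f g hfg => ?_, fun f => ?_⟩).finrank_eq.symm
  · ext x
    exact Subtype.val_injective (DFunLike.congr_fun hfg x)
  · exact ⟨(ofEquiv K H _).symm.toLinearMap ∘ₗ
      f.codRestrict (LinearMap.ker π) fun x => DFunLike.congr_fun (h f) x, rfl⟩

variable {ι : Type*} [Fintype ι] [DecidableEq ι] {S Q : ι → FDMod K H}
  {π : ∀ i, (Q i).carrier →ₗ[H] (S i).carrier}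

/-- If the `S i` represent the simple modules and the `Q i` are their projective covers, then every
projective module is a direct sum of copies of the `Q i`. -/
theorem cls_eq_sum_of_projective (hS : ∀ i, IsSimpleModule H (S i).carrier)
    (hδ : ∀ i j, homDim (S i) (S j) = if i = j then 1 else 0)
    (hall : ∀ M : FDMod K H, IsSimpleModule H M.carrier →
      ∃ i, Nonempty (M.carrier ≃ₗ[H] (S i).carrier))
    (hπ : ∀ i, IsCover (π i)) {P : FDMod K H} (hP : IsFDProjective P) :
    cls P = ∑ i, homDim P (S i) • cls (Q i) := by
  induction hd : P.dim using Nat.strong_induction_on generalizing P with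
  | _ d ih =>
  by_cases h0 : P.dim = 0
  · have := dim_eq_zero_iff.1 h0
    rw [cls_eq_zero h0, Finset.sum_eq_zero]
    intro i _
    rw [homDim_eq_zero_iff.2, zero_smul]
    intro f
    ext m
    rw [Subsingleton.elim m 0, map_zero, map_zero]
  · have hnt : Nontrivial P.carrier := by
      by_contra h
      exact h0 (dim_eq_zero_iff.2 (not_nontrivial_iff_subsingleton.1 h))
    -- A maximal submodule gives a map onto some S i. The cover Q i then splits off, and the
    -- complement P' has smaller dimension.
    obtain ⟨N, hN⟩ := (inferInstance : IsCoatomic (Submodule H P.carrier)).exists_coatom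
    have hNs : IsSimpleModule H (P.carrier ⧸ N) := isSimpleModule_iff_isCoatom.2 hN
    have hNs' : IsSimpleModule H (of K H (P.carrier ⧸ N)).carrier :=
      IsSimpleModule.congr (ofEquiv K H (P.carrier ⧸ N))
    obtain ⟨i, ⟨e⟩⟩ := hall _ hNs'
    let f : P.carrier →ₗ[H] (S i).carrier :=
      e.toLinearMap ∘ₗ (ofEquiv K H _).symm.toLinearMap ∘ₗ N.mkQ
    have hf : f ≠ 0 := by
      intro h
      have := hS i
      have := IsSimpleModule.nontrivial H (S i).carrier
      obtain ⟨s, hs⟩ := exists_ne (0 : (S i).carrier)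
      obtain ⟨x, hx⟩ := N.mkQ_surjective (ofEquiv K H _ (e.symm s))
      refine hs ?_
      have h1 : f x = s := by
        change e ((ofEquiv K H _).symm (N.mkQ x)) = s
        rw [hx, LinearEquiv.symm_apply_apply, LinearEquiv.apply_symm_apply]
      rw [← h1, h, LinearMap.zero_apply]
    obtain ⟨P', hP', ⟨e'⟩⟩ := (hπ i).exists_equiv_sum hP hf
    have hQ0 : 0 < (Q i).dim := by
      rw [Nat.pos_iff_ne_zero]
      intro h
      have := dim_eq_zero_iff.1 h
      have := IsSimpleModule.nontrivial H (S i).carrier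
      obtain ⟨s, hs⟩ := exists_ne (0 : (S i).carrier)
      obtain ⟨x, rfl⟩ := (hπ i).surjective s
      exact hs (by rw [Subsingleton.elim x 0, map_zero])
    have hdim := dim_congr e'
    rw [dim_sum] at hdim
    have hsum := ih P'.dim (by omega) hP' rfl
    rw [cls_congr e', cls_sum, hsum]
    -- Splitting off Q i lowers exactly the i-th coefficient, by one, since Hom(Q i, S j) has the
    -- dimension of Hom(S i, S j).
    have hh : ∀ j, homDim P (S j) = (if i = j then 1 else 0) + homDim P' (S j) := fun j => by
      have := hS i
      have := hS j
      rw [homDim_congr_left e', homDim_sum_left, (hπ i).homDim_eq, hδ]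
    simp only [hh, add_smul, Finset.sum_add_distrib, ite_smul, one_smul, zero_smul,
      Finset.sum_ite_eq, Finset.mem_univ, if_true]

/-- The classes of the non-projective simple modules and of the projective covers of the simple
modules are independent. -/
theorem linearIndependent_simple_cover (hS : ∀ i, IsSimpleModule H (S i).carrier)
    (hδ : ∀ i j, homDim (S i) (S j) = if i = j then 1 else 0) (hπ : ∀ i, IsCover (π i))
    (p : ι → Prop) (hp : ∀ i, p i → ¬ IsFDProjective (S i)) :
    LinearIndependent ℤ (Sum.elim (fun i : {i // p i} => cls (S i)) fun i => cls (Q i)) := by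
  classical
  have h₁ : ∀ i j, factorHom (π i) (cls (Q j)) = if j = i then 1 else 0 := fun i j => by
    have := hS i
    have := hS j
    rw [factorHom_of_projective (hπ i).surjective (hπ j).projective, (hπ j).homDim_eq, hδ]
    split_ifs <;> rfl
  -- If S j → Q i → S i were nonzero, S j → Q i would be onto by the cover property and injective by
  -- simplicity, so S j ≅ Q i would be projective.
  have h₂ : ∀ i j, p j → factorHom (π i) (cls (S j)) = 0 := fun i j hj => by
    refine factorHom_eq_zero fun f => ?_
    by_contra hne
    have := hS i
    have := hS j
    have hfs : Function.Surjective f := by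
      refine LinearMap.range_eq_top.1 ((hπ i).eq_top _ fun h => hne (LinearMap.ext fun x => ?_))
      exact h (LinearMap.mem_range_self f x)
    have hfi : Function.Injective f :=
      (LinearMap.injective_or_eq_zero f).resolve_right fun h => hne (by rw [h, LinearMap.comp_zero])
    exact hp j hj ((hπ i).projective.of_equiv (LinearEquiv.ofBijective f ⟨hfi, hfs⟩).symm)
  rw [Fintype.linearIndependent_iff]
  intro c hc
  rw [Fintype.sum_sum_type] at hc
  simp only [Sum.elim_inl, Sum.elim_inr] at hc
  have hr : ∀ i, c (Sum.inr i) = 0 := fun i => by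
    -- This functional vanishes on the non-projective simple classes and is dual to the covers, so
    -- it isolates one cover coefficient. The remaining coefficients are then isolated by dim Hom(-,
    -- S j).
    have := congrArg (factorHom (π i)) hc
    simp only [map_add, map_sum, map_zsmul, h₁, h₂ i _ (Subtype.prop _), map_zero] at this
    simpa using this
  rintro (j | i)
  · simp only [hr, zero_smul, Finset.sum_const_zero, add_zero] at hc
    have := congrArg (homDimHom (S j)) hc
    simp only [map_sum, map_zsmul, homDimHom_cls, hδ, Subtype.val_inj, map_zero] at this
    simpa using this
  · exact hr i

end greenRing

/-! ### Tensor products and duality -/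

namespace FDMod

variable {K : Type u} {H : Type v} [Field K] [Ring H] [Bialgebra K H]

/-- The pure tensors in `M ⊗ N`. -/
def tm (M N : FDMod K H) : M.carrier →ₗ[K] N.carrier →ₗ[K] (tensor M N).carrier :=
  TensorProduct.mk K M.carrier N.carrier

@[elab_as_elim]
theorem tm_induction {M N : FDMod K H} {p : (tensor M N).carrier → Prop} (z : (tensor M N).carrier)
    (zero : p 0) (tmul : ∀ m n, p (tm M N m n)) (add : ∀ x y, p x → p y → p (x + y)) : p z :=
  TensorProduct.induction_on (motive := p) z zero tmul add

theorem hom_ext_tm {M N P : FDMod K H} {f g : (tensor M N).carrier →ₗ[H] P.carrier}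
    (h : ∀ m n, f (tm M N m n) = g (tm M N m n)) : f = g := by
  refine LinearMap.ext fun z => ?_
  induction z using tm_induction with
  | zero => rw [map_zero, map_zero]
  | tmul m n => exact h m n
  | add x y hx hy => rw [map_add, map_add, hx, hy]

theorem dim_tensor (M N : FDMod K H) : (tensor M N).dim = M.dim * N.dim :=
  Module.finrank_tensorProduct

/-- The tensor product of two `H`-linear maps. -/
def map₂ {M M' N N' : FDMod K H} (f : M.carrier →ₗ[H] M'.carrier)
    (g : N.carrier →ₗ[H] N'.carrier) : (tensor M N).carrier →ₗ[H] (tensor M' N').carrier :=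
  { TensorProduct.map (f.restrictScalars K) (g.restrictScalars K) with
    map_smul' := fun h z =>
      act₂_intertwine M.ρ N.ρ (TensorProduct.map (f.restrictScalars K) (g.restrictScalars K))
        (act₂ M'.ρ N'.ρ).toLinearMap
        (fun x y m n => by
          have h₁ : f (M.ρ x m) = M'.ρ x (f m) := f.map_smul x m
          have h₂ : g (N.ρ y n) = N'.ρ y (g n) := g.map_smul y n
          simp [h₁, h₂]) (Coalgebra.comul h) z }

@[simp] theorem map₂_tm {M M' N N' : FDMod K H} (f : M.carrier →ₗ[H] M'.carrier)
    (g : N.carrier →ₗ[H] N'.carrier) (m : M.carrier) (x : N.carrier) :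
    map₂ f g (tm M N m x) = tm M' N' (f m) (g x) :=
  rfl

/-- The associativity of the tensor product. -/
def assocEquiv (M N P : FDMod K H) :
    (tensor (tensor M N) P).carrier ≃ₗ[H] (tensor M (tensor N P)).carrier :=
  { TensorProduct.assoc K M.carrier N.carrier P.carrier with
    map_smul' := fun h z => by
      have h₁ := act₂_comp_left (act₂ M.ρ N.ρ) P.ρ (Bialgebra.comulAlgHom K H) (Coalgebra.comul h)
      have h₂ := act₂_comp_right M.ρ (act₂ N.ρ P.ρ) (Bialgebra.comulAlgHom K H) (Coalgebra.comul h)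
      have h₃ := act₂_assoc M.ρ N.ρ P.ρ (Coalgebra.comul.rTensor H (Coalgebra.comul h)) z
      rw [Coalgebra.coassoc_apply] at h₃
      exact ((congrArg (fun f => TensorProduct.assoc K M.carrier N.carrier P.carrier (f z))
        h₁).trans h₃).trans
        (congrArg (fun f => f (TensorProduct.assoc K M.carrier N.carrier P.carrier z)) h₂).symm }

/-- The unit of the tensor product. -/
def unitEquiv (M : FDMod K H) : (tensor (unit K H) M).carrier ≃ₗ[H] M.carrier :=
  { TensorProduct.lid K M.carrier with
    map_smul' := fun h z => by
      have := act₂_intertwine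
        ((Algebra.ofId K (Module.End K K)).comp (Bialgebra.counitAlgHom K H))
        M.ρ (TensorProduct.lid K M.carrier).toLinearMap
        (M.ρ.toLinearMap ∘ₗ (TensorProduct.lid K H).toLinearMap ∘ₗ Coalgebra.counit.rTensor H)
        (fun x y m n => by
          simp only [Algebra.ofId_apply, AlgHom.comp_apply, Bialgebra.counitAlgHom_apply,
            Module.algebraMap_end_apply, LinearEquiv.coe_coe, LinearMap.comp_apply,
            TensorProduct.lid_tmul, LinearMap.rTensor_tmul, AlgHom.toLinearMap_apply, map_smul,
            LinearMap.smul_apply, smul_eq_mul, mul_smul]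
          exact smul_comm _ _ _) (Coalgebra.comul h) z
      refine this.trans ?_
      simp only [LinearMap.comp_apply, Coalgebra.rTensor_counit_comul]
      simp
      rfl }

/-- A duality between `V` and `V'`: an invariant bilinear map `V × V' → K` and an invariant element
`∑ i, e' i ⊗ e i` of `V' ⊗ V`, inverse to each other. -/
structure Duality (V V' : FDMod K H) where
  ev : (tensor V V').carrier →ₗ[K] K
  κ : Type
  [fintype : Fintype κ]
  e : κ → V.carrier
  e' : κ → V'.carrier
  ev_smul : ∀ (h : H) (z : (tensor V V').carrier), ev (h • z) = Coalgebra.counit (R := K) h * ev z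
  smul_coev : ∀ h : H, h • ∑ i, tm V' V (e' i) (e i) =
    Coalgebra.counit (R := K) h • ∑ i, tm V' V (e' i) (e i)
  left : ∀ v : V.carrier, ∑ i, ev (tm V V' v (e' i)) • e i = v
  right : ∀ v : V'.carrier, ∑ i, ev (tm V V' (e i) v) • e' i = v

attribute [instance] Duality.fintype

namespace Duality

variable {V V' : FDMod K H} (D : Duality V V')

/-- The unit of the adjunction between `V ⊗ -` and `V' ⊗ -`. -/
def η (M : FDMod K H) : M.carrier →ₗ[H] (tensor V' (tensor V M)).carrier :=
  (assocEquiv V' V M).toLinearMap ∘ₗ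
    map₂ (M := unit K H)
      { toFun := fun k : K => k • ∑ i, tm V' V (D.e' i) (D.e i)
        map_add' := fun k k' : K => add_smul k k' _
        map_smul' := fun h (k : K) => by
          change (Coalgebra.counit (R := K) h * k) • _ = _
          rw [mul_comm, mul_smul, ← D.smul_coev, RingHom.id_apply, smul_comm] } LinearMap.id ∘ₗ
    (unitEquiv M).symm.toLinearMap

theorem η_apply (M : FDMod K H) (m : M.carrier) :
    D.η M m = ∑ i, tm V' (tensor V M) (D.e' i) (tm V M (D.e i) m) := by
  change assocEquiv V' V M (tm (tensor V' V) M
    ((1 : K) • ∑ i, tm V' V (D.e' i) (D.e i)) m) = _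
  rw [one_smul, map_sum, LinearMap.sum_apply, map_sum]
  rfl

/-- The counit of the adjunction between `V ⊗ -` and `V' ⊗ -`. -/
def ε (N : FDMod K H) : (tensor V (tensor V' N)).carrier →ₗ[H] N.carrier :=
  (unitEquiv N).toLinearMap ∘ₗ
    map₂ (M := tensor V V') (M' := unit K H) { D.ev with map_smul' := D.ev_smul } LinearMap.id ∘ₗ
    (assocEquiv V V' N).symm.toLinearMap

@[simp] theorem ε_tm (N : FDMod K H) (v : V.carrier) (v' : V'.carrier) (x : N.carrier) :
    D.ε N (tm V (tensor V' N) v (tm V' N v' x)) = D.ev (tm V V' v v') • x :=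
  rfl

/-- One half of the adjunction: expanding v by `D.left` inside f(v ⊗ m) produces the left side. -/
theorem ε_map₂_η {M N : FDMod K H} (f : (tensor V M).carrier →ₗ[H] N.carrier) :
    D.ε N ∘ₗ map₂ LinearMap.id (map₂ LinearMap.id f ∘ₗ D.η M) = f := by
  refine hom_ext_tm fun v m => ?_
  simp only [LinearMap.comp_apply, map₂_tm, LinearMap.id_apply, η_apply, map_sum, ε_tm]
  conv_rhs => rw [← D.left v, map_sum, LinearMap.sum_apply, map_sum]
  refine Finset.sum_congr rfl fun i _ => ?_
  rw [map_smul, LinearMap.smul_apply]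
  exact ((f.restrictScalars K).map_smul _ _).symm

/-- The other half: contracting with the counit after inserting ∑ e' i ⊗ e i is the identity of V' ⊗
N, by `D.right`. -/
theorem map₂_ε_η {M N : FDMod K H} (f : M.carrier →ₗ[H] (tensor V' N).carrier) :
    map₂ LinearMap.id (D.ε N ∘ₗ map₂ LinearMap.id f) ∘ₗ D.η M = f := by
  have key : ∀ t : (tensor V' N).carrier,
      ∑ i, tm V' N (D.e' i) (D.ε N (tm V (tensor V' N) (D.e i) t)) = t := by
    intro t
    induction t using tm_induction with
    | zero => simp only [map_zero, Finset.sum_const_zero]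
    | add y z hy hz => simp only [map_add, Finset.sum_add_distrib, hy, hz]
    | tmul v x =>
      conv_rhs => rw [← D.right v, map_sum, LinearMap.sum_apply]
      simp only [ε_tm, map_smul, LinearMap.smul_apply]
  refine LinearMap.ext fun m => ?_
  simp only [LinearMap.comp_apply, map₂_tm, LinearMap.id_apply, η_apply, map_sum, key]

/-- The adjunction between `V ⊗ -` and `V' ⊗ -`. -/
theorem homDim_tensor (D : Duality V V') (M N : FDMod K H) :
    homDim (tensor V M) N = homDim M (tensor V' N) := by
  let F : ((tensor V M).carrier →ₗ[H] N.carrier) →ₗ[K] (M.carrier →ₗ[H] (tensor V' N).carrier) :=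
    { toFun := fun f => map₂ LinearMap.id f ∘ₗ D.η M
      map_add' := fun f g => by
        ext m
        simp [η_apply, Finset.sum_add_distrib]
      map_smul' := fun k f => by
        ext m
        simp [η_apply, Finset.smul_sum] }
  refine (LinearEquiv.ofBijective F ⟨fun f g hfg => ?_, fun g => ?_⟩).finrank_eq
  · rw [← D.ε_map₂_η f, ← D.ε_map₂_η g]
    exact congrArg (fun t => D.ε N ∘ₗ map₂ LinearMap.id t) hfg
  · exact ⟨D.ε N ∘ₗ map₂ LinearMap.id g, D.map₂_ε_η g⟩

/-- Tensoring with a module that has a dual preserves projectivity. -/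
theorem isFDProjective_tensor (D : Duality V V') {P : FDMod K H} (hP : IsFDProjective P) :
    IsFDProjective (tensor V P) := by
  intro N N' g f hg
  have hs : Function.Surjective (map₂ (LinearMap.id : V'.carrier →ₗ[H] V'.carrier) g) :=
    TensorProduct.map_surjective Function.surjective_id hg
  -- Transpose f to P → V' ⊗ N', lift along V' ⊗ g, and transpose back. Naturality of the counit
  -- shows that the result lifts f.
  obtain ⟨f', hf'⟩ := hP _ _ _ (map₂ LinearMap.id f ∘ₗ D.η P) hs
  refine ⟨D.ε N ∘ₗ map₂ LinearMap.id f', ?_⟩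
  have hnat : g ∘ₗ D.ε N ∘ₗ map₂ LinearMap.id f' =
      D.ε N' ∘ₗ map₂ LinearMap.id (map₂ LinearMap.id g ∘ₗ f') := by
    refine hom_ext_tm fun v p => ?_
    simp only [LinearMap.comp_apply, map₂_tm, LinearMap.id_apply]
    generalize f' p = t
    induction t using tm_induction with
    | zero => simp only [map_zero]
    | add x y hx hy => simp only [map_add, hx, hy]
    | tmul v' x =>
      simp only [ε_tm, map₂_tm, LinearMap.id_apply]
      exact (g.restrictScalars K).map_smul _ _
  rw [hnat, hf', D.ε_map₂_η]

end Duality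

end FDMod

end Green
end

noncomputable section

namespace Taft

open Green FDMod

/-! ### The scalars in the action on V(l,r) -/

section scalars

variable {K : Type u} [Field K] {n : ℕ} {q : K}

theorem q_ne_zero (n : ℕ) (q : K) [NeZero n] [hq : Fact (IsPrimitiveRoot q n)] : q ≠ 0 := (hq.out).ne_zero (NeZero.ne n)

theorem zpow_eq_zpow_iff [NeZero n] [hq : Fact (IsPrimitiveRoot q n)] (r s : ℤ) : q ^ r = q ^ s ↔ (n : ℤ) ∣ r - s := by
  rw [← (hq.out).zpow_eq_one_iff_dvd, zpow_sub₀ (q_ne_zero n q),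
    div_eq_one_iff_eq (zpow_ne_zero _ (q_ne_zero n q))]

/-- The coefficients by which d lowers the basis vectors of V(l,r) vanish only at the lowest vector;
this is what makes V(l,r) simple. -/
theorem qInt_mul_ne_zero (hq : IsPrimitiveRoot q n) {k l : ℕ} (hk : 0 < k) (hkl : k < l) (hl : l ≤ n) :
    qInt q k * (1 - q ^ (k - l : ℤ)) ≠ 0 := by
  refine mul_ne_zero (qInt_ne_zero hq hk (by omega)) ?_
  rw [sub_ne_zero, ne_comm, Ne, hq.zpow_eq_one_iff_dvd]
  intro h
  have := Int.eq_zero_of_abs_lt_dvd h (by rw [abs_lt]; omega)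
  omega

/-- The recursion that da = q ad + 1 - bc imposes on the coefficients of d: the product bc acts on
the k-th basis vector as q^(2k+1-l). -/
theorem qInt_mul_succ (hq0 : q ≠ 0) (k l : ℕ) : qInt q (k + 1) * (1 - q ^ (((k + 1 : ℕ) : ℤ) - l)) =
    q * (qInt q k * (1 - q ^ (k - l : ℤ))) + 1 - q ^ (2 * k + 1 - l : ℤ) := by
  have e₁ : qInt q (k + 1) = 1 + q * qInt q k := by
    rw [add_comm k 1, qInt_add]; simp [qInt]
  have e₂ : qInt q (k + 1) = qInt q k + q ^ k := by
    rw [qInt_add]; simp [qInt]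
  have e₃ : q ^ (((k + 1 : ℕ) : ℤ) - l) = q * q ^ (k - l : ℤ) := by
    rw [← zpow_one_add₀ hq0]; congr 1; push_cast; ring
  have e₄ : q ^ (2 * k + 1 - l : ℤ) = q * q ^ (k - l : ℤ) * q ^ k := by
    rw [← zpow_natCast q k, ← zpow_one_add₀ hq0, ← zpow_add₀ hq0]
    congr 1; ring
  rw [e₃, e₄]
  linear_combination e₁ - q * q ^ (k - l : ℤ) * e₂

end scalars

/-! ### The action of the generators on a module -/

section op

variable {K : Type u} [Field K] {n : ℕ} {q : K}

/-- The action of a generator. -/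
def op (M : FDMod K (Hn n 1 q)) (g : Gen) : Module.End K M.carrier := M.ρ (Hn.gen n 1 q g)

theorem Relations.map {R R' : Type*} [Ring R] [Algebra K R] [Ring R'] [Algebra K R'] {p : K}
    {a b c d : R} (h : Relations n p q a b c d) (f : R →ₐ[K] R') :
    Relations n p q (f a) (f b) (f c) (f d) where
  ba := by rw [← map_mul, h.ba, map_smul, map_mul]
  db := by rw [← map_mul, h.db, map_smul, map_mul]
  ca := by rw [← map_mul, h.ca, map_smul, map_mul]
  dc := by rw [← map_mul, h.dc, map_smul, map_mul]
  bc := by rw [← map_mul, h.bc, map_mul]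
  an := by rw [← map_pow, h.an, map_zero]
  bn := by rw [← map_pow, h.bn, map_one]
  cn := by rw [← map_pow, h.cn, map_one]
  dn := by rw [← map_pow, h.dn, map_zero]
  da := by rw [← map_mul, ← map_mul, ← map_mul, ← map_one f, ← map_sub, ← map_smul, ← map_smul,
    ← map_sub, h.da]

theorem op_relations (M : FDMod K (Hn n 1 q)) :
    Relations n 1 q (op M .a) (op M .b) (op M .c) (op M .d) :=
  (Hn.relations n 1 q).map M.ρ

/-- A `K`-linear map that commutes with the generators is `H`-linear. -/
def homOfGen {M N : FDMod K (Hn n 1 q)} (f : M.carrier →ₗ[K] N.carrier)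
    (h : ∀ g m, f (op M g m) = op N g (f m)) : M.carrier →ₗ[Hn n 1 q] N.carrier :=
  { f with
    map_smul' := fun x m => by
      let A : Subalgebra K (Hn n 1 q) :=
        { carrier := {x | ∀ m, f (M.ρ x m) = N.ρ x (f m)}
          mul_mem' := fun {x y} hx hy m => by
            rw [map_mul, map_mul, Module.End.mul_apply, Module.End.mul_apply, hx, hy]
          add_mem' := fun {x y} hx hy m => by
            rw [map_add, map_add, LinearMap.add_apply, LinearMap.add_apply, map_add, hx, hy]
          algebraMap_mem' := fun r m => by simp }
      exact Hn.gen_induction A (fun g m => h g m) x m }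

theorem map_op {M N : FDMod K (Hn n 1 q)} (f : M.carrier →ₗ[Hn n 1 q] N.carrier) (g : Gen)
    (m : M.carrier) : f (op M g m) = op N g (f m) :=
  f.map_smul (Hn.gen n 1 q g) m

theorem map_op_pow {M N : FDMod K (Hn n 1 q)} (f : M.carrier →ₗ[Hn n 1 q] N.carrier) (g : Gen)
    (k : ℕ) (m : M.carrier) : f ((op M g ^ k) m) = (op N g ^ k) (f m) := by
  induction k generalizing m with
  | zero => rfl
  | succ k ih => rw [pow_succ, pow_succ, Module.End.mul_apply, Module.End.mul_apply, ih, map_op]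

theorem op_pow_mem {M : FDMod K (Hn n 1 q)} (N : Submodule (Hn n 1 q) M.carrier) (g : Gen)
    (k : ℕ) {m : M.carrier} (hm : m ∈ N) : (op M g ^ k) m ∈ N := by
  induction k with
  | zero => exact hm
  | succ k ih =>
    rw [pow_succ', Module.End.mul_apply]
    exact N.smul_mem (Hn.gen n 1 q g) ih

theorem op_b_a (M : FDMod K (Hn n 1 q)) (m : M.carrier) :
    op M .b (op M .a m) = q • op M .a (op M .b m) := DFunLike.congr_fun (op_relations M).ba m

theorem op_c_a (M : FDMod K (Hn n 1 q)) (m : M.carrier) :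
    op M .c (op M .a m) = q • op M .a (op M .c m) := DFunLike.congr_fun (op_relations M).ca m

theorem op_d_b (M : FDMod K (Hn n 1 q)) (m : M.carrier) :
    op M .d (op M .b m) = q • op M .b (op M .d m) := DFunLike.congr_fun (op_relations M).db m

theorem op_d_c (M : FDMod K (Hn n 1 q)) (m : M.carrier) :
    op M .d (op M .c m) = q • op M .c (op M .d m) := DFunLike.congr_fun (op_relations M).dc m

theorem op_b_c (M : FDMod K (Hn n 1 q)) (m : M.carrier) :
    op M .b (op M .c m) = op M .c (op M .b m) := DFunLike.congr_fun (op_relations M).bc m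

theorem op_d_a (M : FDMod K (Hn n 1 q)) (m : M.carrier) :
    op M .d (op M .a m) = q • op M .a (op M .d m) + m - op M .b (op M .c m) := by
  have := DFunLike.congr_fun (op_relations M).da m
  simp only [one_smul, LinearMap.sub_apply, Module.End.mul_apply, LinearMap.smul_apply,
    Module.End.one_apply] at this
  rw [add_sub_assoc, ← this]
  abel

end op

/-! ### Lowest vectors and the universal property of V(l,r) -/

section lowest

variable {K : Type u} [Field K] {n : ℕ} {q : K}

/-- `v` is annihilated by `d` and has the weight of the lowest vector of `V(l, r)`. -/
structure IsLowest (M : FDMod K (Hn n 1 q)) (l : ℕ) (r : ℤ) (v : M.carrier) : Prop where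
  b : op M .b v = q ^ r • v
  c : op M .c v = q ^ (1 - r - l : ℤ) • v
  d : op M .d v = 0

variable {M N : FDMod K (Hn n 1 q)} {l : ℕ} {r : ℤ} {v : M.carrier}

theorem IsLowest.map (h : IsLowest M l r v) (f : M.carrier →ₗ[Hn n 1 q] N.carrier) :
    IsLowest N l r (f v) where
  b := by rw [← map_op, h.b]; exact (f.restrictScalars K).map_smul _ _
  c := by rw [← map_op, h.c]; exact (f.restrictScalars K).map_smul _ _
  d := by rw [← map_op, h.d, map_zero]

/-- Since d is nilpotent, the last nonzero vector among the d^k y, for y ≠ 0 in N, is killed by d.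
-/
theorem exists_op_d_eq_zero {N : Submodule (Hn n 1 q) M.carrier} (hN : N ≠ ⊥) :
    ∃ x ∈ N, x ≠ 0 ∧ op M .d x = 0 := by
  classical
  obtain ⟨y, hy, hy0⟩ := (Submodule.ne_bot_iff N).1 hN
  have hex : ∃ k, (op M .d ^ k) y = 0 := ⟨n, by rw [(op_relations M).dn]; rfl⟩
  obtain ⟨k, hk⟩ : ∃ k, Nat.find hex = k + 1 := by
    refine ⟨Nat.find hex - 1, (Nat.succ_pred_eq_of_pos ?_).symm⟩
    rw [Nat.find_pos]
    exact hy0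
  refine ⟨(op M .d ^ k) y, op_pow_mem N .d k hy, Nat.find_min hex (by omega), ?_⟩
  have := Nat.find_spec hex
  rwa [hk, pow_succ', Module.End.mul_apply] at this

variable [hq : Fact (IsPrimitiveRoot q n)]

variable (hl : l ≤ n)

/-- The basis vectors of `V(l, r)`. -/
def vv (l : ℕ) (hl : l ≤ n) (r : ℤ) (k : ℕ) : (V (q := q) l hl r).carrier := vec K l k

theorem op_V_a (k : ℕ) : op (V (q := q) l hl r) .a (vv l hl r k) = vv l hl r (k + 1) := by
  have : op (V (q := q) l hl r) .a = opA K l :=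
    Hn.lift_gen (relations_op q r hq.out hl) .a
  rw [this]; exact opA_vec l k

theorem op_V_b (k : ℕ) :
    op (V (q := q) l hl r) .b (vv l hl r k) = q ^ (r + k) • vv l hl r k := by
  have : op (V (q := q) l hl r) .b = opB q l r :=
    Hn.lift_gen (relations_op q r hq.out hl) .b
  rw [this]; exact opB_vec q l r k

theorem op_V_c (k : ℕ) :
    op (V (q := q) l hl r) .c (vv l hl r k) = q ^ (k + 1 - r - l : ℤ) • vv l hl r k := by
  have : op (V (q := q) l hl r) .c = opC q l r :=
    Hn.lift_gen (relations_op q r hq.out hl) .c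
  rw [this]; exact opC_vec q l r k

theorem op_V_d {k : ℕ} (hk : k ≤ l) : op (V (q := q) l hl r) .d (vv l hl r k) =
    (qInt q k * (1 - q ^ (k - l : ℤ))) • vv l hl r (k - 1) := by
  have : op (V (q := q) l hl r) .d = opD q l :=
    Hn.lift_gen (relations_op q r hq.out hl) .d
  rw [this]; exact opD_vec q l hk

theorem vv_eq_zero {k : ℕ} (hk : l ≤ k) : vv (q := q) l hl r k = 0 := vec_of_le l hk

theorem vv_ne_zero {k : ℕ} (hk : k < l) : vv (q := q) l hl r k ≠ 0 := by
  intro h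
  have := congrFun (show (vec K l k) = 0 from h) ⟨k, hk⟩
  simp [vec, hk] at this

theorem op_V_a_pow (m k : ℕ) :
    (op (V (q := q) l hl r) .a ^ m) (vv l hl r k) = vv l hl r (k + m) := by
  induction m with
  | zero => rfl
  | succ m ih => rw [pow_succ', Module.End.mul_apply, ih, op_V_a, add_assoc]

theorem dim_V : (V (q := q) l hl r).dim = l :=
  (Module.finrank_fintype_fun_eq_card K).trans (Fintype.card_fin l)

theorem isLowest_vv : IsLowest (V (q := q) l hl r) l r (vv l hl r 0) where
  b := by simpa using op_V_b (q := q) hl (r := r) 0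
  c := by simpa using op_V_c (q := q) hl (r := r) 0
  d := by simpa [qInt] using op_V_d (q := q) hl (r := r) (Nat.zero_le l)

theorem ext_vv {X : Type*} [AddCommGroup X] [Module K X]
    {f g : (V (q := q) l hl r).carrier →ₗ[K] X}
    (h : ∀ k, k < l → f (vv l hl r k) = g (vv l hl r k)) : f = g := by
  refine (Pi.basisFun K (Fin l)).ext fun i => ?_
  rw [Pi.basisFun_apply, ← vec_coe]
  exact h i i.2

/-- A submodule that contains the lowest vector of `V(l, r)` is everything. -/
theorem eq_top_of_vv_mem {N : Submodule (Hn n 1 q) (V (q := q) l hl r).carrier}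
    (h : vv l hl r 0 ∈ N) : N = ⊤ := by
  have h0 : (N.restrictScalars K).mkQ = 0 := ext_vv hl fun k _ => by
    have := op_pow_mem N .a k h
    rw [op_V_a_pow, zero_add] at this
    rw [LinearMap.zero_apply]
    exact (Submodule.Quotient.mk_eq_zero _).2 this
  refine top_unique fun x _ => ?_
  exact (Submodule.Quotient.mk_eq_zero (N.restrictScalars K)).1 (DFunLike.congr_fun h0 x)

/-- Maps from `V(l, r)` are determined by the image of the lowest vector. -/
theorem hom_ext_vv {f g : (V (q := q) l hl r).carrier →ₗ[Hn n 1 q] M.carrier}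
    (h : f (vv l hl r 0) = g (vv l hl r 0)) : f = g := by
  have : LinearMap.eqLocus f g = ⊤ := eq_top_of_vv_mem hl h
  exact LinearMap.ext fun x => (this ▸ Submodule.mem_top : x ∈ LinearMap.eqLocus f g)

/-- The vectors of `V(l, r)` annihilated by `d` are the multiples of the lowest vector. -/
theorem eq_smul_of_op_d {x : (V (q := q) l hl r).carrier} (hx : op (V l hl r) .d x = 0) :
    ∃ t : K, x = t • vv l hl r 0 := by
  have hd : op (V (q := q) l hl r) .d = opD q l :=
    Hn.lift_gen (relations_op q r hq.out hl) .d
  rw [hd] at hx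
  change Fin l → K at x
  change opD q l x = 0 at hx
  -- The k-th coordinate of d x is the (k+1)-st coordinate of x times a nonzero scalar.
  have hzero : ∀ k (hk : k + 1 < l), x ⟨k + 1, hk⟩ = 0 := by
    intro k hk
    have h := congrFun hx ⟨k, by omega⟩
    have hsum : opD q l x = ∑ i, x i •
        (qInt q i * (1 - q ^ ((i : ℕ) - l : ℤ))) • vec K l (i - 1) := by
      rw [opD, Module.Basis.constr_apply_fintype]; rfl
    rw [hsum, Finset.sum_apply, Finset.sum_eq_single ⟨k + 1, hk⟩] at h
    · have hv : vec K l (k + 1 - 1) ⟨k, by omega⟩ = 1 := by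
        simp [vec, show k < l by omega]
      simp only [Pi.smul_apply, hv, smul_eq_mul, mul_one, Pi.zero_apply] at h
      exact (mul_eq_zero.1 h).resolve_right (qInt_mul_ne_zero hq.out k.succ_pos hk hl)
    · intro i _ hi
      by_cases h0 : (i : ℕ) = 0
      · simp [h0, qInt]
      · have : vec K l (i - 1) ⟨k, by omega⟩ = 0 := by
          have hi' : (i : ℕ) ≠ k + 1 := fun h => hi (Fin.ext h)
          have h1 : (i : ℕ) - 1 < l := by omega
          rw [vec, dif_pos h1, Pi.single_apply, if_neg]
          rw [Fin.mk.injEq]; omega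
        simp [this]
    · simp
  rcases Nat.eq_zero_or_pos l with h0 | h0
  · subst h0
    exact ⟨0, Subsingleton.elim (α := Fin 0 → K) _ _⟩
  refine ⟨x ⟨0, h0⟩, ?_⟩
  change x = x ⟨0, h0⟩ • vec K l 0
  funext i
  obtain ⟨i, hi⟩ := i
  cases i with
  | zero => simp [vec, h0]
  | succ k => simp [hzero k hi, vec, h0]

/-- A nonzero submodule contains a nonzero vector killed by d. Such a vector is a multiple of the
lowest vector, which generates the module. -/
theorem isSimple_V (hl0 : 0 < l) : IsSimpleModule (Hn n 1 q) (V (q := q) l hl r).carrier := by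
  have hnt : Nontrivial (V (q := q) l hl r).carrier := ⟨_, _, vv_ne_zero hl hl0⟩
  rw [isSimpleModule_iff]
  refine ⟨fun N => or_iff_not_imp_left.2 fun hN => ?_⟩
  obtain ⟨x, hx, hx0, hd⟩ := exists_op_d_eq_zero hN
  obtain ⟨t, rfl⟩ := eq_smul_of_op_d hl hd
  have ht : t ≠ 0 := by rintro rfl; simp at hx0
  refine eq_top_of_vv_mem hl ?_
  have := (N.restrictScalars K).smul_mem t⁻¹ hx
  rwa [smul_smul, inv_mul_cancel₀ ht, one_smul] at this

variable [NeZero n]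

theorem IsLowest.b_pow (h : IsLowest M l r v) (k : ℕ) :
    op M .b ((op M .a ^ k) v) = q ^ (r + k) • (op M .a ^ k) v := by
  induction k with
  | zero => simpa using h.b
  | succ k ih =>
    rw [pow_succ', Module.End.mul_apply, op_b_a, ih, map_smul, smul_smul,
      ← zpow_one_add₀ (q_ne_zero n q)]
    congr 2; push_cast; ring

theorem IsLowest.c_pow (h : IsLowest M l r v) (k : ℕ) :
    op M .c ((op M .a ^ k) v) = q ^ (k + 1 - r - l : ℤ) • (op M .a ^ k) v := by
  induction k with
  | zero => simpa using h.c
  | succ k ih =>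
    rw [pow_succ', Module.End.mul_apply, op_c_a, ih, map_smul, smul_smul,
      ← zpow_one_add₀ (q_ne_zero n q)]
    congr 2; push_cast; ring

/-- The formula of V(l,r) holds above any lowest vector, even if a^l does not kill it. The
coefficient vanishes at k = l, so a^l v is again killed by d. -/
theorem IsLowest.d_pow (h : IsLowest M l r v) (k : ℕ) :
    op M .d ((op M .a ^ k) v) = (qInt q k * (1 - q ^ (k - l : ℤ))) • (op M .a ^ (k - 1)) v := by
  induction k with
  | zero => simpa [qInt] using h.d
  | succ k ih =>
    have e : (qInt q k * (1 - q ^ (k - l : ℤ))) • op M .a ((op M .a ^ (k - 1)) v) =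
        (qInt q k * (1 - q ^ (k - l : ℤ))) • (op M .a ^ k) v := by
      rcases Nat.eq_zero_or_pos k with rfl | h0
      · simp [qInt]
      · obtain ⟨j, rfl⟩ : ∃ j, k = j + 1 := ⟨k - 1, by omega⟩
        rw [Nat.add_sub_cancel, pow_succ', Module.End.mul_apply]
    rw [Nat.add_sub_cancel, qInt_mul_succ (q_ne_zero n q), pow_succ', Module.End.mul_apply, op_d_a, ih, map_smul,
      e, h.c_pow, map_smul, h.b_pow, smul_smul, smul_smul, ← zpow_add₀ (q_ne_zero n q), sub_smul,
      add_smul, one_smul]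
    congr 3; ring

/-- In a module with lowest vector `v` of type `(l, r)`, `a ^ l v` is again a lowest vector. -/
theorem IsLowest.pow (h : IsLowest M l r v) (l' : ℕ) (hl : (l' : ℤ) = n - l) :
    IsLowest M l' (r + l) ((op M .a ^ l) v) where
  b := h.b_pow l
  c := by
    rw [h.c_pow l]
    congr 1
    rw [zpow_eq_zpow_iff (n := n), hl]
    exact ⟨1, by ring⟩
  d := by rw [h.d_pow l, sub_self, zpow_zero, sub_self, mul_zero, zero_smul]

/-- The universal property of `V(l, r)`. -/
def homOfLowest (hv : IsLowest M l r v) (ha : (op M .a ^ l) v = 0) :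
    (V (q := q) l hl r).carrier →ₗ[Hn n 1 q] M.carrier :=
  homOfGen (M := V l hl r)
    ((Pi.basisFun K (Fin l)).constr K fun i => (op M .a ^ (i : ℕ)) v) (by
      have key : ∀ k, k ≤ l → ((Pi.basisFun K (Fin l)).constr K fun i => (op M .a ^ (i : ℕ)) v)
          (vv (q := q) l hl r k) = (op M .a ^ k) v := by
        intro k hk
        rcases hk.lt_or_eq with hk | rfl
        · have := (Pi.basisFun K (Fin l)).constr_basis K
            (fun i => (op M .a ^ (i : ℕ)) v) ⟨k, hk⟩
          rwa [Pi.basisFun_apply, ← vec_coe] at this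
        · rw [vv_eq_zero _ le_rfl, ha]
          exact map_zero _
      intro g
      let F : (V (q := q) l hl r).carrier →ₗ[K] M.carrier :=
        (Pi.basisFun K (Fin l)).constr K fun i => (op M .a ^ (i : ℕ)) v
      refine LinearMap.congr_fun (f := F ∘ₗ op (V (q := q) l hl r) g)
        (g := op M g ∘ₗ F) (ext_vv hl fun k hk => ?_)
      change ∀ k, k ≤ l → F (vv (q := q) l hl r k) = (op M .a ^ k) v at key
      rw [LinearMap.comp_apply, LinearMap.comp_apply, key k hk.le]
      cases g
      · rw [op_V_a, key _ hk, pow_succ', Module.End.mul_apply]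
      · rw [op_V_b, map_smul, key k hk.le, hv.b_pow]
      · rw [op_V_c, map_smul, key k hk.le, hv.c_pow]
      · rw [op_V_d hl hk.le, map_smul, key _ (by omega), hv.d_pow])

theorem homOfLowest_vv_zero (hl0 : 0 < l) (hv : IsLowest M l r v) (ha : (op M .a ^ l) v = 0) :
    homOfLowest hl hv ha (vv l hl r 0) = v := by
  have := (Pi.basisFun K (Fin l)).constr_basis K (fun i => (op M .a ^ (i : ℕ)) v) ⟨0, hl0⟩
  rw [Pi.basisFun_apply, ← vec_coe] at this
  exact this


/-! ### Homomorphisms between the simple modules -/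

/-- As q^n = 1, the lowest vector of V(l,s) also has type (l,r). The induced map between simple
modules is nonzero, hence bijective. -/
theorem equiv_V_of_dvd {s : ℤ} (h : (n : ℤ) ∣ r - s) :
    Nonempty ((V (q := q) l hl r).carrier ≃ₗ[Hn n 1 q] (V (q := q) l hl s).carrier) := by
  rcases Nat.eq_zero_or_pos l with h0 | h0
  · have h₁ := dim_eq_zero_iff.1 ((dim_V (q := q) hl (r := r)).trans h0)
    have h₂ := dim_eq_zero_iff.1 ((dim_V (q := q) hl (r := s)).trans h0)
    exact ⟨⟨0, 0, fun _ => Subsingleton.elim _ _, fun _ => Subsingleton.elim _ _⟩⟩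
  have hv : IsLowest (V (q := q) l hl s) l r (vv l hl s 0) := by
    have h' := isLowest_vv (q := q) hl (r := s)
    refine ⟨?_, ?_, h'.d⟩
    · rw [h'.b, (zpow_eq_zpow_iff (n := n) r s).2 h]
    · rw [h'.c, (zpow_eq_zpow_iff (n := n) (1 - r - l) (1 - s - l)).2]
      rw [show (1 - r - l - (1 - s - l) : ℤ) = -(r - s) by ring]
      exact h.neg_right
  let f := homOfLowest hl hv (by rw [op_V_a_pow, zero_add, vv_eq_zero _ le_rfl])
  have hf : f ≠ 0 := by
    intro h0'
    refine vv_ne_zero (q := q) hl (r := s) h0 ?_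
    rw [← homOfLowest_vv_zero hl h0 hv (by rw [op_V_a_pow, zero_add, vv_eq_zero _ le_rfl])]
    exact DFunLike.congr_fun h0' _
  have h₁ := isSimple_V (q := q) hl (r := r) h0
  have h₂ := isSimple_V (q := q) hl (r := s) h0
  exact ⟨LinearEquiv.ofBijective f ((LinearMap.bijective_or_eq_zero f).resolve_right hf)⟩

/-- Schur's lemma by hand, over any field: a map is determined by the image of the lowest vector,
which is again killed by d and so a multiple of the lowest vector of the target. If the image is
nonzero, the weights under b and c must agree. -/
theorem homDim_V {l' : ℕ} (hl' : l' ≤ n) {r' : ℤ} (h0 : 0 < l) (h0' : 0 < l') :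
    homDim (V (q := q) l hl r) (V (q := q) l' hl' r') =
      if l = l' ∧ (n : ℤ) ∣ r - r' then 1 else 0 := by
  split_ifs with h
  · obtain ⟨rfl, h⟩ := h
    obtain ⟨e⟩ := equiv_V_of_dvd (q := q) hl h
    rw [homDim_congr_left e]
    refine finrank_eq_one (LinearMap.id) (fun h => ?_) fun f => ?_
    · exact vv_ne_zero (q := q) hl (r := r') h0 (DFunLike.congr_fun h _)
    · obtain ⟨t, ht⟩ := eq_smul_of_op_d hl ((isLowest_vv (q := q) hl (r := r')).map f).d
      exact ⟨t, hom_ext_vv hl ht.symm⟩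
  · refine homDim_eq_zero_iff.2 fun f => ?_
    by_contra hf
    have hlow := (isLowest_vv (q := q) hl (r := r)).map f
    obtain ⟨t, ht⟩ := eq_smul_of_op_d hl' hlow.d
    have ht0 : t ≠ 0 := by
      rintro rfl
      refine hf (hom_ext_vv hl ?_)
      rw [ht, zero_smul]; rfl
    have hlow' := isLowest_vv (q := q) hl' (r := r')
    have hne : t • vv (q := q) l' hl' r' 0 ≠ 0 := smul_ne_zero ht0 (vv_ne_zero hl' h0')
    rw [ht] at hlow
    have hb := hlow.b
    rw [map_smul, hlow'.b, smul_comm] at hb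
    have hb := (zpow_eq_zpow_iff (n := n) r' r).1 (smul_left_injective K hne hb)
    have hc := hlow.c
    rw [map_smul, hlow'.c, smul_comm] at hc
    have hc := (zpow_eq_zpow_iff (n := n) _ _).1 (smul_left_injective K hne hc)
    refine h ⟨?_, by rw [← neg_sub]; exact hb.neg_right⟩
    -- The weight of bc on a lowest vector is q^(1-l), so l is determined modulo n, and it lies
    -- between 1 and n.
    have hd : (n : ℤ) ∣ (l : ℤ) - l' := by
      have := dvd_add hb hc
      rwa [show (r' - r + (1 - r' - l' - (1 - r - l)) : ℤ) = l - l' by ring] at this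
    have := Int.eq_zero_of_abs_lt_dvd hd (by rw [abs_lt]; omega)
    omega

/-! ### Classification of the simple modules -/

/-- An eigenvalue on W exists because K is algebraically closed. It is an n-th root of unity since
f^n = 1, hence a power of q. -/
theorem exists_eigenvector {X : Type*} [AddCommGroup X] [Module K X] [IsAlgClosed K]
    [Module.Finite K X] (f : Module.End K X) (W : Submodule K X) (hW : W ≠ ⊥)
    (h : ∀ x ∈ W, f x ∈ W) (hf : f ^ n = 1) : ∃ x ∈ W, x ≠ 0 ∧ ∃ r : ℤ, f x = q ^ r • x := by
  have : Nontrivial W := Submodule.nontrivial_iff_ne_bot.2 hW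
  obtain ⟨μ, hμ⟩ := Module.End.exists_eigenvalue (f.restrict h)
  obtain ⟨x, hx⟩ := hμ.exists_hasEigenvector
  have hx' : f x = μ • (x : X) := congrArg Subtype.val hx.apply_eq_smul
  have hx0 : (x : X) ≠ 0 := fun h => hx.2 (Subtype.ext h)
  have hpow : ∀ k : ℕ, (f ^ k) (x : X) = μ ^ k • (x : X) := by
    intro k
    induction k with
    | zero => simp
    | succ k ih => rw [pow_succ', Module.End.mul_apply, ih, map_smul, hx', smul_smul, pow_succ]
  have h1 : μ ^ n = 1 := by
    have := hpow n
    rw [hf] at this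
    refine smul_left_injective K hx0 (this.symm.trans ?_)
    exact (one_smul K (x : X)).symm
  obtain ⟨i, -, hi⟩ := (hq.out).eq_pow_of_pow_eq_one h1
  exact ⟨x, x.2, hx0, i, by rw [hx', zpow_natCast, hi]⟩

/-- The kernel of d is nonzero and stable under the commuting operators b and c, so it contains a
common eigenvector. Any pair of weights is that of a lowest vector for some l. -/
theorem exists_isLowest [IsAlgClosed K] (hM : Nontrivial M.carrier) :
    ∃ (l : ℕ) (r : ℤ) (v : M.carrier), 0 < l ∧ l ≤ n ∧ v ≠ 0 ∧ IsLowest M l r v := by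
  obtain ⟨x, -, hx0, hx⟩ := exists_op_d_eq_zero (M := M) (N := ⊤) top_ne_bot
  obtain ⟨y, hy, hy0, r, hyr⟩ := exists_eigenvector (n := n) (q := q) (op M .b)
    (LinearMap.ker (op M .d)) ((Submodule.ne_bot_iff _).2 ⟨x, hx, hx0⟩)
    (fun z hz => by rw [LinearMap.mem_ker, op_d_b, LinearMap.mem_ker.1 hz, map_zero, smul_zero])
    (op_relations M).bn
  obtain ⟨v, hv, hv0, s, hvs⟩ := exists_eigenvector (n := n) (q := q) (op M .c)
    (LinearMap.ker (op M .d) ⊓ Module.End.eigenspace (op M .b) (q ^ r))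
    ((Submodule.ne_bot_iff _).2 ⟨y, ⟨hy, Module.End.mem_eigenspace_iff.2 hyr⟩, hy0⟩)
    (fun z hz => by
      refine ⟨?_, Module.End.mem_eigenspace_iff.2 ?_⟩
      · rw [SetLike.mem_coe, LinearMap.mem_ker, op_d_c, LinearMap.mem_ker.1 hz.1, map_zero,
          smul_zero]
      · rw [op_b_c, Module.End.mem_eigenspace_iff.1 hz.2, map_smul])
    (op_relations M).cn
  have hn : (0 : ℤ) < n := by exact_mod_cast NeZero.pos n
  have h₁ := Int.emod_nonneg (-r - s) hn.ne'
  have h₂ := Int.emod_lt_of_pos (-r - s) hn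
  -- With weights q^r and q^s, the condition s ≡ 1 - r - l modulo n determines l; the representative
  -- between 1 and n is taken.
  refine ⟨((-r - s) % n).toNat + 1, r, v, Nat.succ_pos _, by omega, hv0,
    Module.End.mem_eigenspace_iff.1 hv.2, ?_, hv.1⟩
  rw [hvs, (zpow_eq_zpow_iff (n := n) s _).2]
  push_cast
  rw [Int.toNat_of_nonneg h₁, Int.emod_def]
  exact ⟨-((-r - s) / n), by ring⟩

/-- A lowest vector v of type (l,r) gives a nonzero map V(l,r) → M once a^l v = 0. If a^l v ≠ 0, the
vectors a^(l+k) v span a nonzero submodule, which is M. Then a^l is surjective, against a^n = 0 and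
v ≠ 0. -/
theorem exists_equiv_V [IsAlgClosed K] (hM : IsSimpleModule (Hn n 1 q) M.carrier) :
    ∃ (l : ℕ) (hl : l ≤ n) (r : ℤ), 0 < l ∧
      Nonempty (M.carrier ≃ₗ[Hn n 1 q] (V (q := q) l hl r).carrier) := by
  obtain ⟨l, r, v, hl0, hl, hv0, hv⟩ := exists_isLowest (IsSimpleModule.nontrivial (Hn n 1 q) M.carrier)
  have ha : (op M .a ^ l) v = 0 := by
    by_contra hne
    let W : Submodule K M.carrier := Submodule.span K (Set.range fun k => (op M .a ^ (l + k)) v)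
    have hmem : ∀ k, l ≤ k → (op M .a ^ k) v ∈ W := fun k hk =>
      Submodule.subset_span ⟨k - l, by simp only; rw [Nat.add_sub_cancel' hk]⟩
    have hstab : ∀ (g : Gen) (x : M.carrier), x ∈ W → op M g x ∈ W := by
      intro g x hx
      induction hx using Submodule.span_induction with
      | zero => rw [map_zero]; exact W.zero_mem
      | add x y _ _ hx hy => rw [map_add]; exact W.add_mem hx hy
      | smul t x _ hx => rw [map_smul]; exact W.smul_mem t hx
      | mem x hx =>
        obtain ⟨k, rfl⟩ := hx
        cases g
        · simp only
          rw [← Module.End.mul_apply, ← pow_succ']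
          exact hmem _ (by omega)
        · simp only [hv.b_pow]
          exact W.smul_mem _ (hmem _ (by omega))
        · simp only [hv.c_pow]
          exact W.smul_mem _ (hmem _ (by omega))
        · simp only [hv.d_pow]
          -- At k = 0 the span is not left downwards, because d kills a^l v.
          rcases Nat.eq_zero_or_pos k with rfl | hk
          · simp
          · exact W.smul_mem _ (hmem _ (by omega))
    have hρ : ∀ (h : Hn n 1 q) (x : M.carrier), x ∈ W → M.ρ h x ∈ W := by
      intro h
      let A : Subalgebra K (Hn n 1 q) :=
        { carrier := {h | ∀ x ∈ W, M.ρ h x ∈ W}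
          mul_mem' := fun {x y} hx hy m hm => by
            rw [map_mul, Module.End.mul_apply]
            exact hx _ (hy _ hm)
          add_mem' := fun {x y} hx hy m hm => by
            rw [map_add, LinearMap.add_apply]
            exact W.add_mem (hx _ hm) (hy _ hm)
          algebraMap_mem' := fun t m hm => by
            rw [AlgHom.commutes]
            exact W.smul_mem t hm }
      exact Hn.gen_induction A hstab h
    let W' : Submodule (Hn n 1 q) M.carrier := { W with smul_mem' := fun h {x} hx => hρ h x hx }
    have htop : W' = ⊤ := (eq_bot_or_eq_top W').resolve_left fun h => hne (by
      have : (op M .a ^ l) v ∈ W' := hmem l le_rfl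
      rwa [h, Submodule.mem_bot] at this)
    have hsurj : Function.Surjective (op M .a ^ l) := by
      intro x
      have hx : x ∈ W' := htop ▸ Submodule.mem_top
      refine (Submodule.span_le (p := LinearMap.range (op M .a ^ l))).2 ?_ hx
      rintro _ ⟨k, rfl⟩
      exact ⟨(op M .a ^ k) v, by rw [← Module.End.mul_apply, ← pow_add]⟩
    have hsurj' : Function.Surjective ((op M .a ^ l) ^ n) := by
      rw [Module.End.coe_pow]
      exact hsurj.iterate n
    obtain ⟨x, hx⟩ := hsurj' v
    rw [← pow_mul, mul_comm, pow_mul, (op_relations M).an, zero_pow hl0.ne'] at hx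
    exact hv0 hx.symm
  have := isSimple_V (q := q) hl (r := r) hl0
  let f := homOfLowest hl hv ha
  have hf : f ≠ 0 := by
    intro h
    refine hv0 ?_
    rw [← homOfLowest_vv_zero hl hl0 hv ha]
    exact DFunLike.congr_fun h _
  exact ⟨l, hl, r, hl0, ⟨(LinearEquiv.ofBijective f
    ((LinearMap.bijective_or_eq_zero f).resolve_right hf)).symm⟩⟩

end lowest

end Taft
end

/-! ### Exactness and splitting from dimension counts -/

noncomputable section

namespace Green.FDMod

variable {K : Type u} {H : Type v} [Field K] [Ring H] [Algebra K H]

/-- The cokernel of a map, with the dimension count that decides whether the map is injective. -/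
theorem exists_cokernel {A M : FDMod K H} (f : A.carrier →ₗ[H] M.carrier) :
    ∃ (M' : FDMod K H) (p : M.carrier →ₗ[H] M'.carrier), Function.Surjective p ∧
      (∀ x, p (f x) = 0) ∧ M.dim ≤ A.dim + M'.dim ∧
      (M.dim = A.dim + M'.dim → ∀ P : FDMod K H, IsFDProjective P →
        homDim P M = homDim P A + homDim P M') := by
  let p : M.carrier →ₗ[H] (of K H (M.carrier ⧸ LinearMap.range f)).carrier :=
    (ofEquiv K H _).symm.toLinearMap ∘ₗ (LinearMap.range f).mkQ
  have hp : Function.Surjective p :=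
    (ofEquiv K H _).symm.surjective.comp (LinearMap.range f).mkQ_surjective
  have hker : LinearMap.ker p = LinearMap.range f := by
    rw [LinearMap.ker_comp, LinearEquiv.ker, Submodule.comap_bot, Submodule.ker_mkQ]
  have h₁ := LinearMap.finrank_range_add_finrank_ker (p.restrictScalars K)
  have h₂ := LinearMap.finrank_range_add_finrank_ker (f.restrictScalars K)
  have hker' : LinearMap.ker (p.restrictScalars K) = LinearMap.range (f.restrictScalars K) := by
    ext x
    exact SetLike.ext_iff.1 hker x
  have hrange : LinearMap.range (p.restrictScalars K) = ⊤ := LinearMap.range_eq_top.2 hp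
  rw [hrange, finrank_top, hker'] at h₁
  refine ⟨_, p, hp, fun x => ?_, ?_, fun h P hP => ?_⟩
  · exact LinearMap.mem_ker.1 (hker.ge (LinearMap.mem_range_self f x))
  · unfold dim; omega
  · refine hP.homDim_eq f ?_ p hp hker.symm
    -- Equality of dimensions forces f to be injective, so that A → M → M' is short exact.
    have h0 : Module.finrank K (LinearMap.ker (f.restrictScalars K)) = 0 := by
      unfold dim at h; omega
    have hbot : LinearMap.ker (f.restrictScalars K) = ⊥ := Submodule.finrank_eq_zero.1 h0
    have hinj : Function.Injective (f.restrictScalars K) := LinearMap.ker_eq_bot.1 hbot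
    exact hinj

theorem bijective_of_injective {M N : FDMod K H} {f : M.carrier →ₗ[H] N.carrier}
    (hf : Function.Injective f) (h : M.dim = N.dim) : Function.Bijective f :=
  ⟨hf, (LinearMap.injective_iff_surjective_of_finrank_eq_finrank (f := f.restrictScalars K) h).1 hf⟩

/-- Two submodules of complementary dimensions, the bigger one simple, span a direct sum. -/
theorem exists_equiv_sum_of_dim {A B M : FDMod K H} [IsSimpleModule H A.carrier]
    {f : A.carrier →ₗ[H] M.carrier} (hf : Function.Injective f) {g : B.carrier →ₗ[H] M.carrier}
    (hg : Function.Injective g) (hlt : B.dim < A.dim) (h : A.dim + B.dim = M.dim) :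
    Nonempty (M.carrier ≃ₗ[H] (sum A B).carrier) := by
  -- As A is simple, the images of A and B meet trivially unless that of A lies in that of B, which
  -- the dimensions forbid.
  have hbot : (LinearMap.range g).comap f = ⊥ := by
    refine (eq_bot_or_eq_top _).resolve_right fun htop => ?_
    have hle : LinearMap.range (f.restrictScalars K) ≤ LinearMap.range (g.restrictScalars K) := by
      rintro _ ⟨x, rfl⟩
      exact (htop ▸ Submodule.mem_top : x ∈ (LinearMap.range g).comap f)
    have := Submodule.finrank_mono hle
    rw [LinearMap.finrank_range_of_inj (f := f.restrictScalars K) hf,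
      LinearMap.finrank_range_of_inj (f := g.restrictScalars K) hg] at this
    exact absurd this (not_le.2 hlt)
  have hinj : Function.Injective (f ∘ₗ fst A B + g ∘ₗ snd A B) := by
    refine (injective_iff_map_eq_zero _).2 ?_
    rintro ⟨x, y⟩ hxy
    change f x + g y = 0 at hxy
    have hx : x ∈ (LinearMap.range g).comap f :=
      ⟨-y, by rw [map_neg]; exact (eq_neg_of_add_eq_zero_left hxy).symm⟩
    rw [hbot, Submodule.mem_bot] at hx
    subst hx
    rw [map_zero, zero_add] at hxy
    rw [(injective_iff_map_eq_zero g).1 hg y hxy]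
    rfl
  exact ⟨(LinearEquiv.ofBijective _ (bijective_of_injective hinj ((dim_sum A B).trans h))).symm⟩

end Green.FDMod

namespace Taft

open Green FDMod

variable {K : Type u} [Field K] {n : ℕ} {q : K}

/-! ### The module `V(n, r)` is projective -/

section average

variable {M N : FDMod K (Hn n 1 q)}

/-- `n` times the projection to the `q ^ t`-eigenspace of a generator. -/
def average (M : FDMod K (Hn n 1 q)) (g : Gen) (t : ℤ) : Module.End K M.carrier :=
  ∑ k ∈ Finset.range n, (q ^ (-t) • op M g) ^ k

theorem map_average (f : M.carrier →ₗ[Hn n 1 q] N.carrier) (g : Gen) (t : ℤ) (x : M.carrier) :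
    f (average M g t x) = average N g t (f x) := by
  rw [average, average, LinearMap.sum_apply, LinearMap.sum_apply, map_sum]
  refine Finset.sum_congr rfl fun k _ => ?_
  rw [smul_pow, smul_pow, LinearMap.smul_apply, LinearMap.smul_apply, ← map_op_pow]
  exact (f.restrictScalars K).map_smul _ _

theorem average_mem {W : Submodule K M.carrier} {g : Gen} (hW : ∀ x ∈ W, op M g x ∈ W) (t : ℤ)
    {x : M.carrier} (hx : x ∈ W) : average M g t x ∈ W := by
  rw [average, LinearMap.sum_apply]
  refine W.sum_mem fun k _ => ?_
  clear * - hW hx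
  induction k with
  | zero => exact hx
  | succ k ih =>
    rw [pow_succ', Module.End.mul_apply]
    exact W.smul_mem _ (hW _ ih)

variable [hq : Fact (IsPrimitiveRoot q n)]

/-- None of the k successive coefficients of d vanishes. With k = l - 1 this reaches the lowest
vector from the top one. -/
theorem exists_op_d_pow {l : ℕ} (hl : l ≤ n) (r : ℤ) (k : ℕ) (hk : k < l) :
    ∃ t : K, t ≠ 0 ∧ (op (V (q := q) l hl r) .d ^ k) (vv l hl r k) = t • vv l hl r 0 := by
  induction k with
  | zero => exact ⟨1, one_ne_zero, (one_smul _ _).symm⟩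
  | succ k ih =>
    obtain ⟨t, ht, h⟩ := ih (by omega)
    refine ⟨_, mul_ne_zero (qInt_mul_ne_zero hq.out k.succ_pos hk hl) ht, ?_⟩
    rw [pow_succ, Module.End.mul_apply, op_V_d hl hk.le, map_smul, Nat.add_sub_cancel, h, smul_smul]

variable [NeZero n]

/-- The sum 1 + T + ... + T^(n-1) is fixed by T when T^n = 1; here T is the generator divided by
q^t. -/
theorem op_average {g : Gen} (hg : op M g ^ n = 1) (t : ℤ) (x : M.carrier) :
    op M g (average M g t x) = q ^ t • average M g t x := by
  have h : (q ^ (-t) • op M g) ^ n = 1 := by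
    rw [smul_pow, hg, ← zpow_natCast, ← zpow_mul, mul_comm, zpow_mul, zpow_natCast,
      (hq.out).pow_eq_one, one_zpow, one_smul]
  have h₁ := mul_geom_sum (q ^ (-t) • op M g) n
  rw [h, sub_self, sub_mul, one_mul, sub_eq_zero] at h₁
  have h₂ : q ^ (-t) • op M g (average M g t x) = average M g t x := DFunLike.congr_fun h₁ x
  conv_rhs => rw [← h₂]
  rw [smul_smul, ← zpow_add₀ (q_ne_zero n q), add_neg_cancel, zpow_zero, one_smul]

theorem average_eigenvector {g : Gen} {t : ℤ} {x : M.carrier} (hx : op M g x = q ^ t • x) :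
    average M g t x = (n : K) • x := by
  have h : ∀ k : ℕ, ((q ^ (-t) • op M g) ^ k) x = x := fun k => by
    induction k with
    | zero => rfl
    | succ k ih =>
      rw [pow_succ, Module.End.mul_apply, LinearMap.smul_apply, hx, smul_smul,
        ← zpow_add₀ (q_ne_zero n q), neg_add_cancel, zpow_zero, one_smul, ih]
  rw [average, LinearMap.sum_apply, Finset.sum_congr rfl fun k _ => h k, Finset.sum_const,
    Finset.card_range, Nat.cast_smul_eq_nsmul]

end average

variable [NeZero n] [hq : Fact (IsPrimitiveRoot q n)]

/-- It suffices to lift the image f(v) of the lowest vector to a lowest vector of type (n,r); the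
remaining condition is a^n = 0, which always holds. If x lifts the image of the top vector, then
d^(n-1) x lifts a nonzero multiple of f(v) and is killed by d since d^n = 0. Averaging over b and c
corrects its weights and multiplies the image by n^2. -/
theorem isFDProjective_V (r : ℤ) : IsFDProjective (V (q := q) n le_rfl r) := by
  intro N N' g f hg
  have hn := NeZero.pos n
  obtain ⟨t, ht, htv⟩ := exists_op_d_pow (q := q) (n := n) le_rfl r (n - 1) (by omega)
  -- A primitive n-th root of unity exists only if the characteristic does not divide n.
  have hnK : (n : K) ≠ 0 := (hq.out).neZero'.out
  set v := vv (q := q) n le_rfl r 0 with hv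
  have hlow : IsLowest N' n r (f v) := (isLowest_vv le_rfl).map f
  obtain ⟨x, hx⟩ := hg (f (vv n le_rfl r (n - 1)))
  set y := (op N .d ^ (n - 1)) x
  have hy : op N .d y = 0 := by
    rw [← Module.End.mul_apply, ← pow_succ', Nat.sub_add_cancel hn, (op_relations N).dn]; rfl
  have hgy : g y = t • f v := by
    rw [map_op_pow, hx, ← map_op_pow, htv]
    exact (f.restrictScalars K).map_smul _ _
  set z := average N .c (1 - r - n) (average N .b r y) with hz
  have hby : average N .b r y ∈ LinearMap.ker (op N .d) := average_mem (fun x hx => by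
    rw [LinearMap.mem_ker, op_d_b, LinearMap.mem_ker.1 hx, map_zero, smul_zero]) r hy
  have hlowz : IsLowest N n r z := by
    refine ⟨?_, op_average (op_relations N).cn _ _, ?_⟩
    · refine Module.End.mem_eigenspace_iff.1 (average_mem (fun x hx => ?_) _
        (Module.End.mem_eigenspace_iff.2 (op_average (op_relations N).bn r y)))
      rw [Module.End.mem_eigenspace_iff] at hx ⊢
      rw [op_b_c, hx, map_smul]
    · exact average_mem (W := LinearMap.ker (op N .d)) (fun x hx => by
        rw [LinearMap.mem_ker, op_d_c, LinearMap.mem_ker.1 hx, map_zero, smul_zero]) _ hby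
  have hgz : g z = ((n : K) * ((n : K) * t)) • f v := by
    rw [hz, map_average, map_average, hgy, map_smul, average_eigenvector hlow.b, map_smul, map_smul,
      average_eigenvector hlow.c, smul_smul, smul_smul]
    congr 1; ring
  have hs : (n : K) * ((n : K) * t) ≠ 0 := mul_ne_zero hnK (mul_ne_zero hnK ht)
  refine ⟨((n : K) * ((n : K) * t))⁻¹ • homOfLowest le_rfl hlowz
    (by rw [(op_relations N).an]; rfl), hom_ext_vv le_rfl ?_⟩
  rw [LinearMap.comp_apply, LinearMap.smul_apply, homOfLowest_vv_zero le_rfl hn]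
  refine ((g.restrictScalars K).map_smul _ _).trans ?_
  change _ • g z = _
  rw [hgz, smul_smul, inv_mul_cancel₀ hs, one_smul]

/-! ### Tensor products -/

section tensor

variable (M N : FDMod K (Hn n 1 q)) (x : M.carrier) (y : N.carrier)

theorem op_tensor_a : op (tensor M N) .a (tm M N x y) =
    tm M N (op M .a x) (op N .b y) + tm M N x (op N .a y) := by
  have : op (tensor M N) .a = act₂ M.ρ N.ρ (Hn.lift ((Hn.relations n 1 q).comul hq.out)
    (Hn.gen n 1 q .a)) := rfl
  rw [this, Hn.lift_gen, Hn.vals, map_add]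
  refine congrArg₂ (· + ·) (act₂_tmul M.ρ N.ρ _ _ x y) ((act₂_tmul M.ρ N.ρ _ _ x y).trans ?_)
  rw [map_one]; rfl

theorem op_tensor_b : op (tensor M N) .b (tm M N x y) = tm M N (op M .b x) (op N .b y) := by
  have : op (tensor M N) .b = act₂ M.ρ N.ρ (Hn.lift ((Hn.relations n 1 q).comul hq.out)
    (Hn.gen n 1 q .b)) := rfl
  rw [this, Hn.lift_gen, Hn.vals]
  exact act₂_tmul M.ρ N.ρ _ _ x y

theorem op_tensor_c : op (tensor M N) .c (tm M N x y) = tm M N (op M .c x) (op N .c y) := by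
  have : op (tensor M N) .c = act₂ M.ρ N.ρ (Hn.lift ((Hn.relations n 1 q).comul hq.out)
    (Hn.gen n 1 q .c)) := rfl
  rw [this, Hn.lift_gen, Hn.vals]
  exact act₂_tmul M.ρ N.ρ _ _ x y

theorem op_tensor_d : op (tensor M N) .d (tm M N x y) =
    tm M N (op M .d x) (op N .c y) + tm M N x (op N .d y) := by
  have : op (tensor M N) .d = act₂ M.ρ N.ρ (Hn.lift ((Hn.relations n 1 q).comul hq.out)
    (Hn.gen n 1 q .d)) := rfl
  rw [this, Hn.lift_gen, Hn.vals, map_add]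
  refine congrArg₂ (· + ·) (act₂_tmul M.ρ N.ρ _ _ x y) ((act₂_tmul M.ρ N.ρ _ _ x y).trans ?_)
  rw [map_one]; rfl

/-- The value of the counit on a generator. -/
def counitVal (K : Type u) [Field K] : Gen → K := Hn.vals 0 1 1 0

theorem op_unit (g : Gen) (k : K) : op (unit K (Hn n 1 q)) g k = counitVal K g * k := by
  have : Coalgebra.counit (R := K) (Hn.gen n 1 q g) = counitVal K g := by
    rw [Hn.counit_eq, Hn.lift_gen]; rfl
  rw [← this]; rfl

variable {l l' : ℕ} (hl : l ≤ n) (hl' : l' ≤ n) {r r' : ℤ}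

theorem ext_tm_vv {X : Type*} [AddCommGroup X] [Module K X]
    {f g : (tensor (V (q := q) l hl r) (V (q := q) l' hl' r')).carrier →ₗ[K] X}
    (h : ∀ i j, i < l → j < l' → f (tm _ _ (vv l hl r i) (vv l' hl' r' j)) =
      g (tm _ _ (vv l hl r i) (vv l' hl' r' j))) : f = g := by
  refine TensorProduct.ext (ext_vv hl fun i hi => ext_vv hl' fun j hj => h i j hi hj)

/-- The coordinates of the tensor product of two simple modules. -/
def coord (i : Fin l) (j : Fin l') :
    (tensor (V (q := q) l hl r) (V (q := q) l' hl' r')).carrier →ₗ[K] K :=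
  TensorProduct.lift ((LinearMap.mul K K).compl₁₂ (LinearMap.proj i : (Fin l → K) →ₗ[K] K)
    (LinearMap.proj j : (Fin l' → K) →ₗ[K] K))

theorem coord_tm_vv (i : Fin l) (j : Fin l') (k k' : ℕ) :
    coord (q := q) hl hl' (r := r) (r' := r') i j (tm _ _ (vv l hl r k) (vv l' hl' r' k')) =
      if (i : ℕ) = k ∧ (j : ℕ) = k' then 1 else 0 := by
  have hvec : ∀ {m : ℕ} (i : Fin m) (k : ℕ), vec K m k i = if (i : ℕ) = k then 1 else 0 := by
    intro m i k
    by_cases h : k < m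
    · rw [vec, dif_pos h, Pi.single_apply]
      simp [Fin.ext_iff]
    · rw [vec, dif_neg h, if_neg (by omega)]; rfl
  change vec K l k i * vec K l' k' j = _
  rw [hvec, hvec, ite_and]
  split_ifs <;> simp

end tensor

/-! ### Duals -/

/-- A duality over `H_n(1, q)` may be checked on the generators. -/
def dualityOfGen {M M' : FDMod K (Hn n 1 q)} (ev : (tensor M M').carrier →ₗ[K] K)
    {κ : Type} [Fintype κ] (e : κ → M.carrier) (e' : κ → M'.carrier)
    (hev : ∀ g z, ev (op _ g z) = counitVal K g * ev z)
    (hcoev : ∀ g, op (tensor M' M) g (∑ i, tm M' M (e' i) (e i)) =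
      counitVal K g • ∑ i, tm M' M (e' i) (e i))
    (left : ∀ v, ∑ i, ev (tm M M' v (e' i)) • e i = v)
    (right : ∀ v, ∑ i, ev (tm M M' (e i) v) • e' i = v) : Duality M M' where
  ev := ev
  κ := κ
  e := e
  e' := e'
  ev_smul h z := (homOfGen (N := unit K (Hn n 1 q)) ev fun g m =>
    (hev g m).trans (op_unit g _).symm).map_smul h z
  smul_coev h := by
    have := (homOfGen (M := unit K (Hn n 1 q)) (N := tensor M' M)
      (LinearMap.toSpanSingleton K _ (∑ i, tm M' M (e' i) (e i)))
      (fun g (k : K) => by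
        rw [op_unit]
        change (counitVal K g * k) • _ = op (tensor M' M) g (k • _)
        rw [map_smul, hcoev, smul_smul, mul_comm])).map_smul h (1 : K)
    change (Coalgebra.counit (R := K) h * (1 : K)) • (∑ i, tm M' M (e' i) (e i)) =
      h • ((1 : K) • ∑ i, tm M' M (e' i) (e i)) at this
    rw [one_smul, mul_one] at this
    exact this.symm
  left := left
  right := right

/-- A duality between two of the modules `V(l, r)` may be checked on the basis vectors. -/
def dualityOfBasis {l l' : ℕ} {hl : l ≤ n} {hl' : l' ≤ n} {r r' : ℤ}
    (ev : (tensor (V (q := q) l hl r) (V (q := q) l' hl' r')).carrier →ₗ[K] K)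
    {κ : Type} [Fintype κ] (e : κ → (V (q := q) l hl r).carrier)
    (e' : κ → (V (q := q) l' hl' r').carrier)
    (hev : ∀ g i j, i < l → j < l' → ev (op _ g (tm _ _ (vv l hl r i) (vv l' hl' r' j))) =
      counitVal K g * ev (tm _ _ (vv l hl r i) (vv l' hl' r' j)))
    (hcoev : ∀ g, op (tensor (V (q := q) l' hl' r') (V (q := q) l hl r)) g
      (∑ i, tm _ _ (e' i) (e i)) = counitVal K g • ∑ i, tm _ _ (e' i) (e i))
    (left : ∀ k < l, ∑ i, ev (tm _ _ (vv l hl r k) (e' i)) • e i = vv l hl r k)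
    (right : ∀ k < l', ∑ i, ev (tm _ _ (e i) (vv l' hl' r' k)) • e' i = vv l' hl' r' k) :
    Duality (V (q := q) l hl r) (V (q := q) l' hl' r') :=
  dualityOfGen ev e e'
    (fun g => LinearMap.congr_fun (f := ev ∘ₗ op _ g) (g := counitVal K g • ev)
      (ext_tm_vv hl hl' (hev g))) hcoev
    (fun v => by
      have := LinearMap.congr_fun (g := LinearMap.id)
        (f := ∑ i, (ev ∘ₗ (tm _ _).flip (e' i)).smulRight (e i)) (ext_vv hl fun k hk => by
          rw [LinearMap.sum_apply]
          exact left k hk) v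
      rw [LinearMap.sum_apply] at this
      exact this)
    (fun v => by
      have := LinearMap.congr_fun (g := LinearMap.id)
        (f := ∑ i, (ev ∘ₗ tm _ _ (e i)).smulRight (e' i)) (ext_vv hl' fun k hk => by
          rw [LinearMap.sum_apply]
          exact right k hk) v
      rw [LinearMap.sum_apply] at this
      exact this)

/-- The dual of `V(2, 0)` is `V(2, -1)`. -/
def dualityTwo (h2 : 2 ≤ n) : Duality (V (q := q) 2 h2 0) (V (q := q) 2 h2 (-1)) :=
  have hq0 : q ≠ 0 := q_ne_zero n q
  have hz : ∀ r, vv (q := q) 2 h2 r 2 = 0 := fun r => vv_eq_zero h2 le_rfl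
  have h1 : qInt q 1 = 1 := by simp [qInt]
  have h0 : qInt q 0 = 0 := by simp [qInt]
  -- The pairing takes v_1 ⊗ v_0 to 1 and v_0 ⊗ v_1 to -q⁻¹. The second value is forced by
  -- invariance under a: a(v_0 ⊗ v_0) = q⁻¹ v_1 ⊗ v_0 + v_0 ⊗ v_1 must pair to 0. The families on
  -- the next line are dual bases for this pairing.
  dualityOfBasis (coord h2 h2 1 0 - q⁻¹ • coord h2 h2 0 1) (κ := Fin 2)
    ![vv 2 h2 0 1, vv 2 h2 0 0] ![vv 2 h2 (-1) 0, -q • vv 2 h2 (-1) 1]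
    (by
      intro g i j hi hj
      have hi : i = 0 ∨ i = 1 := by omega
      have hj : j = 0 ∨ j = 1 := by omega
      cases g
      · rw [op_tensor_a, op_V_a, op_V_a, op_V_b]
        rcases hi with rfl | rfl <;> rcases hj with rfl | rfl <;>
          simp [counitVal, Hn.vals, coord_tm_vv, hz]
      · rw [op_tensor_b, op_V_b, op_V_b]
        rcases hi with rfl | rfl <;> rcases hj with rfl | rfl <;>
          simp [counitVal, Hn.vals, coord_tm_vv, hq0]
      · rw [op_tensor_c, op_V_c, op_V_c]
        rcases hi with rfl | rfl <;> rcases hj with rfl | rfl <;>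
          simp [counitVal, Hn.vals, coord_tm_vv, hq0]
      · rw [op_tensor_d, op_V_d h2 (by omega), op_V_d h2 (by omega), op_V_c]
        rcases hi with rfl | rfl <;> rcases hj with rfl | rfl <;>
          simp [counitVal, Hn.vals, coord_tm_vv, h1, h0, hq0])
    (by
      intro g
      rw [Fin.sum_univ_two]
      simp only [Matrix.cons_val_zero, Matrix.cons_val_one]
      rw [LinearMap.map_smul₂]
      cases g
      · rw [map_add, map_smul, op_tensor_a, op_tensor_a, op_V_a, op_V_a, op_V_a, op_V_a, hz, hz,
          op_V_b]
        simp [counitVal, Hn.vals]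
      · rw [map_add, map_smul, op_tensor_b, op_tensor_b, op_V_b, op_V_b, op_V_b, op_V_b]
        simp [counitVal, Hn.vals, hq0, smul_smul]
      · rw [map_add, map_smul, op_tensor_c, op_tensor_c, op_V_c, op_V_c, op_V_c, op_V_c]
        simp [counitVal, Hn.vals, hq0, smul_smul]
      · rw [map_add, map_smul, op_tensor_d, op_tensor_d, op_V_d h2 (by omega),
          op_V_d h2 (by omega), op_V_d h2 (by omega), op_V_d h2 (by omega), op_V_c, op_V_c]
        simp [counitVal, Hn.vals, h1, h0, smul_smul]
        rw [add_neg_eq_zero]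
        congr 1
        field_simp)
    (by
      intro k hk
      have hk : k = 0 ∨ k = 1 := by omega
      rcases hk with rfl | rfl <;> simp [coord_tm_vv, hq0])
    (by
      intro k hk
      have hk : k = 0 ∨ k = 1 := by omega
      rcases hk with rfl | rfl <;> simp [coord_tm_vv, hq0])

end Taft
end

noncomputable section

namespace Taft

open Green FDMod

/-! ### Tensor products of simple modules -/

variable {K : Type u} [Field K] {n : ℕ} {q : K} [hq : Fact (IsPrimitiveRoot q n)]

/-- The case l = 0 is included because V(0,r) occurs as the second summand of V(2,t) ⊗ V(1,r). -/
theorem injective_of_vv {M : FDMod K (Hn n 1 q)} {l : ℕ} {hl : l ≤ n} {r : ℤ}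
    {f : (V (q := q) l hl r).carrier →ₗ[Hn n 1 q] M.carrier}
    (hf : 0 < l → f (vv l hl r 0) ≠ 0) : Function.Injective f := by
  rcases Nat.eq_zero_or_pos l with h0 | h0
  · have := dim_eq_zero_iff.1 ((dim_V (q := q) hl (r := r)).trans h0)
    exact Function.injective_of_subsingleton _
  · have := isSimple_V (q := q) hl (r := r) h0
    refine (LinearMap.injective_or_eq_zero f).resolve_right fun h => hf h0 ?_
    rw [h, LinearMap.zero_apply]

variable [NeZero n]

theorem equiv_unit (h1 : 1 ≤ n) :
    Nonempty ((V (q := q) 1 h1 0).carrier ≃ₗ[Hn n 1 q] (unit K (Hn n 1 q)).carrier) := by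
  let e : (unit K (Hn n 1 q)).carrier := (1 : K)
  have hop : ∀ g, op (unit K (Hn n 1 q)) g e = counitVal K g • e := fun g => op_unit g 1
  have hlow : IsLowest (unit K (Hn n 1 q)) 1 0 e := by
    refine ⟨?_, ?_, ?_⟩
    · rw [hop]; simp [counitVal, Hn.vals]
    · rw [hop]; simp [counitVal, Hn.vals]
    · rw [hop]; simp [counitVal, Hn.vals]
  have ha : (op (unit K (Hn n 1 q)) .a ^ 1) e = 0 := by
    rw [pow_one, hop]; simp [counitVal, Hn.vals]
  refine ⟨LinearEquiv.ofBijective (homOfLowest h1 hlow ha)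
    (bijective_of_injective (injective_of_vv fun h0 => ?_) ?_)⟩
  · rw [homOfLowest_vv_zero h1 h0]
    exact one_ne_zero (α := K)
  · rw [dim_V]
    exact (Module.finrank_self K).symm

variable {l : ℕ} (hl : l ≤ n) {r t : ℤ}

/-- The vector v_0 ⊗ v_0 is a lowest vector of type (l, t+r), and the dimensions agree. -/
theorem equiv_V_one_tensor (h1 : 1 ≤ n) :
    Nonempty ((V (q := q) l hl (t + r)).carrier ≃ₗ[Hn n 1 q]
      (tensor (V (q := q) 1 h1 t) (V (q := q) l hl r)).carrier) := by
  have hq0 := q_ne_zero n q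
  have hz : vv (q := q) 1 h1 t 1 = 0 := vv_eq_zero h1 le_rfl
  set X := tensor (V (q := q) 1 h1 t) (V (q := q) l hl r)
  have ha : ∀ m k, (op X .a ^ m) (tm _ _ (vv 1 h1 t 0) (vv l hl r k)) =
      tm _ _ (vv 1 h1 t 0) (vv l hl r (k + m)) := by
    intro m k
    induction m with
    | zero => rfl
    | succ m ih =>
      rw [pow_succ', Module.End.mul_apply, ih, op_tensor_a, op_V_a, op_V_a, hz, map_zero,
        LinearMap.zero_apply, zero_add, add_assoc]
  have hlow : IsLowest X l (t + r) (tm _ _ (vv 1 h1 t 0) (vv l hl r 0)) := by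
    have h₁ := isLowest_vv (q := q) h1 (r := t)
    have h₂ := isLowest_vv (q := q) hl (r := r)
    refine ⟨?_, ?_, ?_⟩
    · rw [op_tensor_b, h₁.b, h₂.b, map_smul, LinearMap.map_smul₂, smul_smul, ← zpow_add₀ hq0,
        add_comm]
    · rw [op_tensor_c, h₁.c, h₂.c, map_smul, LinearMap.map_smul₂, smul_smul, ← zpow_add₀ hq0]
      congr 2; push_cast; ring
    · rw [op_tensor_d, h₁.d, h₂.d, map_zero, map_zero, LinearMap.zero_apply, zero_add]
  refine ⟨LinearEquiv.ofBijective (homOfLowest hl hlow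
    (by rw [ha, vv_eq_zero hl (by omega), map_zero]))
    (bijective_of_injective (injective_of_vv fun h0 => ?_) ?_)⟩
  · rw [homOfLowest_vv_zero hl h0]
    intro h
    have := congrArg (coord h1 hl ⟨0, by omega⟩ ⟨0, h0⟩) h
    rw [coord_tm_vv, map_zero] at this
    simp at this
  · rw [dim_tensor, dim_V, dim_V, dim_V, one_mul]

/-! ### The tensor products V(2,t) ⊗ V(l,r) -/

section two

variable (h2 : 2 ≤ n) (k m : ℕ)

variable (t r) in
/-- The tensor product `V(2, t) ⊗ V(l, r)`. -/
abbrev twoTensor : FDMod K (Hn n 1 q) := tensor (V (q := q) 2 h2 t) (V (q := q) l hl r)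

variable (t r) in
/-- The basis vectors of `V(2, t) ⊗ V(l, r)`. -/
def ww (i k : ℕ) : (twoTensor (q := q) hl r t h2).carrier := tm _ _ (vv 2 h2 t i) (vv l hl r k)

theorem ww_eq_zero (i : ℕ) {k : ℕ} (hk : l ≤ k) : ww (q := q) hl r t h2 i k = 0 := by
  rw [ww, vv_eq_zero hl hk, map_zero]

theorem op_a_ww_zero : op (twoTensor (q := q) hl r t h2) .a (ww hl r t h2 0 k) =
    q ^ (r + k) • ww hl r t h2 1 k + ww hl r t h2 0 (k + 1) := by
  rw [ww, op_tensor_a, op_V_a, op_V_a, op_V_b, map_smul]; rfl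

theorem op_a_ww_one : op (twoTensor (q := q) hl r t h2) .a (ww hl r t h2 1 k) =
    ww hl r t h2 1 (k + 1) := by
  rw [ww, op_tensor_a, op_V_a, op_V_a, vv_eq_zero h2 le_rfl, map_zero, LinearMap.zero_apply,
    zero_add]; rfl

theorem op_a_pow_ww_one : (op (twoTensor (q := q) hl r t h2) .a ^ m) (ww hl r t h2 1 k) =
    ww hl r t h2 1 (k + m) := by
  induction m with
  | zero => rfl
  | succ m ih => rw [pow_succ', Module.End.mul_apply, ih, op_a_ww_one, add_assoc]

/-- The first factor can be raised in any one of the m applications of a, which contributes q^(r+k),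
..., q^(r+k+m-1). The truncated index k + m - 1 at k = m = 0 is harmless because its coefficient is
then 0. -/
theorem op_a_pow_ww_zero : (op (twoTensor (q := q) hl r t h2) .a ^ m) (ww hl r t h2 0 k) =
    ww hl r t h2 0 (k + m) + (q ^ (r + k) * qInt q m) • ww hl r t h2 1 (k + m - 1) := by
  induction m with
  | zero => simp [qInt]
  | succ m ih =>
    rw [pow_succ', Module.End.mul_apply, ih, map_add, map_smul, op_a_ww_zero, op_a_ww_one]
    have e : (q ^ (r + k) * qInt q m) • ww (q := q) hl r t h2 1 (k + m - 1 + 1) =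
        (q ^ (r + k) * qInt q m) • ww (q := q) hl r t h2 1 (k + m) := by
      rcases Nat.eq_zero_or_pos m with rfl | hm
      · simp [qInt]
      · rw [Nat.sub_add_cancel (by omega)]
    rw [e, qInt_add, mul_add, add_smul, show k + (m + 1) - 1 = k + m by omega, ← add_assoc k m 1]
    have e₂ : q ^ (r + k) * (q ^ m * qInt q 1) = q ^ (r + (k + m : ℕ) : ℤ) := by
      rw [show qInt q 1 = 1 by simp [qInt], mul_one, ← zpow_natCast q m,
        ← zpow_add₀ (q_ne_zero n q)]
      congr 1; push_cast; ring
    rw [e₂]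
    abel

theorem op_b_ww (i : ℕ) : op (twoTensor (q := q) hl r t h2) .b (ww hl r t h2 i k) =
    q ^ (t + r + i + k) • ww hl r t h2 i k := by
  rw [ww, op_tensor_b, op_V_b, op_V_b, map_smul, LinearMap.map_smul₂, smul_smul,
    ← zpow_add₀ (q_ne_zero n q)]
  congr 2; ring

theorem op_c_ww (i : ℕ) : op (twoTensor (q := q) hl r t h2) .c (ww hl r t h2 i k) =
    q ^ (i + k - t - r - l : ℤ) • ww hl r t h2 i k := by
  rw [ww, op_tensor_c, op_V_c, op_V_c, map_smul, LinearMap.map_smul₂, smul_smul,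
    ← zpow_add₀ (q_ne_zero n q)]
  congr 2; push_cast; ring

theorem op_d_ww_zero (hk : k ≤ l) : op (twoTensor (q := q) hl r t h2) .d (ww hl r t h2 0 k) =
    (qInt q k * (1 - q ^ (k - l : ℤ))) • ww hl r t h2 0 (k - 1) := by
  rw [ww, op_tensor_d, (isLowest_vv h2).d, op_V_d hl hk, map_zero, LinearMap.zero_apply, zero_add,
    map_smul]; rfl

theorem op_d_ww_one_zero : op (twoTensor (q := q) hl r t h2) .d (ww hl r t h2 1 0) =
    ((1 - q⁻¹) * q ^ (1 - r - l : ℤ)) • ww hl r t h2 0 0 := by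
  rw [ww, op_tensor_d, (isLowest_vv hl).d, (isLowest_vv hl).c, op_V_d h2 (by omega), map_zero,
    add_zero, map_smul, LinearMap.map_smul₂, smul_smul, mul_comm]
  congr 2
  rw [show qInt q 1 = 1 by simp [qInt], one_mul, show ((1 : ℕ) : ℤ) - (2 : ℕ) = -1 by norm_num,
    zpow_neg_one]

theorem isLowest_ww_zero : IsLowest (twoTensor (q := q) hl r t h2) (l + 1) (t + r)
    (ww hl r t h2 0 0) where
  b := by rw [op_b_ww]; congr 2; simp
  c := by rw [op_c_ww]; congr 2; push_cast; ring
  d := by rw [op_d_ww_zero hl h2 0 (Nat.zero_le l)]; simp [qInt]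

theorem coord_ww (i k i' k' : ℕ) (hi : i < 2) (hk : k < l) :
    coord (q := q) h2 hl (r := t) (r' := r) ⟨i, hi⟩ ⟨k, hk⟩ (ww hl r t h2 i' k') =
      if i = i' ∧ k = k' then 1 else 0 :=
  coord_tm_vv h2 hl _ _ _ _

theorem dim_twoTensor : (twoTensor (q := q) hl r t h2).dim = 2 * l := by
  rw [dim_tensor, dim_V, dim_V]

/-- `V(2, t) ⊗ V(l, r) ≅ V(l + 1, t + r) ⊕ V(l - 1, t + r + 1)` for `0 < l < n`. -/
theorem equiv_twoTensor (h0 : 0 < l) (hln : l < n) :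
    Nonempty ((twoTensor (q := q) hl r t h2).carrier ≃ₗ[Hn n 1 q]
      (sum (V (q := q) (l + 1) hln (t + r))
        (V (q := q) (l - 1) (by omega) (t + r + 1))).carrier) := by
  have hq0 := q_ne_zero n q
  have hq1 : q ≠ 1 := (hq.out).ne_one (by omega)
  set X := twoTensor (q := q) hl r t h2 with hX
  have hlow := isLowest_ww_zero (q := q) hl (r := r) (t := t) h2
  -- The generator of the second summand: both d(v_0 ⊗ v_1) and d(v_1 ⊗ v_0) are multiples of v_0 ⊗
  -- v_0, and w is the combination in which they cancel.
  set w := (-((1 - q⁻¹) * q ^ (1 - r - l : ℤ))) • ww (q := q) hl r t h2 0 1 +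
    (1 - q ^ (1 - l : ℤ)) • ww (q := q) hl r t h2 1 0 with hw
  have hloww : IsLowest X (l - 1) (t + r + 1) w := by
    refine ⟨?_, ?_, ?_⟩
    · rw [hw, map_add, map_smul, map_smul, op_b_ww, op_b_ww, smul_add, smul_comm,
        smul_comm (1 - _)]
      simp
    · rw [hw, map_add, map_smul, map_smul, op_c_ww, op_c_ww, smul_add, smul_comm,
        smul_comm (1 - _)]
      rw [show (((0 : ℕ) : ℤ) + (1 : ℕ) - t - r - l) = 1 - (t + r + 1) - (l - 1 : ℕ) by
        push_cast [h0]; ring, show (((1 : ℕ) : ℤ) + (0 : ℕ) - t - r - l) =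
        1 - (t + r + 1) - (l - 1 : ℕ) by push_cast [h0]; ring]
    · rw [hw, map_add, map_smul, map_smul, op_d_ww_zero hl h2 1 h0, op_d_ww_one_zero, smul_smul,
        smul_smul, ← add_smul, show qInt q 1 = 1 by simp [qInt], Nat.cast_one]
      convert zero_smul K (ww (q := q) hl r t h2 0 0)
      ring
  -- Only v_1 ⊗ v_{l-1} survives; its coefficient vanishes by (l-1)_q (q - 1) = q^(l-1) - 1.
  have haw : (op X .a ^ (l - 1)) w = 0 := by
    rw [hw, map_add, map_smul, map_smul, op_a_pow_ww_zero, op_a_pow_ww_one,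
      ww_eq_zero hl h2 0 (show l ≤ 1 + (l - 1) by omega), zero_add, smul_smul,
      show 1 + (l - 1) - 1 = 0 + (l - 1) by omega, ← add_smul]
    convert zero_smul K (ww (q := q) hl r t h2 1 (0 + (l - 1)))
    have hg : qInt q (l - 1) * (q - 1) = q ^ (l - 1) - 1 := geom_sum_mul q (l - 1)
    have e₁ : (1 - q⁻¹) * q ^ (1 - r - l : ℤ) * q ^ (r + (1 : ℕ) : ℤ) =
        (q - 1) * q ^ (1 - l : ℤ) := by
      rw [mul_assoc, ← zpow_add₀ hq0, show (1 - r - l + (r + (1 : ℕ)) : ℤ) = 1 + (1 - l) by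
        push_cast; ring, zpow_one_add₀ hq0]
      field_simp
    have e₂ : q ^ (l - 1) * q ^ (1 - l : ℤ) = 1 := by
      rw [← zpow_natCast, ← zpow_add₀ hq0, Nat.cast_sub h0]
      simp
    linear_combination (-qInt q (l - 1)) * e₁ - q ^ (1 - l : ℤ) * hg - e₂
  have h1 := isSimple_V (q := q) (l := l + 1) hln (r := t + r) l.succ_pos
  refine exists_equiv_sum_of_dim (f := homOfLowest hln hlow ?_) (g := homOfLowest _ hloww haw)
    (injective_of_vv fun h => ?_) (injective_of_vv fun h => ?_) ?_ ?_
  · rw [op_a_pow_ww_zero, ww_eq_zero hl h2 _ (by omega), ww_eq_zero hl h2 _ (by omega), smul_zero,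
      add_zero]
  · rw [homOfLowest_vv_zero _ h]
    intro h'
    have := congrArg (coord h2 hl ⟨0, by omega⟩ ⟨0, h0⟩) h'
    rw [coord_ww, map_zero] at this
    simp at this
  · rw [homOfLowest_vv_zero _ h]
    intro h'
    -- For l = 1 the second summand is zero and there is nothing to check, so l ≥ 2 here and v_0 ⊗
    -- v_1 is a basis vector; its coefficient in w is nonzero as q ≠ 1.
    have := congrArg (coord h2 hl ⟨0, by omega⟩ ⟨1, by omega⟩) h'
    rw [hw, map_add, map_smul, map_smul, coord_ww, coord_ww, map_zero] at this
    simp only [and_self, if_true, zero_ne_one, false_and, if_false, smul_eq_mul, mul_one, mul_zero,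
      add_zero, neg_eq_zero, mul_eq_zero, sub_eq_zero, zpow_ne_zero _ hq0, or_false] at this
    exact hq1 (inv_eq_one.1 this.symm)
  · rw [dim_V, dim_V]; omega
  · rw [dim_V, dim_V, dim_twoTensor]; omega

/-- The composition factors of `V(2, -1) ⊗ V(n, r)`, as seen by projective modules. -/
theorem homDim_twoTensor {P : FDMod K (Hn n 1 q)} (hP : IsFDProjective P) (r : ℤ) :
    homDim P (twoTensor (q := q) (le_refl n) r (-1) h2) =
      2 * homDim P (V (q := q) (n - 1) (Nat.sub_le n 1) r) +
        2 * homDim P (V (q := q) 1 (one_le_two.trans h2) (r - 1)) := by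
  have h1 : 1 ≤ n := by omega
  have hn1 : n - 1 ≤ n := by omega
  set T := twoTensor (q := q) (le_refl n) r (-1) h2 with hT
  set w₀ := ww (q := q) (le_refl n) r (-1) h2 0 0
  set w₁ := ww (q := q) (le_refl n) r (-1) h2 1 0
  -- The type (n+1, r-1) of w₀ = v_0 ⊗ v_0 is also (1, r-1), as q^n = 1. Consequently a w₀ is a
  -- lowest vector of type (n-1, r). Successive quotients by the submodules generated by a w₀, w₀,
  -- a^(n-1) w₁ and w₁ are formed next.
  have hw₀ : IsLowest T 1 (r - 1) w₀ := by
    have := isLowest_ww_zero (q := q) (le_refl n) (r := r) (t := -1) h2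
    refine ⟨?_, ?_, this.d⟩
    · rw [this.b]; congr 2; ring
    · rw [this.c, (zpow_eq_zpow_iff (n := n) _ (1 - (r - 1) - (1 : ℕ) : ℤ)).2]
      exact ⟨-1, by push_cast; ring⟩
  have han : ∀ (M : FDMod K (Hn n 1 q)) (x : M.carrier), (op M .a ^ n) x = 0 := fun M x => by
    rw [(op_relations M).an]; rfl
  have h₁ : IsLowest T (n - 1) (r - 1 + 1) (op T .a w₀) := by
    simpa using hw₀.pow (n - 1) (by push_cast [h1]; ring)
  rw [sub_add_cancel] at h₁
  obtain ⟨T₁, p₁, hp₁, hk₁, hd₁, he₁⟩ := exists_cokernel (homOfLowest hn1 h₁ (by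
    rw [← Module.End.mul_apply, ← pow_succ, Nat.sub_add_cancel h1, han]))
  have hz₁ : op T₁ .a (p₁ w₀) = 0 := by
    have := hk₁ (vv _ _ _ 0)
    rwa [homOfLowest_vv_zero _ (by omega), map_op] at this
  obtain ⟨T₂, p₂, hp₂, hk₂, hd₂, he₂⟩ := exists_cokernel (homOfLowest h1 (hw₀.map p₁) (by
    rw [pow_one, hz₁]))
  have hz₂ : p₂ (p₁ w₀) = 0 := by
    have := hk₂ (vv _ _ _ 0)
    rwa [homOfLowest_vv_zero _ (by omega)] at this
  -- The vector w₁ = v_1 ⊗ v_0 becomes a lowest vector only after w₀ is killed, since d w₁ is a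
  -- multiple of w₀.
  have hw₁ : IsLowest T₂ (n - 1) r (p₂ (p₁ w₁)) := by
    refine ⟨?_, ?_, ?_⟩
    · rw [← map_op, ← map_op, op_b_ww]
      simp only [Nat.cast_one, Nat.cast_zero, add_zero]
      rw [show (-1 + r + 1 : ℤ) = r by ring]
      exact ((p₂ ∘ₗ p₁).restrictScalars K).map_smul _ _
    · rw [← map_op, ← map_op, op_c_ww,
        show (((1 : ℕ) : ℤ) + (0 : ℕ) - -1 - r - n) = 1 - r - (n - 1 : ℕ) by push_cast [h1]; ring]
      exact ((p₂ ∘ₗ p₁).restrictScalars K).map_smul _ _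
    · rw [← map_op, ← map_op, op_d_ww_one_zero]
      refine (((p₂ ∘ₗ p₁).restrictScalars K).map_smul _ _).trans ?_
      change _ • p₂ (p₁ w₀) = 0
      rw [hz₂, smul_zero]
  have h₃ : IsLowest T₂ 1 (r + (n - 1 : ℕ)) ((op T₂ .a ^ (n - 1)) (p₂ (p₁ w₁))) :=
    hw₁.pow 1 (by push_cast [h1]; ring)
  obtain ⟨T₃, p₃, hp₃, hk₃, hd₃, he₃⟩ := exists_cokernel (homOfLowest h1 h₃ (by
    rw [← Module.End.mul_apply, ← pow_add, Nat.add_sub_cancel' h1, han]))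
  have hz₃ : (op T₃ .a ^ (n - 1)) (p₃ (p₂ (p₁ w₁))) = 0 := by
    have := hk₃ (vv _ _ _ 0)
    rwa [homOfLowest_vv_zero _ (by omega), map_op_pow] at this
  obtain ⟨T₄, p₄, hp₄, hk₄, hd₄, he₄⟩ := exists_cokernel (homOfLowest hn1 (hw₁.map p₃) hz₃)
  have hz₄ : p₄ (p₃ (p₂ (p₁ w₁))) = 0 := by
    have := hk₄ (vv _ _ _ 0)
    rwa [homOfLowest_vv_zero _ (by omega)] at this
  let p := p₄ ∘ₗ p₃ ∘ₗ p₂ ∘ₗ p₁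
  have hp : Function.Surjective p := hp₄.comp (hp₃.comp (hp₂.comp hp₁))
  have hpw₁ : ∀ k, p (ww (le_refl n) r (-1) h2 1 k) = 0 := by
    intro k
    have := op_a_pow_ww_one (q := q) (le_refl n) (r := r) (t := -1) h2 0 k
    rw [zero_add] at this
    rw [← this, map_op_pow, show p (ww (le_refl n) r (-1) h2 1 0) = 0 from hz₄, map_zero]
  have hpw₀ : ∀ k, p (ww (le_refl n) r (-1) h2 0 k) = 0 := by
    intro k
    induction k with
    | zero => change p₄ (p₃ (p₂ (p₁ w₀))) = 0; rw [hz₂, map_zero, map_zero]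
    | succ k ih =>
      have := congrArg p (op_a_ww_zero (q := q) (le_refl n) (r := r) (t := -1) h2 k)
      rw [map_op, ih, map_zero, map_add] at this
      have h' : p (q ^ (r + k) • ww (le_refl n) r (-1) h2 1 k) = 0 :=
        ((p.restrictScalars K).map_smul _ _).trans ((congrArg _ (hpw₁ k)).trans (smul_zero _))
      rw [h', zero_add] at this
      exact this.symm
  have hp0 : p.restrictScalars K = 0 := ext_tm_vv h2 (le_refl n) fun i j hi hj => by
    have hi : i = 0 ∨ i = 1 := by omega
    rcases hi with rfl | rfl
    · exact hpw₀ j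
    · exact hpw₁ j
  -- The vectors w₀ and w₁ generate T, so nothing is left. As 2n = (n-1) + 1 + 1 + (n-1), all four
  -- dimension inequalities are equalities, and `exists_cokernel` turns each step into an exact
  -- sequence.
  have hd₅ : T₄.dim = 0 := dim_eq_zero_iff.2 ⟨fun x y => by
    obtain ⟨x, rfl⟩ := hp x
    obtain ⟨y, rfl⟩ := hp y
    exact (DFunLike.congr_fun hp0 x).trans (DFunLike.congr_fun hp0 y).symm⟩
  have hd : T.dim = 2 * n := dim_twoTensor _ _
  rw [dim_V] at hd₁ hd₂ hd₃ hd₄ he₁ he₂ he₃ he₄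
  obtain ⟨e⟩ := equiv_V_of_dvd (q := q) h1 (r := r + (n - 1 : ℕ)) (s := r - 1)
    ⟨1, by push_cast [h1]; ring⟩
  rw [he₁ (by omega) P hP, he₂ (by omega) P hP, he₃ (by omega) P hP, he₄ (by omega) P hP,
    homDim_eq_zero_of_dim hd₅, homDim_congr_right P e]
  ring

end two

end Taft
end

noncomputable section

namespace Green.FDMod

theorem IsFDProjective.sum {K : Type u} {H : Type v} [Field K] [Ring H] [Algebra K H]
    {P Q : FDMod K H} (hP : IsFDProjective P) (hQ : IsFDProjective Q) :
    IsFDProjective (sum P Q) := by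
  intro N N' g f hg
  obtain ⟨f₁, h₁⟩ := hP N N' g (f ∘ₗ inl P Q) hg
  obtain ⟨f₂, h₂⟩ := hQ N N' g (f ∘ₗ inr P Q) hg
  refine ⟨f₁ ∘ₗ fst P Q + f₂ ∘ₗ snd P Q, LinearMap.ext fun x => ?_⟩
  have e₁ : g (f₁ (fst P Q x)) = f (inl P Q (fst P Q x)) := DFunLike.congr_fun h₁ _
  have e₂ : g (f₂ (snd P Q x)) = f (inr P Q (snd P Q x)) := DFunLike.congr_fun h₂ _
  rw [LinearMap.comp_apply, LinearMap.add_apply, LinearMap.comp_apply, LinearMap.comp_apply,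
    map_add, e₁, e₂, ← map_add, inl_fst_add_inr_snd]

end Green.FDMod

namespace Taft

open Green FDMod

/-! ### Projective modules -/

variable {K : Type u} [Field K] {n : ℕ} {q : K} [NeZero n] [hq : Fact (IsPrimitiveRoot q n)]
  {P : FDMod K (Hn n 1 q)} {l : ℕ} {r : ℤ}

/-- Adjunction moves V(2,0) to V(2,-1) on the other side, where the product splits. No projectivity
of P is required. -/
theorem homDim_two_tensor (h2 : 2 ≤ n) (P : FDMod K (Hn n 1 q)) (h0 : 0 < l) (hl : l < n) :
    homDim (tensor (V (q := q) 2 h2 0) P) (V (q := q) l hl.le r) =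
      homDim P (V (q := q) (l + 1) hl (r - 1)) +
        homDim P (V (q := q) (l - 1) (by omega) r) := by
  obtain ⟨e⟩ := equiv_twoTensor (q := q) hl.le (r := r) (t := -1) h2 h0 hl
  rw [(dualityTwo h2).homDim_tensor, homDim_congr_right P e, homDim_sum_right,
    show -1 + r = r - 1 by ring, sub_add_cancel]

/-- At l = n only the composition factors of V(2,-1) ⊗ V(n,r) are used, so P has to be projective.
-/
theorem homDim_two_tensor_top (h2 : 2 ≤ n) (hP : IsFDProjective P) :
    homDim (tensor (V (q := q) 2 h2 0) P) (V (q := q) n le_rfl r) =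
      2 * homDim P (V (q := q) (n - 1) (Nat.sub_le n 1) r) +
        2 * homDim P (V (q := q) 1 (one_le_two.trans h2) (r - 1)) := by
  rw [(dualityTwo h2).homDim_tensor]
  exact homDim_twoTensor h2 hP r

/-- Every `V(l, r)` is a quotient of a projective module. -/
theorem exists_homDim_ne_zero (h2 : 2 ≤ n) (h0 : 0 < l) (hl : l ≤ n) (r : ℤ) :
    ∃ P : FDMod K (Hn n 1 q), IsFDProjective P ∧ homDim P (V (q := q) l hl r) ≠ 0 := by
  induction hj : n - l generalizing l r with
  | zero =>
    obtain rfl : l = n := by omega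
    refine ⟨_, isFDProjective_V r, ?_⟩
    rw [homDim_V _ _ h0 h0]
    simp
  | succ j ih =>
    -- Descending from l = n: if P maps onto V(l+1, r-1), then V(2,0) ⊗ P maps onto V(l,r).
    obtain ⟨P, hP, hPl⟩ := ih (l := l + 1) l.succ_pos (by omega) (r - 1) (by omega)
    refine ⟨_, (dualityTwo h2).isFDProjective_tensor hP, ?_⟩
    rw [homDim_two_tensor h2 P h0 (by omega)]
    omega

theorem exists_cover_V (h2 : 2 ≤ n) (h0 : 0 < l) (hl : l ≤ n) (r : ℤ) :
    ∃ (Q : FDMod K (Hn n 1 q)) (π : Q.carrier →ₗ[Hn n 1 q] (V (q := q) l hl r).carrier),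
      IsCover π := by
  obtain ⟨P, hP, h⟩ := exists_homDim_ne_zero (q := q) h2 h0 hl r
  rw [Ne, homDim_eq_zero_iff, not_forall] at h
  obtain ⟨f, hf⟩ := h
  have := isSimple_V (q := q) hl (r := r) h0
  exact exists_isCover hP hf

/-- `P` is a projective cover of `V(l, r)`. -/
structure CoverOf (P : FDMod K (Hn n 1 q)) (l : ℕ) (r : ℤ) : Prop where
  projective : IsFDProjective P
  homDim_eq : ∀ (l' : ℕ) (hl' : l' ≤ n) (r' : ℤ),
    homDim P (V (q := q) l' hl' r') = if 0 < l' ∧ l = l' ∧ (n : ℤ) ∣ r - r' then 1 else 0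

/-- Dimensions of Hom spaces are all that `CoverOf` retains of a cover. They determine its class, so
identities between classes of covers become arithmetic. -/
theorem coverOf_of_isCover (h0 : 0 < l) (hl : l ≤ n) {Q : FDMod K (Hn n 1 q)}
    {π : Q.carrier →ₗ[Hn n 1 q] (V (q := q) l hl r).carrier} (hπ : IsCover π) : CoverOf Q l r := by
  refine ⟨hπ.projective, fun l' hl' r' => ?_⟩
  rcases Nat.eq_zero_or_pos l' with h0' | h0'
  · rw [homDim_eq_zero_of_dim ((dim_V hl').trans h0'), if_neg (by omega)]
  · have := isSimple_V (q := q) hl (r := r) h0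
    have := isSimple_V (q := q) hl' (r := r') h0'
    rw [hπ.homDim_eq, homDim_V _ _ h0 h0']
    simp [h0']

theorem coverOf_V : CoverOf (V (q := q) n le_rfl r) n r := by
  refine ⟨isFDProjective_V r, fun l' hl' r' => ?_⟩
  rcases Nat.eq_zero_or_pos l' with h0' | h0'
  · rw [homDim_eq_zero_of_dim ((dim_V hl').trans h0'), if_neg (by omega)]
  · rw [homDim_V _ _ (NeZero.pos n) h0']
    simp [h0']

/-- The modules `V(l, r)` with `l < n` are not projective. -/
theorem not_isFDProjective_V (hn : 2 < n) (h0 : 0 < l) (hl : l < n) (r : ℤ) :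
    ¬ IsFDProjective (V (q := q) l hl.le r) := by
  induction l using Nat.strong_induction_on generalizing r with
  | _ l ih =>
  intro hP
  by_cases h1 : l = 1
  · subst h1
    -- If V(1,r) were projective, the composition factor V(1,r) of V(2,-1) ⊗ V(n,r+1) would give a
    -- two-dimensional space of maps V(2,0) ⊗ V(1,r) → V(n,r+1). But the source is V(2,r), and 2 <
    -- n.
    have h₁ := homDim_two_tensor_top (q := q) hn.le hP (r := r + 1)
    obtain ⟨e⟩ := equiv_twoTensor (q := q) hl.le (r := r) (t := 0) hn.le h0 hl
    rw [homDim_congr_left e, homDim_sum_left, homDim_V _ _ (by omega) (by omega),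
      homDim_V _ _ h0 (by omega), homDim_V _ _ h0 h0, if_neg (by omega), if_neg (by omega),
      if_pos (by simp)] at h₁
    have h₂ : homDim (V (q := q) (1 - 1) (by omega) (0 + r + 1)) (V (q := q) n le_rfl (r + 1)) = 0 := by
      have := dim_eq_zero_iff.1 (dim_V (q := q) (n := n) (l := 1 - 1) (by omega) (r := 0 + r + 1))
      refine homDim_eq_zero_iff.2 fun f => LinearMap.ext fun m => ?_
      rw [Subsingleton.elim m 0, map_zero, map_zero]
    omega
  -- For l > 1 projectivity passes to the summand V(l-1, r+1) of V(2,0) ⊗ V(l,r).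
  · obtain ⟨e⟩ := equiv_twoTensor (q := q) hl.le (r := r) (t := 0) hn.le h0 hl
    have := ((dualityTwo hn.le).isFDProjective_tensor hP).of_equiv e
    exact ih (l - 1) (by omega) (by omega) (by omega) _ this.right_of_sum

variable (K n q) in
/-- The representatives of the simple modules. -/
def simple (i : Fin n × Fin n) : FDMod K (Hn n 1 q) := V (i.1 + 1) i.1.2 (i.2 : ℕ)

theorem homDim_simple (i j : Fin n × Fin n) :
    homDim (simple K n q i) (simple K n q j) = if i = j then 1 else 0 := by
  rw [simple, simple, homDim_V _ _ (Nat.succ_pos _) (Nat.succ_pos _)]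
  congr 1
  rw [eq_iff_iff, Prod.ext_iff, Fin.ext_iff, Fin.ext_iff, Nat.succ_inj]
  refine and_congr_right fun _ => ⟨fun h => ?_, fun h => by simp [h]⟩
  have := Int.eq_zero_of_abs_lt_dvd h (by rw [abs_lt]; omega)
  omega

section classes

variable [IsAlgClosed K]

theorem exists_equiv_simple (M : FDMod K (Hn n 1 q)) (hM : IsSimpleModule (Hn n 1 q) M.carrier) :
    ∃ i, Nonempty (M.carrier ≃ₗ[Hn n 1 q] (simple K n q i).carrier) := by
  obtain ⟨l, hl, r, h0, ⟨e⟩⟩ := exists_equiv_V hM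
  have hn : (0 : ℤ) < n := by exact_mod_cast NeZero.pos n
  have h₁ := Int.emod_nonneg r hn.ne'
  have h₂ := Int.emod_lt_of_pos r hn
  obtain ⟨k, rfl⟩ : ∃ k, l = k + 1 := ⟨l - 1, by omega⟩
  obtain ⟨e'⟩ := equiv_V_of_dvd (q := q) hl (r := r) (s := ((r % n).toNat : ℕ)) (by
    rw [Int.toNat_of_nonneg h₁, Int.emod_def]
    exact ⟨r / n, by ring⟩)
  exact ⟨(⟨k, hl⟩, ⟨(r % n).toNat, by omega⟩), ⟨e.trans e'⟩⟩

/-- Projective modules with the same simple quotients have the same class. -/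
theorem cls_eq_of_homDim (h2 : 2 ≤ n) {P P' : FDMod K (Hn n 1 q)} (hP : IsFDProjective P)
    (hP' : IsFDProjective P') (h : ∀ (l : ℕ) (hl : l ≤ n) (r : ℤ), 0 < l →
      homDim P (V (q := q) l hl r) = homDim P' (V (q := q) l hl r)) : cls P = cls P' := by
  choose Q π hπ using fun i : Fin n × Fin n =>
    exists_cover_V (q := q) h2 i.1.val.succ_pos i.1.2 (i.2 : ℕ)
  have hS : ∀ i, IsSimpleModule (Hn n 1 q) (simple K n q i).carrier :=
    fun i => isSimple_V _ (Nat.succ_pos _)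
  rw [cls_eq_sum_of_projective (S := simple K n q) (π := π) hS homDim_simple exists_equiv_simple
    hπ hP, cls_eq_sum_of_projective (S := simple K n q) (π := π) hS homDim_simple
    exists_equiv_simple hπ hP']
  exact Finset.sum_congr rfl fun i _ => by rw [simple, h _ _ _ (Nat.succ_pos _)]

end classes

end Taft
end

noncomputable section

namespace Taft

/-! ### Lucas sequences -/

section lucas

variable {R : Type*} [CommRing R] (x y : R)

/-- The Lucas sequence `0, 1, y, …` with `U (k + 2) = y * U (k + 1) - x * U k`. -/
def lucasU : ℕ → R
  | 0 => 0
  | 1 => 1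
  | k + 2 => y * lucasU (k + 1) - x * lucasU k

/-- The companion Lucas sequence `2, y, …` with `V (k + 2) = y * V (k + 1) - x * V k`. -/
def lucasV : ℕ → R
  | 0 => 2
  | 1 => y
  | k + 2 => y * lucasV (k + 1) - x * lucasV k

theorem lucasU_add_two (k : ℕ) :
    lucasU x y (k + 2) = y * lucasU x y (k + 1) - x * lucasU x y k := by rw [lucasU]

theorem lucasV_add_two (k : ℕ) :
    lucasV x y (k + 2) = y * lucasV x y (k + 1) - x * lucasV x y k := by rw [lucasV]

theorem lucasV_succ (k : ℕ) :
    lucasV x y (k + 1) = lucasU x y (k + 2) - x * lucasU x y k := by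
  induction k using Nat.twoStepInduction with
  | zero => simp [lucasU, lucasV]
  | one => simp only [lucasU, lucasV]; ring
  | more k h₁ h₂ =>
    rw [lucasV_add_two, h₁, h₂, lucasU_add_two x y (k + 2), lucasU_add_two x y (k + 1),
      lucasU_add_two x y k]
    ring

/-- As functions of k, both sides satisfy the Lucas recurrence and agree at k = 0 and k = 1. -/
theorem lucasU_add (m k : ℕ) : lucasU x y (m + 1 + k) =
    lucasU x y (m + 1) * lucasU x y (k + 1) - x * lucasU x y m * lucasU x y k := by
  induction k using Nat.twoStepInduction with
  | zero => simp [lucasU]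
  | one => simp only [lucasU]; ring
  | more k h₁ h₂ =>
    rw [show m + 1 + (k + 2) = m + 1 + k + 2 by ring, lucasU_add_two, add_assoc (m + 1) k 1, h₁, h₂,
      lucasU_add_two x y (k + 1), lucasU_add_two x y k]
    ring

/-- This turns the relation V_n U_n = 2 U_n into U_{2n} = 2 U_n, whose left side is visibly monic in
y. -/
theorem lucasU_two_mul (k : ℕ) : lucasU x y (2 * k) = lucasV x y k * lucasU x y k := by
  cases k with
  | zero => simp [lucasU]
  | succ k =>
    rw [two_mul, lucasU_add, lucasV_succ]
    ring

/-- The terms with 2i > n vanish, so the range may be enlarged. This aligns the sums for three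
consecutive indices, which Pascal's rule then compares term by term. -/
theorem lucasU_eq_sum_of_le {n N : ℕ} (hN : n / 2 + 1 ≤ N) :
    lucasU x y (n + 1) =
      ∑ i ∈ Finset.range N, (-1) ^ i * ((n - i).choose i : R) * x ^ i * y ^ (n - 2 * i) := by
  have hext : ∀ {n N N' : ℕ}, n / 2 + 1 ≤ N → N ≤ N' →
      ∑ i ∈ Finset.range N, (-1) ^ i * ((n - i).choose i : R) * x ^ i * y ^ (n - 2 * i) =
      ∑ i ∈ Finset.range N', (-1) ^ i * ((n - i).choose i : R) * x ^ i * y ^ (n - 2 * i) := by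
    intro n N N' h h'
    refine Finset.sum_subset (Finset.range_subset_range.2 h') fun i _ hi => ?_
    rw [Finset.mem_range, not_lt] at hi
    rw [Nat.choose_eq_zero_of_lt (by omega)]
    simp
  rw [← hext le_rfl hN]
  induction n using Nat.twoStepInduction generalizing N with
  | zero => simp [lucasU]
  | one => simp [lucasU]
  | more n h₁ h₂ =>
    rw [lucasU_add_two, h₁ le_rfl, h₂ le_rfl,
      hext (N := n / 2 + 1) (N' := n + 1) le_rfl (by omega),
      hext (N := (n + 1) / 2 + 1) (N' := n + 2) le_rfl (by omega),
      hext (N := (n + 2) / 2 + 1) (N' := n + 2) le_rfl (by omega),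
      Finset.sum_range_succ' _ (n + 1), Finset.sum_range_succ' _ (n + 1), mul_add, Finset.mul_sum,
      Finset.mul_sum, add_sub_right_comm, ← Finset.sum_sub_distrib]
    congr 1
    · refine Finset.sum_congr rfl fun i hi => ?_
      rw [Finset.mem_range] at hi
      rw [show n + 2 - (i + 1) = n - i + 1 by omega, show n + 1 - (i + 1) = n - i by omega,
        show n + 2 - 2 * (i + 1) = n - 2 * i by omega, Nat.choose_succ_succ]
      -- For 2i + 1 > n the exponent n + 1 - 2(i+1) is truncated, but its binomial coefficient is 0.
      rcases le_or_gt (2 * i + 1) n with h | h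
      · rw [show n - 2 * i = n + 1 - 2 * (i + 1) + 1 by omega]
        push_cast
        ring
      · rw [Nat.choose_eq_zero_of_lt (show n - i < i + 1 by omega)]
        push_cast
        ring
    · simp
      ring

theorem lucasU_eq_sum (n : ℕ) : lucasU x y (n + 1) = ∑ i ∈ Finset.range (n / 2 + 1),
    (-1) ^ i * ((n - i).choose i : R) * x ^ i * y ^ (n - 2 * i) :=
  lucasU_eq_sum_of_le x y le_rfl

/-- This splitting of the coefficient corresponds to V_{k+1} = U_{k+2} - x U_k. -/
theorem lucasCoeff_succ {n i : ℕ} (h : 2 * i ≤ n) :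
    lucasCoeff (n + 2) (i + 1) = (n + 1 - i).choose (i + 1) + (n - i).choose i := by
  have h₁ := sub_mul_lucasCoeff (n := n + 2) (i := i + 1) (by omega) (by omega)
  obtain ⟨m, rfl⟩ : ∃ m, n = m + i := ⟨n - i, by omega⟩
  have h₂ := Nat.add_one_mul_choose_eq m i
  rw [show m + i + 2 - (i + 1) = m + 1 by omega] at h₁
  rw [show m + i + 1 - i = m + 1 by omega, Nat.add_sub_cancel]
  refine Nat.eq_of_mul_eq_mul_left m.succ_pos (h₁.trans ?_)
  rw [Nat.succ_eq_add_one, mul_add, h₂]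
  ring

/-- The expansions of U_{k+2} and x U_k are combined termwise. Positivity matters: V_0 = 2, while
`lucasCoeff 0 0` is 0. -/
theorem lucasV_eq_sum {n : ℕ} (hn : 0 < n) : lucasV x y n = ∑ i ∈ Finset.range (n / 2 + 1),
    (-1) ^ i * (lucasCoeff n i : R) * x ^ i * y ^ (n - 2 * i) := by
  obtain ⟨k, rfl⟩ : ∃ k, n = k + 1 := ⟨n - 1, by omega⟩
  cases k with
  | zero => simp [lucasV, lucasCoeff]
  | succ k =>
    rw [lucasV_succ, lucasU_eq_sum, lucasU_eq_sum, show (k + 1 + 1) / 2 = k / 2 + 1 by omega,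
      Finset.sum_range_succ', Finset.sum_range_succ' _ (k / 2 + 1), Finset.mul_sum,
      add_sub_right_comm, ← Finset.sum_sub_distrib]
    congr 1
    · refine Finset.sum_congr rfl fun i hi => ?_
      rw [Finset.mem_range] at hi
      rw [lucasCoeff_succ (by omega), show k + 1 + 1 - (i + 1) = k + 1 - i by omega,
        show k + 1 + 1 - 2 * (i + 1) = k - 2 * i by omega]
      push_cast
      ring
    · have : lucasCoeff (k + 1 + 1) 0 = 1 := by simp [lucasCoeff]
      rw [this]
      simp

/-! ### Spanning by monomials -/

/-- The span of the monomials of degree less than `k` in `y`. -/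
def degreeLT (k : ℕ) : Submodule ℤ R :=
  Submodule.span ℤ {z | ∃ i j, j < k ∧ z = x ^ i * y ^ j}

variable {x y}

theorem monomial_mem_degreeLT {k : ℕ} (i : ℕ) {j : ℕ} (h : j < k) :
    x ^ i * y ^ j ∈ degreeLT x y k :=
  Submodule.subset_span ⟨i, j, h, rfl⟩

theorem degreeLT_mono {k k' : ℕ} (h : k ≤ k') : degreeLT x y k ≤ degreeLT x y k' :=
  Submodule.span_mono fun _ ⟨i, j, hj, hz⟩ => ⟨i, j, hj.trans_le h, hz⟩

theorem mul_mem_of_span {s : Set R} {N : Submodule ℤ R} (z : R) (h : ∀ w ∈ s, z * w ∈ N) {w : R}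
    (hw : w ∈ Submodule.span ℤ s) : z * w ∈ N :=
  (Submodule.span_le (p := N.comap (LinearMap.mulLeft ℤ z))).2 h hw

theorem x_mul_mem_degreeLT {k : ℕ} {z : R} (hz : z ∈ degreeLT x y k) :
    x * z ∈ degreeLT x y k := by
  refine mul_mem_of_span x ?_ hz
  rintro _ ⟨i, j, hj, rfl⟩
  rw [← mul_assoc, ← pow_succ']
  exact monomial_mem_degreeLT _ hj

theorem y_mul_mem_degreeLT {k : ℕ} {z : R} (hz : z ∈ degreeLT x y k) :
    y * z ∈ degreeLT x y (k + 1) := by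
  refine mul_mem_of_span y ?_ hz
  rintro _ ⟨i, j, hj, rfl⟩
  rw [mul_left_comm, ← pow_succ']
  exact monomial_mem_degreeLT _ (by omega)

theorem y_pow_mem_degreeLT {k j : ℕ} (h : j < k) : y ^ j ∈ degreeLT x y k := by
  simpa using monomial_mem_degreeLT (x := x) (y := y) 0 h

/-- In other words, U_{k+1} is monic of degree k in y. -/
theorem lucasU_sub_mem_degreeLT (k : ℕ) : lucasU x y (k + 1) - y ^ k ∈ degreeLT x y k := by
  induction k using Nat.twoStepInduction with
  | zero => simp [lucasU]
  | one => simp [lucasU]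
  | more k h₁ h₂ =>
    have h₃ : lucasU x y (k + 1) ∈ degreeLT x y (k + 2) := by
      have := add_mem (degreeLT_mono (Nat.le_add_right k 2) h₁)
        (y_pow_mem_degreeLT (x := x) (y := y) (show k < k + 2 by omega))
      simpa using this
    have := sub_mem (y_mul_mem_degreeLT h₂) (x_mul_mem_degreeLT h₃)
    convert this using 1
    rw [lucasU_add_two]
    ring

theorem lucasU_mem_degreeLT (k : ℕ) : lucasU x y k ∈ degreeLT x y k := by
  cases k with
  | zero => simp [lucasU]
  | succ k =>
    simpa using add_mem (degreeLT_mono k.le_succ (lucasU_sub_mem_degreeLT k))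
      (y_pow_mem_degreeLT (x := x) (y := y) k.lt_succ_self)

/-- By hypothesis U_{2n} = V_n U_n = U_n + U_n. The left side is y^(2n-1) plus lower terms and U_n
has degree less than n, so y^(2n-1) reduces to lower powers. The span is therefore stable under
multiplication by x and by y. -/
theorem aeval_mem_degreeLT {n : ℕ} (hn : 0 < n)
    (h : lucasV x y n * lucasU x y n = 2 * lucasU x y n) (p : MvPolynomial (Fin 2) ℤ) :
    MvPolynomial.aeval ![x, y] p ∈ degreeLT x y (2 * n - 1) := by
  have hy : ∀ j < 2 * n, y ^ j ∈ degreeLT x y (2 * n - 1) := by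
    intro j hj
    rcases eq_or_ne j (2 * n - 1) with rfl | hne
    · have h₁ := lucasU_sub_mem_degreeLT (x := x) (y := y) (2 * n - 1)
      have h₂ := degreeLT_mono (show n ≤ 2 * n - 1 by omega) (lucasU_mem_degreeLT (x := x) (y := y) n)
      have h₃ := sub_mem (add_mem h₂ h₂) h₁
      rw [show 2 * n - 1 + 1 = 2 * n by omega, lucasU_two_mul, h] at h₃
      convert h₃ using 1
      ring
    · exact y_pow_mem_degreeLT (by omega)
  have hx : ∀ i z, z ∈ degreeLT x y (2 * n - 1) → x ^ i * z ∈ degreeLT x y (2 * n - 1) := by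
    intro i z hz
    induction i with
    | zero => simpa using hz
    | succ i ih =>
      rw [pow_succ', mul_assoc]
      exact x_mul_mem_degreeLT ih
  induction p using MvPolynomial.induction_on with
  | C a =>
    have := (degreeLT x y (2 * n - 1)).smul_mem a (hy 0 (by omega))
    simpa [MvPolynomial.aeval_C] using this
  | add p p' hp hp' => rw [map_add]; exact add_mem hp hp'
  | mul_X p i hp =>
    rw [map_mul, MvPolynomial.aeval_X, mul_comm _ (![x, y] i)]
    fin_cases i
    · exact x_mul_mem_degreeLT hp
    · refine mul_mem_of_span y ?_ hp
      rintro _ ⟨i, j, hj, rfl⟩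
      rw [mul_left_comm, ← pow_succ']
      exact hx _ _ (hy _ (by omega))

theorem degreeLT_le_span {n : ℕ} (hn : 0 < n) (h : x ^ n = 1) (k : ℕ) :
    degreeLT x y k ≤
      Submodule.span ℤ (Set.range fun i : Fin n × Fin k => x ^ (i.1 : ℕ) * y ^ (i.2 : ℕ)) := by
  refine Submodule.span_mono ?_
  rintro _ ⟨i, j, hj, rfl⟩
  refine ⟨(⟨i % n, Nat.mod_lt _ hn⟩, ⟨j, hj⟩), ?_⟩
  dsimp only
  rw [← pow_eq_pow_mod i h]

end lucas

/-! ### Homomorphisms from the polynomial ring -/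

open scoped IsMulCommutative in
/-- Commuting elements of a ring receive a homomorphism from the polynomial ring. -/
theorem exists_ringHom_of_commute {R : Type*} [Ring R] {x y : R} (h : x * y = y * x) :
    ∃ f : MvPolynomial (Fin 2) ℤ →+* R, f (MvPolynomial.X 0) = x ∧ f (MvPolynomial.X 1) = y := by
  -- The target need not be commutative, so evaluation takes place in the commutative subring
  -- generated by x and y.
  have : IsMulCommutative (Subring.closure {x, y}) := Subring.isMulCommutative_closure (by
    rintro a (rfl | rfl) b (rfl | rfl)
    exacts [rfl, h, h.symm, rfl])
  let x' : Subring.closure {x, y} := ⟨x, Subring.subset_closure (by simp)⟩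
  let y' : Subring.closure {x, y} := ⟨y, Subring.subset_closure (by simp)⟩
  refine ⟨(Subring.subtype (Subring.closure {x, y})).comp
    (MvPolynomial.aeval ![x', y']).toRingHom, ?_, ?_⟩
  · simp [x']
  · simp [y']

end Taft
end

noncomputable section

namespace Taft

open Green FDMod MvPolynomial

/-! ### Products in the Green ring -/

variable {K : Type u} [Field K] {n : ℕ} {q : K} [NeZero n] [hq : Fact (IsPrimitiveRoot q n)]
  {l : ℕ} {r : ℤ}

theorem cls_V_of_dvd (hl : l ≤ n) {s : ℤ} (h : (n : ℤ) ∣ r - s) :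
    cls (V (q := q) l hl r) = cls (V (q := q) l hl s) := by
  obtain ⟨e⟩ := equiv_V_of_dvd (q := q) hl h
  exact cls_congr e

theorem cls_one_mul (h1 : 1 ≤ n) (hl : l ≤ n) (t : ℤ) :
    cls (V (q := q) 1 h1 t) * cls (V (q := q) l hl r) = cls (V (q := q) l hl (t + r)) := by
  obtain ⟨e⟩ := equiv_V_one_tensor (q := q) hl (r := r) (t := t) h1
  rw [← cls_tensor, cls_congr e]

theorem cls_two_mul (h2 : 2 ≤ n) (h0 : 0 < l) (hl : l < n) :
    cls (V (q := q) 2 h2 0) * cls (V (q := q) l hl.le r) =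
      cls (V (q := q) (l + 1) hl r) + cls (V (q := q) (l - 1) (by omega) (r + 1)) := by
  obtain ⟨e⟩ := equiv_twoTensor (q := q) hl.le (r := r) (t := 0) h2 h0 hl
  have := cls_congr e
  rw [cls_sum, zero_add] at this
  exact (cls_tensor _ _).symm.trans this

theorem cls_V_one (h1 : 1 ≤ n) : cls (V (q := q) 1 h1 0) = 1 := by
  obtain ⟨e⟩ := equiv_unit (q := q) h1
  rw [cls_congr e, cls_one]

theorem cls_V_zero (h0 : l = 0) (hl : l ≤ n) : cls (V (q := q) l hl r) = 0 :=
  cls_eq_zero ((dim_V hl).trans h0)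

/-- Both products are [V(2,1)]. Commutativity of the whole Green ring is not needed. -/
theorem cls_comm (h1 : 1 ≤ n) (h2 : 2 ≤ n) :
    cls (V (q := q) 1 h1 1) * cls (V (q := q) 2 h2 0) =
      cls (V (q := q) 2 h2 0) * cls (V (q := q) 1 h1 1) := by
  rw [cls_one_mul, add_zero, cls_two_mul h2 one_pos h2, cls_V_zero (l := 1 - 1) rfl, add_zero]

theorem map_X_pow_mul_cls {Ψ : MvPolynomial (Fin 2) ℤ →+* GreenRing K (Hn n 1 q)} {h1 : 1 ≤ n}
    (hx : Ψ (X 0) = cls (V 1 h1 1)) (hl : l ≤ n) (k : ℕ) :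
    Ψ (X 0 ^ k) * cls (V (q := q) l hl r) = cls (V (q := q) l hl (k + r)) := by
  induction k with
  | zero => simp
  | succ k ih =>
    rw [pow_succ', map_mul, mul_assoc, ih, hx, cls_one_mul]
    congr 2
    push_cast
    ring

theorem map_X_pow_card {Ψ : MvPolynomial (Fin 2) ℤ →+* GreenRing K (Hn n 1 q)} {h1 : 1 ≤ n}
    (hx : Ψ (X 0) = cls (V 1 h1 1)) : Ψ (X 0 ^ n) = 1 := by
  have := map_X_pow_mul_cls hx h1 n (r := 0)
  rwa [cls_V_one, mul_one, cls_V_of_dvd h1 (s := 0) (by simp), cls_V_one] at this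

/-- The decomposition of V(2,0) ⊗ V(l+1,0) reads y[V(l+1,0)] = [V(l+2,0)] + x[V(l,0)], since
[V(l,1)] = x[V(l,0)]. This is the recurrence of U. -/
theorem map_lucasU {Ψ : MvPolynomial (Fin 2) ℤ →+* GreenRing K (Hn n 1 q)} {h1 : 1 ≤ n}
    {h2 : 2 ≤ n} (hx : Ψ (X 0) = cls (V 1 h1 1)) (hy : Ψ (X 1) = cls (V 2 h2 0)) (hl : l ≤ n) :
    Ψ (lucasU (X 0) (X 1) l) = cls (V l hl 0) := by
  induction l using Nat.twoStepInduction with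
  | zero => rw [cls_V_zero rfl, lucasU, map_zero]
  | one => rw [cls_V_one, lucasU, map_one]
  | more l h₁ h₂ =>
    have := cls_two_mul (q := q) h2 (l := l + 1) (r := 0) l.succ_pos hl
    simp only [add_tsub_cancel_right] at this
    rw [lucasU_add_two, map_sub, map_mul, map_mul, h₁ (by omega), h₂ (by omega), hx, hy, this,
      cls_one_mul, add_zero, zero_add, add_sub_cancel_right]

theorem map_X_pow_mul_lucasU {Ψ : MvPolynomial (Fin 2) ℤ →+* GreenRing K (Hn n 1 q)} {h1 : 1 ≤ n}
    {h2 : 2 ≤ n} (hx : Ψ (X 0) = cls (V 1 h1 1)) (hy : Ψ (X 1) = cls (V 2 h2 0)) (hl : l ≤ n)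
    (k : ℕ) : Ψ (X 0 ^ k * lucasU (X 0) (X 1) l) = cls (V l hl k) := by
  rw [map_mul, map_lucasU hx hy hl, map_X_pow_mul_cls hx, add_zero]

/-! ### Classes of projective covers -/

section covers

variable {Q Q' Q₁ Q₂ : FDMod K (Hn n 1 q)}

theorem exists_coverOf (h2 : 2 ≤ n) (h0 : 0 < l) (hl : l ≤ n) (r : ℤ) :
    ∃ Q : FDMod K (Hn n 1 q), CoverOf Q l r := by
  obtain ⟨Q, π, hπ⟩ := exists_cover_V (q := q) h2 h0 hl r
  exact ⟨Q, coverOf_of_isCover h0 hl hπ⟩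

theorem CoverOf.of_dvd (h : CoverOf Q l r) {s : ℤ} (hs : (n : ℤ) ∣ r - s) : CoverOf Q l s := by
  refine ⟨h.projective, fun l' hl' r' => ?_⟩
  rw [h.homDim_eq]
  have : (n : ℤ) ∣ r - r' ↔ (n : ℤ) ∣ s - r' := by
    rw [show r - r' = (r - s) + (s - r') by ring]
    exact dvd_add_right hs
  simp only [this]

/-- The three terms record the summands of V(2,0) ⊗ P(l,r): P(l-1,r+1); P(l+1,r), doubled when l + 1
= n; and, when l = 1, two copies of V(n,r+1) instead of a lower neighbour. -/
theorem CoverOf.homDim_two_tensor (h : CoverOf Q l r) (hn : 2 < n) (h0 : 0 < l) {l' : ℕ}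
    (h0' : 0 < l') (hl' : l' ≤ n) (r' : ℤ) :
    homDim (tensor (V 2 hn.le 0) Q) (V (q := q) l' hl' r') =
      (if l = l' + 1 ∧ l' ≠ n ∧ (n : ℤ) ∣ r + 1 - r' then 1 else 0) +
      (if l + 1 = l' ∧ (n : ℤ) ∣ r - r' then if l' = n then 2 else 1 else 0) +
      if l = 1 ∧ l' = n ∧ (n : ℤ) ∣ r + 1 - r' then 2 else 0 := by
  have e : r - (r' - 1) = r + 1 - r' := by ring
  rcases hl'.lt_or_eq with hlt | rfl
  · rw [Taft.homDim_two_tensor hn.le Q h0' hlt, h.homDim_eq, h.homDim_eq, e]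
    by_cases hA : (n : ℤ) ∣ r + 1 - r' <;> by_cases hB : (n : ℤ) ∣ r - r' <;>
      simp only [hA, hB, and_true, and_false, if_false] <;> split_ifs <;> omega
  · rw [homDim_two_tensor_top hn.le h.projective, h.homDim_eq, h.homDim_eq, e]
    by_cases hA : (l' : ℤ) ∣ r + 1 - r' <;> by_cases hB : (l' : ℤ) ∣ r - r' <;>
      simp only [hA, hB, and_true, and_false, if_false] <;> split_ifs <;> omega

variable [IsAlgClosed K]

theorem CoverOf.cls_eq (h2 : 2 ≤ n) (h : CoverOf Q l r) (h' : CoverOf Q' l r) : cls Q = cls Q' :=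
  cls_eq_of_homDim h2 h.projective h'.projective fun l' hl' r' _ => by
    rw [h.homDim_eq, h'.homDim_eq]

theorem CoverOf.cls_eq_V (h2 : 2 ≤ n) (h : CoverOf Q n r) : cls Q = cls (V (q := q) n le_rfl r) :=
  h.cls_eq h2 coverOf_V

theorem CoverOf.two_mul_top (hn : 2 < n) (h : CoverOf Q n r) (h₁ : CoverOf Q₁ (n - 1) (r + 1)) :
    cls (V (q := q) 2 hn.le 0) * cls Q = cls Q₁ := by
  rw [← cls_tensor]
  refine cls_eq_of_homDim hn.le ((dualityTwo hn.le).isFDProjective_tensor h.projective)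
    h₁.projective fun l' hl' r' h0' => ?_
  rw [h.homDim_two_tensor hn (by omega) h0' hl', h₁.homDim_eq]
  by_cases hA : (n : ℤ) ∣ r + 1 - r' <;>
    simp only [hA, and_true, and_false, if_false] <;> split_ifs <;> omega

/-- The factor 2 comes from the two composition factors V(n-1,r) of V(2,-1) ⊗ V(n,r). -/
theorem CoverOf.two_mul_pred (hn : 2 < n) (h : CoverOf Q (n - 1) r)
    (h₁ : CoverOf Q₁ (n - 2) (r + 1)) (h₂ : CoverOf Q₂ n r) :
    cls (V (q := q) 2 hn.le 0) * cls Q = cls Q₁ + 2 * cls Q₂ := by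
  rw [← cls_tensor, two_mul, ← cls_sum, ← cls_sum]
  refine cls_eq_of_homDim hn.le ((dualityTwo hn.le).isFDProjective_tensor h.projective)
    (h₁.projective.sum (h₂.projective.sum h₂.projective)) fun l' hl' r' h0' => ?_
  rw [h.homDim_two_tensor hn (by omega) h0' hl', homDim_sum_left, homDim_sum_left, h₁.homDim_eq,
    h₂.homDim_eq]
  by_cases hA : (n : ℤ) ∣ r + 1 - r' <;> by_cases hB : (n : ℤ) ∣ r - r' <;>
    simp only [hA, hB, and_true, and_false, if_false] <;> split_ifs <;> omega

theorem CoverOf.two_mul (hn : 2 < n) (h0 : 1 < l) (hl : l < n - 1) (h : CoverOf Q l r)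
    (h₁ : CoverOf Q₁ (l - 1) (r + 1)) (h₂ : CoverOf Q₂ (l + 1) r) :
    cls (V (q := q) 2 hn.le 0) * cls Q = cls Q₁ + cls Q₂ := by
  rw [← cls_tensor, ← cls_sum]
  refine cls_eq_of_homDim hn.le ((dualityTwo hn.le).isFDProjective_tensor h.projective)
    (h₁.projective.sum h₂.projective) fun l' hl' r' h0' => ?_
  rw [h.homDim_two_tensor hn (by omega) h0' hl', homDim_sum_left, h₁.homDim_eq, h₂.homDim_eq]
  by_cases hA : (n : ℤ) ∣ r + 1 - r' <;> by_cases hB : (n : ℤ) ∣ r - r' <;>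
    simp only [hA, hB, and_true, and_false, if_false] <;> split_ifs <;> omega

/-- The factor 2 comes from the two composition factors V(1,r) of V(2,-1) ⊗ V(n,r+1). -/
theorem CoverOf.two_mul_one (hn : 2 < n) (h : CoverOf Q 1 r)
    (h₁ : CoverOf Q₁ 2 r) (h₂ : CoverOf Q₂ n (r + 1)) :
    cls (V (q := q) 2 hn.le 0) * cls Q = cls Q₁ + 2 * cls Q₂ := by
  rw [← cls_tensor, _root_.two_mul, ← cls_sum, ← cls_sum]
  refine cls_eq_of_homDim hn.le ((dualityTwo hn.le).isFDProjective_tensor h.projective)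
    (h₁.projective.sum (h₂.projective.sum h₂.projective)) fun l' hl' r' h0' => ?_
  rw [h.homDim_two_tensor hn (by omega) h0' hl', homDim_sum_left, homDim_sum_left, h₁.homDim_eq,
    h₂.homDim_eq]
  by_cases hA : (n : ℤ) ∣ r + 1 - r' <;> by_cases hB : (n : ℤ) ∣ r - r' <;>
    simp only [hA, hB, and_true, true_and, and_false, if_false] <;> split_ifs <;> omega

variable {Ψ : MvPolynomial (Fin 2) ℤ →+* GreenRing K (Hn n 1 q)} {h1 : 1 ≤ n}

/-- The class of the projective cover of `V(n - j, j + k)`. -/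
theorem CoverOf.cls_eq_map (hn : 2 < n) (hx : Ψ (X 0) = cls (V 1 h1 1))
    (hy : Ψ (X 1) = cls (V 2 hn.le 0)) (j : ℕ) (hj : j + 1 < n) (k : ℕ) :
    ∀ {Q : FDMod K (Hn n 1 q)}, CoverOf Q (n - (j + 1)) ((j + 1 : ℕ) + k) →
    cls Q = Ψ (X 0 ^ k * (lucasV (X 0) (X 1) (j + 1) * lucasU (X 0) (X 1) n)) := by
  -- The index j + 1 excludes 0, where the formula fails: V_0 U_n = 2 U_n, while P(n,0) = V(n,0) has
  -- class U_n. The doubling in `two_mul_pred` compensates for this and makes V_2 = y^2 - 2x appear.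
  induction j using Nat.twoStepInduction generalizing k with
  | zero =>
    intro Q h
    rw [show ((0 + 1 : ℕ) + k : ℤ) = k + 1 by push_cast; ring] at h
    rw [← coverOf_V.two_mul_top hn h, lucasV, mul_left_comm, map_mul,
      map_X_pow_mul_lucasU hx hy le_rfl, hy]
  | one =>
    intro Q h
    rw [show ((1 + 1 : ℕ) + k : ℤ) = (k + 1 : ℕ) + 1 by push_cast; ring] at h
    obtain ⟨Q', h'⟩ := exists_coverOf (q := q) hn.le (l := n - 1) (by omega) (by omega) (k + 1 : ℕ)
    have e := h'.two_mul_pred hn h coverOf_V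
    have e' := CoverOf.two_mul_top hn coverOf_V (by rwa [Nat.cast_succ] at h')
    rw [← e', ← map_X_pow_mul_lucasU hx hy le_rfl, ← map_X_pow_mul_lucasU hx hy le_rfl, ← hy,
      ← map_mul, ← map_mul] at e
    rw [eq_sub_of_add_eq e.symm, ← map_ofNat Ψ 2, ← map_mul, ← map_sub]
    congr 1
    simp only [lucasV]
    ring
  | more j ih₁ ih₂ =>
    intro Q h
    obtain ⟨Q', h'⟩ := exists_coverOf (q := q) hn.le (l := n - (j + 1 + 1)) (by omega) (by omega)
      ((j + 1 + 1 : ℕ) + k)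
    -- The upper neighbour P(n-(j+1), j+k+2) belongs to the parameter k + 1 instead of k; this is
    -- the factor x in the recurrence of V.
    obtain ⟨Q₂, h₂⟩ := exists_coverOf (q := q) hn.le (l := n - (j + 1)) (by omega) (by omega)
      ((j + 1 : ℕ) + (k + 1 : ℕ))
    have e := h'.two_mul hn (by omega) (by omega) (Q₁ := Q) (Q₂ := Q₂)
      (by convert h using 1 <;> omega)
      (by convert h₂ using 1 <;> omega)
    rw [ih₁ (by omega) (k + 1) h₂, ih₂ (by omega) k h', ← hy, ← map_mul] at e
    rw [eq_sub_of_add_eq e.symm, ← map_sub, lucasV_add_two _ _ (j + 1)]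
    congr 1
    ring

/-- The product y[P(1,n-1)] = [P(2,n-1)] + 2[V(n,n)] closes the recursion. The three classes are
V_{n-1} U_n, x V_{n-2} U_n and U_n, because V(n,n) ≅ V(n,0), and y V_{n-1} - x V_{n-2} = V_n. -/
theorem map_lucasV_mul_lucasU (hn : 2 < n) (hx : Ψ (X 0) = cls (V 1 h1 1))
    (hy : Ψ (X 1) = cls (V 2 hn.le 0)) :
    Ψ (lucasV (X 0) (X 1) n * lucasU (X 0) (X 1) n) = Ψ (2 * lucasU (X 0) (X 1) n) := by
  obtain ⟨m, rfl⟩ : ∃ m, n = m + 1 + 2 := ⟨n - 3, by omega⟩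
  obtain ⟨Q, h⟩ := exists_coverOf (q := q) hn.le (l := 1) (by omega) (by omega)
    ((m + 1 + 1 : ℕ) + (0 : ℕ))
  obtain ⟨Q₁, h₁⟩ := exists_coverOf (q := q) hn.le (l := 2) (by omega) (by omega)
    ((m + 1 : ℕ) + (1 : ℕ))
  have e := h.two_mul_one hn (Q₁ := Q₁) (by convert h₁ using 1; push_cast; ring) coverOf_V
  rw [CoverOf.cls_eq_map hn hx hy (m + 1) (by omega) 0 (Q := Q) (by convert h using 1; omega),
    CoverOf.cls_eq_map hn hx hy m (by omega) 1 (Q := Q₁) (by convert h₁ using 1; omega), ← hy,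
    cls_V_of_dvd le_rfl (s := 0) ⟨1, by push_cast; ring⟩, ← map_lucasU hx hy le_rfl,
    ← map_ofNat Ψ 2, ← map_mul, ← map_mul, ← map_add] at e
  have e' := congrArg (· - Ψ (X 0 ^ 1 * (lucasV (X 0) (X 1) (m + 1) *
    lucasU (X 0) (X 1) (m + 1 + 2)))) e
  simp only [← map_sub] at e'
  rw [add_sub_cancel_left] at e'
  rw [← e', lucasV_add_two]
  congr 1
  ring

end covers

end Taft
end

noncomputable section

namespace Taft

open Green FDMod MvPolynomial

/-! ### The presentation of the projective class ring -/

theorem map_lucas {R S : Type*} [CommRing R] [CommRing S] (f : R →+* S) (x y : R) (k : ℕ) :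
    f (lucasU x y k) = lucasU (f x) (f y) k ∧ f (lucasV x y k) = lucasV (f x) (f y) k := by
  induction k using Nat.twoStepInduction with
  | zero => simp [lucasU, lucasV, map_ofNat f 2]
  | one => simp [lucasU, lucasV]
  | more k h₁ h₂ => simp [lucasU_add_two, lucasV_add_two, h₁, h₂]

/-- The two explicit sums are the closed forms of V_n and U_n. -/
theorem relIdeal_eq {n : ℕ} (hn : 0 < n) : relIdeal n =
    Ideal.span {X 0 ^ n - 1, (lucasV (X 0) (X 1) n - 2) * lucasU (X 0) (X 1) n} := by
  obtain ⟨k, rfl⟩ : ∃ k, n = k + 1 := ⟨n - 1, by omega⟩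
  rw [lucasV_eq_sum _ _ hn, lucasU_eq_sum]
  rfl

theorem span_monomials_of_surjective {R : Type*} [CommRing R] {f : MvPolynomial (Fin 2) ℤ →+* R}
    (hf : Function.Surjective f) {n : ℕ} (hn : 0 < n) (hx : f (X 0 ^ n - 1) = 0)
    (hy : f ((lucasV (X 0) (X 1) n - 2) * lucasU (X 0) (X 1) n) = 0) :
    Submodule.span ℤ (Set.range fun i : Fin n × Fin (2 * n - 1) =>
      f (X 0) ^ (i.1 : ℕ) * f (X 1) ^ (i.2 : ℕ)) = ⊤ := by
  rw [map_sub, map_pow, map_one, sub_eq_zero] at hx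
  rw [sub_mul, map_sub, map_mul, map_mul, (map_lucas f _ _ n).1, (map_lucas f _ _ n).2,
    map_ofNat f 2, sub_eq_zero] at hy
  rw [eq_top_iff]
  rintro a -
  obtain ⟨p, rfl⟩ := hf a
  have : f = (aeval ![f (X 0), f (X 1)]).toRingHom := by
    refine MvPolynomial.ringHom_ext (fun a => by simp) fun i => ?_
    fin_cases i <;> simp
  rw [show f p = aeval ![f (X 0), f (X 1)] p from DFunLike.congr_fun this p]
  exact degreeLT_le_span hn hx _ (aeval_mem_degreeLT hn hy p)

theorem span_monomials_eq_top {n : ℕ} (hn : 0 < n) :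
    Submodule.span ℤ (Set.range fun i : Fin n × Fin (2 * n - 1) =>
      Ideal.Quotient.mk (relIdeal n) (X 0) ^ (i.1 : ℕ) *
        Ideal.Quotient.mk (relIdeal n) (X 1) ^ (i.2 : ℕ)) = ⊤ := by
  refine span_monomials_of_surjective Ideal.Quotient.mk_surjective hn
    (Ideal.Quotient.eq_zero_iff_mem.2 ?_) (Ideal.Quotient.eq_zero_iff_mem.2 ?_) <;>
  · rw [relIdeal_eq hn]
    exact Ideal.subset_span (by simp)

/-- The span of b contains an independent family at least as large as b, so its rank is at least the
number of generators. -/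
theorem linearIndependent_of_card_le {M ι κ : Type*} [AddCommGroup M] [Fintype ι] [Fintype κ]
    {b : ι → M} {w : κ → M} (hw : LinearIndependent ℤ w)
    (h : ∀ k, w k ∈ Submodule.span ℤ (Set.range b)) (hc : Fintype.card ι ≤ Fintype.card κ) :
    LinearIndependent ℤ b := by
  rw [linearIndependent_iff_card_le_finrank_span]
  have : Module.Finite ℤ (Submodule.span ℤ (Set.range b)) :=
    Module.Finite.span_of_finite ℤ (Set.finite_range b)
  have hw' : LinearIndependent ℤ fun k => (⟨w k, h k⟩ : Submodule.span ℤ (Set.range b)) :=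
    LinearIndependent.of_comp (Submodule.span ℤ (Set.range b)).subtype hw
  exact hc.trans hw'.fintype_card_le_finrank

variable {K : Type u} [Field K] {n : ℕ} {q : K} [NeZero n]
  [hq : Fact (IsPrimitiveRoot q n)] {Ψ : MvPolynomial (Fin 2) ℤ →+* GreenRing K (Hn n 1 q)}
  {h1 : 1 ≤ n}

theorem cls_simple_mem_range (hn : 2 < n) (hx : Ψ (X 0) = cls (V 1 h1 1))
    (hy : Ψ (X 1) = cls (V 2 hn.le 0)) (i : Fin n × Fin n) : cls (simple K n q i) ∈ Ψ.range :=
  ⟨_, map_X_pow_mul_lucasU hx hy _ _⟩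

variable [IsAlgClosed K]

theorem relIdeal_le_ker (hn : 2 < n) (hx : Ψ (X 0) = cls (V 1 h1 1))
    (hy : Ψ (X 1) = cls (V 2 hn.le 0)) : ∀ a ∈ relIdeal n, Ψ a = 0 := by
  intro a ha
  rw [relIdeal_eq h1] at ha
  refine (Ideal.span_le (I := RingHom.ker Ψ)).2 ?_ ha
  rintro _ (rfl | rfl)
  · rw [SetLike.mem_coe, RingHom.mem_ker, map_sub, map_X_pow_card hx, map_one, sub_self]
  · rw [SetLike.mem_coe, RingHom.mem_ker, sub_mul, map_sub, map_lucasV_mul_lucasU hn hx hy,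
      sub_self]

theorem CoverOf.cls_mem_range {Q : FDMod K (Hn n 1 q)} {l : ℕ} {r : ℤ} (h : CoverOf Q l r)
    (h0 : 0 < l) (hl : l ≤ n) (hn : 2 < n) (hx : Ψ (X 0) = cls (V 1 h1 1))
    (hy : Ψ (X 1) = cls (V 2 hn.le 0)) : cls Q ∈ Ψ.range := by
  have hn0 : (0 : ℤ) < n := by omega
  obtain ⟨j, rfl⟩ : ∃ j, l = n - j := ⟨n - l, by omega⟩
  -- Replacing r by a congruent integer j + k with k ≥ 0 brings the cover into the form treated in
  -- `CoverOf.cls_eq_map`.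
  obtain ⟨k, hk⟩ : ∃ k : ℕ, (n : ℤ) ∣ r - (j + k) := by
    refine ⟨((r - j) % n).toNat, ?_⟩
    rw [Int.toNat_of_nonneg (Int.emod_nonneg _ hn0.ne'), ← sub_sub]
    exact Int.dvd_self_sub_emod
  have h' := h.of_dvd hk
  cases j with
  | zero =>
    rw [Nat.cast_zero, zero_add] at h'
    rw [CoverOf.cls_eq_V hn.le h', ← map_X_pow_mul_lucasU hx hy le_rfl]
    exact ⟨_, rfl⟩
  | succ j =>
    rw [CoverOf.cls_eq_map hn hx hy j (by omega) k h']
    exact ⟨_, rfl⟩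

theorem cls_mem_range (hn : 2 < n) (hx : Ψ (X 0) = cls (V 1 h1 1))
    (hy : Ψ (X 1) = cls (V 2 hn.le 0)) {M : FDMod K (Hn n 1 q)}
    (hM : Module.Projective (Hn n 1 q) M.carrier ∨ IsSimpleModule (Hn n 1 q) M.carrier) :
    cls M ∈ Ψ.range := by
  rcases hM with hM | hM
  · choose Q π hπ using fun i : Fin n × Fin n =>
      exists_cover_V (q := q) hn.le i.1.val.succ_pos i.1.2 (i.2 : ℕ)
    rw [cls_eq_sum_of_projective (S := simple K n q) (π := π)
      (fun i => isSimple_V _ (Nat.succ_pos _)) homDim_simple exists_equiv_simple hπ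
      (isFDProjective_of_projective hM)]
    exact sum_mem fun i _ => nsmul_mem ((coverOf_of_isCover (Nat.succ_pos _) i.1.2
      (hπ i)).cls_mem_range (Nat.succ_pos _) i.1.2 hn hx hy) _
  · obtain ⟨i, ⟨e⟩⟩ := exists_equiv_simple M hM
    rw [cls_congr e]
    exact cls_simple_mem_range hn hx hy i

/-- The image lies in r_p because x and y are classes of simple modules. Conversely, the generators
of r_p are polynomials in x and y. -/
theorem range_eq_projectiveClassRing (hn : 2 < n) (hx : Ψ (X 0) = cls (V 1 h1 1))
    (hy : Ψ (X 1) = cls (V 2 hn.le 0)) : Ψ.range = projectiveClassRing K (Hn n 1 q) := by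
  refine le_antisymm ?_ (Subring.closure_le.2 ?_)
  · rintro _ ⟨p, rfl⟩
    induction p using MvPolynomial.induction_on with
    | C a => rw [eq_intCast C a, map_intCast]; exact intCast_mem _ a
    | add p p' hp hp' => rw [map_add]; exact add_mem hp hp'
    | mul_X p i hp =>
      rw [map_mul]
      refine mul_mem hp (Subring.subset_closure ?_)
      fin_cases i
      · exact ⟨_, Or.inr (isSimple_V h1 one_pos), hx⟩
      · exact ⟨_, Or.inr (isSimple_V hn.le two_pos), hy⟩
  · rintro _ ⟨M, hM, rfl⟩
    exact cls_mem_range hn hx hy hM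

/-- A count: the monomials span the image, which contains the independent classes of the
non-projective simple modules and of the covers, and these are at least n(2n-1) in number. -/
theorem linearIndependent_monomials (hn : 2 < n) (hx : Ψ (X 0) = cls (V 1 h1 1))
    (hy : Ψ (X 1) = cls (V 2 hn.le 0)) :
    LinearIndependent ℤ fun i : Fin n × Fin (2 * n - 1) =>
      Ψ (X 0 ^ (i.1 : ℕ) * X 1 ^ (i.2 : ℕ)) := by
  choose Q π hπ using fun i : Fin n × Fin n =>
    exists_cover_V (q := q) hn.le i.1.val.succ_pos i.1.2 (i.2 : ℕ)
  have hLI := linearIndependent_simple_cover (S := simple K n q) (π := π)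
    (fun i => isSimple_V _ (Nat.succ_pos _)) homDim_simple hπ (fun i => (i.1 : ℕ) + 1 < n)
    fun i hi => not_isFDProjective_V hn (Nat.succ_pos _) hi _
  have hspan : ∀ z ∈ Ψ.range, z ∈ Submodule.span ℤ (Set.range fun i : Fin n × Fin (2 * n - 1) =>
      Ψ (X 0 ^ (i.1 : ℕ) * X 1 ^ (i.2 : ℕ))) := by
    rintro _ ⟨p, rfl⟩
    let f := Ideal.Quotient.lift (relIdeal n) Ψ (relIdeal_le_ker hn hx hy)
    have hp : Ideal.Quotient.mk (relIdeal n) p ∈ (⊤ : Submodule ℤ _) := trivial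
    rw [← span_monomials_eq_top h1] at hp
    have := Submodule.mem_map_of_mem (f := f.toAddMonoidHom.toIntLinearMap) hp
    rw [Submodule.map_span, ← Set.range_comp] at this
    have e : (f.toAddMonoidHom.toIntLinearMap ∘ fun i : Fin n × Fin (2 * n - 1) =>
        Ideal.Quotient.mk (relIdeal n) (X 0) ^ (i.1 : ℕ) *
          Ideal.Quotient.mk (relIdeal n) (X 1) ^ (i.2 : ℕ)) =
        fun i => Ψ (X 0 ^ (i.1 : ℕ) * X 1 ^ (i.2 : ℕ)) := funext fun i => by
      change f _ = _
      beta_reduce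
      rw [← map_pow, ← map_pow, ← map_mul]
      rfl
    rw [e] at this
    exact this
  refine linearIndependent_of_card_le hLI ?_ ?_
  · rintro (⟨i, -⟩ | i)
    · exact hspan _ (cls_simple_mem_range hn hx hy i)
    · exact hspan _ ((coverOf_of_isCover (Nat.succ_pos _) i.1.2 (hπ i)).cls_mem_range
        (Nat.succ_pos _) i.1.2 hn hx hy)
  · have h := Fintype.card_le_of_injective
      (fun i : Fin (n - 1) × Fin n => (⟨(⟨i.1, by omega⟩, i.2), by
        have := i.1.2
        change (i.1 : ℕ) + 1 < n
        omega⟩ : {i : Fin n × Fin n // (i.1 : ℕ) + 1 < n}))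
      (fun i j h => by
        simp only [Subtype.mk.injEq, Prod.mk.injEq, Fin.mk.injEq] at h
        exact Prod.ext (Fin.ext h.1) h.2)
    rw [Fintype.card_sum]
    simp only [Fintype.card_prod, Fintype.card_fin] at h ⊢
    -- The simple modules V(l,r) with l < n account for (n-1)n classes, the projective covers for
    -- n^2.
    have e : n * (2 * n - 1) = (n - 1) * n + n * n := by
      obtain ⟨k, rfl⟩ : ∃ k, n = k + 1 := ⟨n - 1, by omega⟩
      rw [show 2 * (k + 1) - 1 = 2 * k + 1 by omega, Nat.add_sub_cancel]
      ring
    omega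

end Taft
end
-- The isomorphism and the basis
theorem theorem5p9 {K : Type*} [Field K] [IsAlgClosed K] (n : ℕ) [NeZero n] (hn : 2 < n)
    (q : K) [Fact (IsPrimitiveRoot q n)] :
    ∃ φ : (MvPolynomial (Fin 2) ℤ ⧸ Taft.relIdeal n) ≃+*
        Green.projectiveClassRing K (Taft.Hn n 1 q),
      (φ (Ideal.Quotient.mk _ (MvPolynomial.X 0)) : Green.GreenRing K (Taft.Hn n 1 q)) =
          Green.cls (Taft.V 1 (by omega) 1) ∧
      (φ (Ideal.Quotient.mk _ (MvPolynomial.X 1)) : Green.GreenRing K (Taft.Hn n 1 q)) =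
          Green.cls (Taft.V 2 (by omega) 0) ∧
      ∃ B : Module.Basis (Fin n × Fin (2 * n - 1)) ℤ
          (Green.projectiveClassRing K (Taft.Hn n 1 q)),
        ∀ (i : Fin n) (j : Fin (2 * n - 1)),
          (B (i, j) : Green.GreenRing K (Taft.Hn n 1 q)) =
            Green.cls (Taft.V 1 (by omega) 1) ^ (i : ℕ) *
              Green.cls (Taft.V 2 (by omega) 0) ^ (j : ℕ) := by
  have h1 : 1 ≤ n := by omega
  obtain ⟨Ψ, hx, hy⟩ := Taft.exists_ringHom_of_commute (Taft.cls_comm (q := q) h1 hn.le)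
  have hrange := Taft.range_eq_projectiveClassRing hn hx hy
  have hspan := Taft.span_monomials_eq_top h1
  have hLI := Taft.linearIndependent_monomials hn hx hy
  let f : (MvPolynomial (Fin 2) ℤ ⧸ Taft.relIdeal n) →+*
      Green.projectiveClassRing K (Taft.Hn n 1 q) :=
    Ideal.Quotient.lift (Taft.relIdeal n)
      (Ψ.codRestrict (Green.projectiveClassRing K (Taft.Hn n 1 q))
        fun p => hrange ▸ Ψ.mem_range_self p)
      fun a ha => Subtype.ext (Taft.relIdeal_le_ker hn hx hy a ha)
  let b : Fin n × Fin (2 * n - 1) → MvPolynomial (Fin 2) ℤ ⧸ Taft.relIdeal n := fun i =>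
    Ideal.Quotient.mk _ (MvPolynomial.X 0) ^ (i.1 : ℕ) *
      Ideal.Quotient.mk _ (MvPolynomial.X 1) ^ (i.2 : ℕ)
  have hf : ∀ p, (f (Ideal.Quotient.mk _ p) : Green.GreenRing K (Taft.Hn n 1 q)) = Ψ p :=
    fun p => rfl
  have hfb : ∀ i, (f (b i) : Green.GreenRing K (Taft.Hn n 1 q)) =
      Ψ (MvPolynomial.X 0 ^ (i.1 : ℕ) * MvPolynomial.X 1 ^ (i.2 : ℕ)) := fun i => by
    rw [← hf, map_mul (Ideal.Quotient.mk _), map_pow, map_pow]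
  let g := f.toAddMonoidHom.toIntLinearMap
  have hg : LinearIndependent ℤ (g ∘ b) :=
    LinearIndependent.of_comp
      (Green.projectiveClassRing K (Taft.Hn n 1 q)).subtype.toAddMonoidHom.toIntLinearMap
      (by rw [← funext hfb] at hLI; exact hLI)
  have hsurj : Function.Surjective f := by
    rintro ⟨z, hz⟩
    rw [← hrange] at hz
    obtain ⟨p, rfl⟩ := hz
    exact ⟨Ideal.Quotient.mk _ p, rfl⟩
  -- The family b spans the quotient and its image under g is independent. Hence g composed with the
  -- surjection of linear combinations of b is injective, and so is g.
  have hinj : Function.Injective g := by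
    refine Function.Injective.of_comp_right (g := Finsupp.linearCombination ℤ b) ?_ ?_
    · rw [← LinearMap.coe_comp, ← Finsupp.linearCombination_linear_comp]
      exact hg
    · rw [← LinearMap.range_eq_top, Finsupp.range_linearCombination]
      exact hspan
  let φ := RingEquiv.ofBijective f ⟨hinj, hsurj⟩
  refine ⟨φ, hx, hy, Module.Basis.mk hg ?_, fun i j => ?_⟩
  · rw [Set.range_comp, ← Submodule.map_span, hspan, Submodule.map_top,
      LinearMap.range_eq_top.2 hsurj]
  · rw [Module.Basis.mk_apply]
    refine (hfb (i, j)).trans ?_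
    rw [map_mul, map_pow, map_pow, hx, hy]
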